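/- **Setting.** All objects are of class $C^\infty$. Let $X$ be a manifold of dimension $n+1$ ($n\ge 0$) with a volume form $\eta$, $\pi:Y\to X$ a fibre bundle of rank $m$, $J^1\pi$ its first jet bundle with projections $\pi_1:J^1\pi\to X$, $\pi_{1,0}:J^1\pi\to Y$ and coordinates $(x^\mu,y^a,y^a_\mu)$; put $\theta^a=dy^a-y^a_\nu dx^\nu$, $d^nx_\mu=i_{\partial/\partial x^\mu}\eta$ and $S_\eta=\theta^a\wedge d^nx_\mu\otimes\partial/\partial y^a_\mu$. A contact $1$-form is a $1$-form $\theta$ on (an open subset of) $J^1\pi$ with $(j^1\phi)^*\theta=0$ for all local sections $\phi$ of $\pi$. For a vector-valued $1$-form $A$, $i_A\omega(v_1,\dots,v_p)=\sum_i(-1)^{i+1}\omega(Av_i,v_1,\dots,\widehat{v_i},\dots,v_p)$. The horizontal projector of a connection on a fibred manifold $p:B\to N$ is a smooth field $\mathbf h$ of projections of the tangent spaces of $B$ with $\ker\mathbf h=\ker Tp$. Let $L\in C^\infty(J^1\pi)$ be a regular Lagrangian, i.e. the matrix $\partial^2L/\partial y^a_\mu\partial y^b_\nu$ is non-degenerate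 at every point, and let $\Omega_L=-d(S_\eta^*dL+L\eta)$. Let $j:\mathcal C\hookrightarrow J^1\pi$ be an embedded submanifold of codimension $k$ such that $\pi_{1,0}|_{\mathcal C}:\mathcal C\to Y$ is a (surjective) fibre bundle. Let $F$ be a bundle of constraint forms: a rank $k$ bundle of $(n+1)$-forms along $\mathcal C$, locally spanned by $k$ smooth, pointwise independent forms $\Phi_\alpha=(C_\alpha)^\mu_a\,\theta^a\wedge d^nx_\mu$. Let $D$ be the distribution along $\mathcal C$ given by $$D(\gamma)=\{\zeta\in T_\gamma J^1\pi:\ \zeta \text{ is } \pi_{1,0}\text{-vertical and } i_\zeta\Omega_L\in F_\gamma\},$$ i.e. spanned by the $\pi_{1,0}$-vertical $\zeta_\alpha$ with $i_{\zeta_\alpha}\Omega_L=-\Phi_\alpha$. Let $\mathcal I(F)$ be the ideal of differential forms along $\mathcal C$ generated by $F$: the forms which locally are finite sums $\sum_i\lambda_i\wedge\Phi^i$ with smooth sections $\Phi^i$ of $F$ and arbitrary smooth forms $\lambda_i$ along $\mathcal C$. **Theorem.** Assume $D(\gamma)\cap T_\gamma\mathcal C=\{0\}$ for all $\gamma\in\mathcal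 C$. Let $\mathbf h$ be the horizontal projector of a connection on $\pi_1$ satisfying the free De Donder–Weyl equation $i_{\mathbf h}\Omega_L=n\Omega_L$ on $J^1\pi$. Then: 1. $T_\gamma J^1\pi=T_\gamma\mathcal C\oplus D(\gamma)$ for all $\gamma\in\mathcal C$; let $\mathcal P$ be the projector onto $T\mathcal C$ along $D$ (the nonholonomic projector). 2. Along $\mathcal C$, $\mathcal P\circ\mathbf h$ is a projector whose kernel consists of the $\pi_1$-vertical vectors, and it solves the nonholonomic De Donder–Weyl problem: $i_{\mathcal P\circ\mathbf h}\Omega_L-n\Omega_L\in\mathcal I(F)$ and $\operatorname{Im}(\mathcal P\circ\mathbf h)\subset T\mathcal C$. 3. $\mathcal P\circ\mathbf h$ restricts on $T\mathcal C$ to the horizontal projector $\mathbf h_{\mathcal P}$ of a (smooth) connection on $\pi_1|_{\mathcal C}:\mathcal C\to X$, and this connection is semi-holonomic: $i_{\mathbf h_{\mathcal P}}j^*\theta=0$ for every contact $1$-form $\theta$. -/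

import Mathlib

open scoped Manifold ContDiff Topology

noncomputable section

namespace JetField

universe uB

/-! ### Smooth fibre bundles -/

/-- A smooth fibre bundle `p : B → N` : `p` is a smooth surjection which, around each point of the
base, is smoothly trivial, i.e. looks like the projection of a product with some manifold `M`
modelled on `K`. The manifolds `N` and `B` are modelled on the vector spaces `E` and `G`. -/
class IsSmoothFibreBundle (E G K : Type*)
    [NormedAddCommGroup E] [NormedSpace ℝ E] [NormedAddCommGroup G] [NormedSpace ℝ G]
    [NormedAddCommGroup K] [NormedSpace ℝ K]
    {N : Type*} {B : Type uB} [TopologicalSpace N] [ChartedSpace E N]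
    [TopologicalSpace B] [ChartedSpace G B] (p : B → N) : Prop where
  smooth : ContMDiff 𝓘(ℝ, G) 𝓘(ℝ, E) ∞ p
  surjective : Function.Surjective p
  locally_trivial : ∀ x : N, ∃ (M : Type uB) (_ : TopologicalSpace M) (_ : ChartedSpace K M)
    (_ : IsManifold 𝓘(ℝ, K) ∞ M) (t : Bundle.Trivialization M p), x ∈ t.baseSet ∧
      ContMDiffOn 𝓘(ℝ, G) (𝓘(ℝ, E).prod 𝓘(ℝ, K)) ∞ t t.source ∧
      ContMDiffOn (𝓘(ℝ, E).prod 𝓘(ℝ, K)) 𝓘(ℝ, G) ∞ t.toOpenPartialHomeomorph.symm t.target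

/-- The derivative `T_x f` of a map between manifolds modelled on `G` and `H`. As everywhere in this
file, the tangent space `TangentSpace 𝓘(ℝ, G) x` is regarded as the vector space `G`, to which it
is equal by definition. -/
def dmap (G H : Type*) [NormedAddCommGroup G] [NormedSpace ℝ G] [NormedAddCommGroup H]
    [NormedSpace ℝ H] {M M' : Type*} [TopologicalSpace M] [ChartedSpace G M]
    [TopologicalSpace M'] [ChartedSpace H M'] (f : M → M') (x : M) : G →L[ℝ] H :=
  mfderiv 𝓘(ℝ, G) 𝓘(ℝ, H) f x

section Bundle

variable {E F : Type*} [NormedAddCommGroup E] [NormedSpace ℝ E]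
  [NormedAddCommGroup F] [NormedSpace ℝ F]
  {X Y : Type*} [TopologicalSpace X] [ChartedSpace E X]
  [TopologicalSpace Y] [ChartedSpace (E × F) Y]

/-- Local bundle coordinates `(x, y)` on `Y` adapted to `π`, together with the underlying
coordinates `x` on `X`. -/
structure AdaptedChart (E F : Type*) [NormedAddCommGroup E] [NormedSpace ℝ E]
    [NormedAddCommGroup F] [NormedSpace ℝ F]
    {X Y : Type*} [TopologicalSpace X] [ChartedSpace E X]
    [TopologicalSpace Y] [ChartedSpace (E × F) Y] (π : Y → X) where
  tot : OpenPartialHomeomorph Y (E × F)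
  base : OpenPartialHomeomorph X E
  tot_smooth : ContMDiffOn 𝓘(ℝ, E × F) 𝓘(ℝ, E × F) ∞ tot tot.source
  tot_symm_smooth : ContMDiffOn 𝓘(ℝ, E × F) 𝓘(ℝ, E × F) ∞ tot.symm tot.target
  base_smooth : ContMDiffOn 𝓘(ℝ, E) 𝓘(ℝ, E) ∞ base base.source
  base_symm_smooth : ContMDiffOn 𝓘(ℝ, E) 𝓘(ℝ, E) ∞ base.symm base.target
  proj_mem : ∀ y ∈ tot.source, π y ∈ base.source
  base_proj : ∀ y ∈ tot.source, base (π y) = (tot y).1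

theorem exists_adaptedChart [IsManifold 𝓘(ℝ, E) ∞ X] [IsManifold 𝓘(ℝ, E × F) ∞ Y]
    (π : Y → X) [hπ : IsSmoothFibreBundle E (E × F) F π] (y : Y) :
    ∃ a : AdaptedChart E F π, y ∈ a.tot.source := by
  obtain ⟨M, _, _, _, t, ht, h1, h2⟩ := hπ.locally_trivial (π y)
  have hy : y ∈ t.source := by rw [t.source_eq]; exact ht
  have hprod : ContMDiffOn (𝓘(ℝ, E).prod 𝓘(ℝ, F)) 𝓘(ℝ, E × F) ∞
      ((chartAt E (π y)).prod (chartAt F (t y).2))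
      ((chartAt E (π y)).prod (chartAt F (t y).2)).source := by
    rw [modelWithCornersSelf_prod, ← chartedSpaceSelf_prod]
    exact (contMDiffOn_chart (I := 𝓘(ℝ, E)) (x := π y)).prodMap
      (contMDiffOn_chart (I := 𝓘(ℝ, F)) (x := (t y).2))
  have hprod' : ContMDiffOn 𝓘(ℝ, E × F) (𝓘(ℝ, E).prod 𝓘(ℝ, F)) ∞
      ((chartAt E (π y)).prod (chartAt F (t y).2)).symm
      ((chartAt E (π y)).prod (chartAt F (t y).2)).target := by
    rw [modelWithCornersSelf_prod, ← chartedSpaceSelf_prod]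
    exact (contMDiffOn_chart_symm (I := 𝓘(ℝ, E)) (x := π y)).prodMap
      (contMDiffOn_chart_symm (I := 𝓘(ℝ, F)) (x := (t y).2))
  refine ⟨⟨t.toOpenPartialHomeomorph.trans ((chartAt E (π y)).prod (chartAt F (t y).2)),
    chartAt E (π y), ?_, ?_, contMDiffOn_chart, contMDiffOn_chart_symm, ?_, ?_⟩, ?_⟩
  · rw [OpenPartialHomeomorph.coe_trans, OpenPartialHomeomorph.trans_source]
    exact hprod.comp (h1.mono Set.inter_subset_left) (fun z hz => hz.2)
  · rw [OpenPartialHomeomorph.coe_trans_symm, OpenPartialHomeomorph.trans_target]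
    exact h2.comp (hprod'.mono Set.inter_subset_left) (fun z hz => hz.2)
  · intro z hz
    have h := hz.2
    have hz1 : (t z).1 = π z := t.proj_toFun z hz.1
    have h3 : (t z).1 ∈ (chartAt E (π y)).source := h.1
    rwa [hz1] at h3
  · intro z hz
    have hz1 : (t z).1 = π z := t.proj_toFun z hz.1
    rw [← hz1]; rfl
  · refine ⟨hy, ?_, ?_⟩
    · have hz1 : (t y).1 = π y := t.proj_toFun y hy
      change (t y).1 ∈ _
      rw [hz1]; exact mem_chart_source _ _
    · exact mem_chart_source _ _

/-! ### The first jet bundle -/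

/-- The first jet bundle of `π : Y → X`. The jet `j¹ₓφ` of a local section `φ` is represented by
the point `φ x` and the linear map `Tₓφ : T_x X → T_{φ x} Y`, which is a right inverse of `Tπ`.
(The tangent space at any point of a manifold modelled on `G` is, as a type, `G` itself.) -/
structure J1 (E F : Type*) [NormedAddCommGroup E] [NormedSpace ℝ E]
    [NormedAddCommGroup F] [NormedSpace ℝ F]
    {X Y : Type*} [TopologicalSpace X] [ChartedSpace E X]
    [TopologicalSpace Y] [ChartedSpace (E × F) Y] (π : Y → X) where
  pt : Y
  lin : E →L[ℝ] E × F
  proj_lin : ∀ v : E, dmap (E × F) E π pt (lin v) = v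

/-- The model space of `J¹π`, with elements `((x, y), (y_μ))`. -/
abbrev JModel (E F : Type*) [NormedAddCommGroup E] [NormedSpace ℝ E]
    [NormedAddCommGroup F] [NormedSpace ℝ F] := (E × F) × (E →L[ℝ] F)

namespace AdaptedChart

variable {π : Y → X} (a : AdaptedChart E F π)

/-- Derivative of the bundle coordinates. -/
def dTot (y : Y) : E × F →L[ℝ] E × F := dmap (E × F) (E × F) a.tot y

def dTotSymm (z : E × F) : E × F →L[ℝ] E × F :=
  dmap (E × F) (E × F) a.tot.symm z

def dBase (x : X) : E →L[ℝ] E := dmap E E a.base x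

def dBaseSymm (u : E) : E →L[ℝ] E := dmap E E a.base.symm u

theorem tot_mdiff : a.tot.MDifferentiable 𝓘(ℝ, E × F) 𝓘(ℝ, E × F) :=
  ⟨a.tot_smooth.mdifferentiableOn (by simp), a.tot_symm_smooth.mdifferentiableOn (by simp)⟩

theorem base_mdiff : a.base.MDifferentiable 𝓘(ℝ, E) 𝓘(ℝ, E) :=
  ⟨a.base_smooth.mdifferentiableOn (by simp), a.base_symm_smooth.mdifferentiableOn (by simp)⟩

theorem dTotSymm_dTot {y : Y} (hy : y ∈ a.tot.source) (v : E × F) :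
    a.dTotSymm (a.tot y) (a.dTot y v) = v :=
  congrArg (fun f : E × F →L[ℝ] E × F => f v) (a.tot_mdiff.symm_comp_deriv hy)

theorem dTot_dTotSymm {z : E × F} (hz : z ∈ a.tot.target) (v : E × F) :
    a.dTot (a.tot.symm z) (a.dTotSymm z v) = v :=
  congrArg (fun f : E × F →L[ℝ] E × F => f v) (a.tot_mdiff.comp_symm_deriv hz)

theorem dBaseSymm_dBase {x : X} (hx : x ∈ a.base.source) (v : E) :
    a.dBaseSymm (a.base x) (a.dBase x v) = v :=
  congrArg (fun f : E →L[ℝ] E => f v) (a.base_mdiff.symm_comp_deriv hx)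

theorem dBase_dBaseSymm {x : X} (hx : x ∈ a.base.source) (v : E) :
    a.dBase x (a.dBaseSymm (a.base x) v) = v := by
  have h := congrArg (fun f : E →L[ℝ] E => f v)
    (a.base_mdiff.comp_symm_deriv (a.base.map_source hx))
  have h2 : a.base.symm (a.base x) = x := a.base.left_inv hx
  have h3 : a.dBase (a.base.symm (a.base x)) (a.dBaseSymm (a.base x) v) = v := h
  rwa [h2] at h3

/-- Differentiating `base ∘ π = fst ∘ tot`. -/
theorem dBase_dπ {y : Y} (hπ : MDifferentiableAt 𝓘(ℝ, E × F) 𝓘(ℝ, E) π y)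
    (hy : y ∈ a.tot.source) (v : E × F) :
    a.dBase (π y) (dmap (E × F) E π y v) = (a.dTot y v).1 := by
  have h1 : mfderiv 𝓘(ℝ, E × F) 𝓘(ℝ, E) (a.base ∘ π) y
      = mfderiv 𝓘(ℝ, E × F) 𝓘(ℝ, E) ((ContinuousLinearMap.fst ℝ E F) ∘ a.tot) y := by
    apply Filter.EventuallyEq.mfderiv_eq
    filter_upwards [a.tot.open_source.mem_nhds hy] with z hz
    exact a.base_proj z hz
  have hb : MDifferentiableAt 𝓘(ℝ, E) 𝓘(ℝ, E) a.base (π y) :=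
    a.base_mdiff.mdifferentiableAt (a.proj_mem y hy)
  rw [mfderiv_comp y hb hπ, mfderiv_comp y
    (ContinuousLinearMap.fst ℝ E F).differentiableAt.mdifferentiableAt
    (a.tot_mdiff.mdifferentiableAt hy), mfderiv_eq_fderiv, ContinuousLinearMap.fderiv] at h1
  exact congrArg (fun f : E × F →L[ℝ] E => f v) h1

open Classical in
/-- The coordinates `((x, y), (y_μ))` on `J¹π` induced by adapted coordinates on `Y`. The jet
`γ₀` only serves as a default value outside the target. -/
def jetChart (hπ : MDifferentiable 𝓘(ℝ, E × F) 𝓘(ℝ, E) π) (γ₀ : J1 E F π) :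
    PartialEquiv (J1 E F π) (JModel E F) where
  toFun γ := (a.tot γ.pt, ContinuousLinearMap.snd ℝ E F ∘L a.dTot γ.pt ∘L γ.lin ∘L
    a.dBaseSymm (a.base (π γ.pt)))
  invFun z := if h : z.1 ∈ a.tot.target then
      { pt := a.tot.symm z.1
        lin := a.dTotSymm z.1 ∘L ((ContinuousLinearMap.id ℝ E).prod z.2) ∘L
          a.dBase (π (a.tot.symm z.1))
        proj_lin := fun v => by
          have hy := a.tot.map_target h
          have hx := a.proj_mem _ hy
          have key : ∀ w, a.dBaseSymm (a.base (π (a.tot.symm z.1)))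
              (a.dBase (π (a.tot.symm z.1)) w) = w := a.dBaseSymm_dBase hx
          rw [← key (dmap (E × F) E π (a.tot.symm z.1) _),
            a.dBase_dπ (hπ _) hy]
          simp only [ContinuousLinearMap.comp_apply]
          rw [a.dTot_dTotSymm h]
          exact key v }
    else γ₀
  source := {γ | γ.pt ∈ a.tot.source}
  target := {z | z.1 ∈ a.tot.target}
  map_source' γ hγ := a.tot.map_source hγ
  map_target' z hz := by
    have hz' : z.1 ∈ a.tot.target := hz
    simp only [hz', dif_pos, Set.mem_ofPred_eq]
    exact a.tot.map_target hz'
  left_inv' γ hγ := by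
    have hγ' : γ.pt ∈ a.tot.source := hγ
    have hx := a.proj_mem _ hγ'
    have h0 : a.tot γ.pt ∈ a.tot.target := a.tot.map_source hγ'
    have h1 : a.tot.symm (a.tot γ.pt) = γ.pt := a.tot.left_inv hγ'
    simp only [h0, dif_pos]
    obtain ⟨y, A, hA⟩ := γ
    simp only at h1 hγ' hx
    congr 1
    ext1 v
    simp only [h1, ContinuousLinearMap.comp_apply]
    have h2 : ((ContinuousLinearMap.id ℝ E).prod (ContinuousLinearMap.snd ℝ E F ∘L a.dTot y ∘L
        A ∘L a.dBaseSymm (a.base (π y)))) (a.dBase (π y) v) = a.dTot y (A v) := by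
      ext1
      · rw [← a.dBase_dπ (hπ y) hγ', hA]; rfl
      · simp only [ContinuousLinearMap.prod_apply, ContinuousLinearMap.comp_apply]
        rw [a.dBaseSymm_dBase hx]; rfl
    rw [h2, a.dTotSymm_dTot hγ']
  right_inv' z hz := by
    have hz' : z.1 ∈ a.tot.target := hz
    have hy := a.tot.map_target hz'
    have hx := a.proj_mem _ hy
    simp only [hz', dif_pos]
    ext1
    · exact a.tot.right_inv hz'
    · ext1 v
      simp only [ContinuousLinearMap.comp_apply]
      rw [a.dBase_dBaseSymm hx, a.dTot_dTotSymm hz']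
      rfl

end AdaptedChart

namespace AdaptedChart

variable {π : Y → X} (a b : AdaptedChart E F π)

/-- The coordinate change between two adapted charts of `Y`. -/
def trans (z : E × F) : E × F := b.tot (a.tot.symm z)

/-- The coordinate change on `X` (from the coordinates of `b` to those of `a`). -/
def baseTrans (u : E) : E := a.base (b.base.symm u)

theorem contDiffOn_trans :
    ContDiffOn ℝ ∞ (a.trans b) (a.tot.symm.trans b.tot).source :=
  (b.tot_smooth.comp (a.tot_symm_smooth.mono Set.inter_subset_left)
    (fun _ hz => hz.2)).contDiffOn

theorem contDiffOn_baseTrans :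
    ContDiffOn ℝ ∞ (a.baseTrans b) (b.base.symm.trans a.base).source :=
  (a.base_smooth.comp (b.base_symm_smooth.mono Set.inter_subset_left)
    (fun _ hz => hz.2)).contDiffOn

theorem isOpen_trans_source : IsOpen (a.tot.symm.trans b.tot).source :=
  (a.tot.symm.trans b.tot).open_source

/-- The coordinate change of `J¹π`. -/
def jetTrans (z : JModel E F) : JModel E F :=
  (a.trans b z.1, ContinuousLinearMap.snd ℝ E F ∘L fderiv ℝ (a.trans b) z.1 ∘L
    ((ContinuousLinearMap.id ℝ E).prod z.2) ∘L fderiv ℝ (a.baseTrans b) (a.trans b z.1).1)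

theorem trans_fst_mem {z : E × F} (hz : z ∈ (a.tot.symm.trans b.tot).source) :
    (a.trans b z).1 ∈ (b.base.symm.trans a.base).source := by
  have h1 : z ∈ a.tot.target := hz.1
  have h2 : a.tot.symm z ∈ b.tot.source := hz.2
  have h3 : (a.trans b z).1 = b.base (π (a.tot.symm z)) := (b.base_proj _ h2).symm
  rw [h3]
  refine ⟨b.base.map_source (b.proj_mem _ h2), ?_⟩
  change b.base.symm (b.base _) ∈ a.base.source
  rw [b.base.left_inv (b.proj_mem _ h2)]
  exact a.proj_mem _ (a.tot.map_target h1)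

theorem contDiffOn_jetTrans :
    ContDiffOn ℝ ∞ (a.jetTrans b) {z | z.1 ∈ (a.tot.symm.trans b.tot).source} := by
  have hfst : Set.MapsTo (Prod.fst : JModel E F → E × F)
      {z | z.1 ∈ (a.tot.symm.trans b.tot).source} (a.tot.symm.trans b.tot).source :=
    fun z hz => hz
  have h1 : ContDiffOn ℝ ∞ (fun z : JModel E F => a.trans b z.1)
      {z | z.1 ∈ (a.tot.symm.trans b.tot).source} :=
    (a.contDiffOn_trans b).comp contDiffOn_fst hfst
  have h2 : ContDiffOn ℝ ∞ (fun z : JModel E F => fderiv ℝ (a.trans b) z.1)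
      {z | z.1 ∈ (a.tot.symm.trans b.tot).source} :=
    ((a.contDiffOn_trans b).fderiv_of_isOpen (m := ∞) (a.isOpen_trans_source b)
      (by simp)).comp contDiffOn_fst hfst
  have h3 : ContDiffOn ℝ ∞ (fun z : JModel E F => fderiv ℝ (a.baseTrans b) (a.trans b z.1).1)
      {z | z.1 ∈ (a.tot.symm.trans b.tot).source} :=
    ((a.contDiffOn_baseTrans b).fderiv_of_isOpen (m := ∞)
      (b.base.symm.trans a.base).open_source (by simp)).comp (contDiff_fst.comp_contDiffOn h1)
      (fun z hz => a.trans_fst_mem b hz)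
  have h4 : ContDiffOn ℝ ∞
      (fun z : JModel E F => (ContinuousLinearMap.id ℝ E).prod z.2)
      {z | z.1 ∈ (a.tot.symm.trans b.tot).source} := by
    have : (fun z : JModel E F => (ContinuousLinearMap.id ℝ E).prod z.2) =
        fun z : JModel E F => ContinuousLinearMap.inl ℝ E F
          + (ContinuousLinearMap.inr ℝ E F) ∘L z.2 := by
      funext z; ext v <;> simp
    rw [this]
    exact contDiffOn_const.add (contDiffOn_const.clm_comp contDiffOn_snd)
  exact h1.prodMk (contDiffOn_const.clm_comp (h2.clm_comp (h4.clm_comp h3)))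

theorem jetChart_trans_source (hπ : MDifferentiable 𝓘(ℝ, E × F) 𝓘(ℝ, E) π) (γ₀ γ₁ : J1 E F π) :
    ((a.jetChart hπ γ₀).symm.trans (b.jetChart hπ γ₁)).source =
      {z | z.1 ∈ (a.tot.symm.trans b.tot).source} := by
  ext z
  refine and_congr_right fun (h : z.1 ∈ a.tot.target) => ?_
  simp [jetChart, h]

theorem jetChart_trans_eqOn (hπ : MDifferentiable 𝓘(ℝ, E × F) 𝓘(ℝ, E) π) (γ₀ γ₁ : J1 E F π) :
    Set.EqOn ((a.jetChart hπ γ₀).symm.trans (b.jetChart hπ γ₁)) (a.jetTrans b)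
      {z | z.1 ∈ (a.tot.symm.trans b.tot).source} := by
  intro z hz
  have h1 : z.1 ∈ a.tot.target := hz.1
  have h2 : a.tot.symm z.1 ∈ b.tot.source := hz.2
  have h3 : b.base (π (a.tot.symm z.1)) = (a.trans b z.1).1 := b.base_proj _ h2
  have h4 : b.base.symm (b.base (π (a.tot.symm z.1))) = π (a.tot.symm z.1) :=
    b.base.left_inv (b.proj_mem _ h2)
  have h5 : fderiv ℝ (a.trans b) z.1 = b.dTot (a.tot.symm z.1) ∘L a.dTotSymm z.1 := by
    rw [← mfderiv_eq_fderiv]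
    exact mfderiv_comp z.1 (b.tot_mdiff.mdifferentiableAt h2)
      (a.tot_mdiff.mdifferentiableAt_symm h1)
  have h6 : fderiv ℝ (a.baseTrans b) (b.base (π (a.tot.symm z.1))) =
      a.dBase (π (a.tot.symm z.1)) ∘L b.dBaseSymm (b.base (π (a.tot.symm z.1))) := by
    rw [← mfderiv_eq_fderiv]
    have hm : MDifferentiableAt 𝓘(ℝ, E) 𝓘(ℝ, E) a.base
        (b.base.symm (b.base (π (a.tot.symm z.1)))) := by
      rw [h4]; exact a.base_mdiff.mdifferentiableAt (a.proj_mem _ (a.tot.map_target h1))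
    have := mfderiv_comp (b.base (π (a.tot.symm z.1))) hm
      (b.base_mdiff.mdifferentiableAt_symm (b.base.map_source (b.proj_mem _ h2)))
    have h7 : dmap E E (a.baseTrans b) (b.base (π (a.tot.symm z.1))) =
      a.dBase (b.base.symm (b.base (π (a.tot.symm z.1)))) ∘L
        b.dBaseSymm (b.base (π (a.tot.symm z.1))) := this
    rw [h4] at h7
    exact h7
  change (b.jetChart hπ γ₁) ((a.jetChart hπ γ₀).symm z) = _
  simp only [jetChart, PartialEquiv.coe_symm_mk, h1, dif_pos, jetTrans, ← h3, h5, h6]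
  rfl

end AdaptedChart

theorem mdiff_proj (π : Y → X) [hπ : IsSmoothFibreBundle E (E × F) F π] :
    MDifferentiable 𝓘(ℝ, E × F) 𝓘(ℝ, E) π :=
  hπ.smooth.mdifferentiable (by simp)

section Manifold

variable [IsManifold 𝓘(ℝ, E) ∞ X] [IsManifold 𝓘(ℝ, E × F) ∞ Y]
  (π : Y → X) [hπ : IsSmoothFibreBundle E (E × F) F π]

/-- The atlas of `J¹π` made of all charts induced by adapted charts of `Y`. -/
def jetCore : ChartedSpaceCore (JModel E F) (J1 E F π) where
  atlas := {c | ∃ (a : AdaptedChart E F π) (γ₀ : J1 E F π), c = a.jetChart (mdiff_proj π) γ₀}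
  chartAt γ := (exists_adaptedChart π γ.pt).choose.jetChart (mdiff_proj π) γ
  mem_chart_source γ := (exists_adaptedChart π γ.pt).choose_spec
  chart_mem_atlas γ := ⟨_, _, rfl⟩
  open_source := by
    rintro _ _ ⟨a, γ₀, rfl⟩ ⟨b, γ₁, rfl⟩
    rw [a.jetChart_trans_source b]
    exact (a.isOpen_trans_source b).preimage continuous_fst
  continuousOn_toFun := by
    rintro _ _ ⟨a, γ₀, rfl⟩ ⟨b, γ₁, rfl⟩
    rw [a.jetChart_trans_source b]
    exact (a.contDiffOn_jetTrans b).continuousOn.congr (a.jetChart_trans_eqOn b _ _ _)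

instance : TopologicalSpace (J1 E F π) := (jetCore π).toTopologicalSpace

instance : ChartedSpace (JModel E F) (J1 E F π) := (jetCore π).toChartedSpace

instance : IsManifold 𝓘(ℝ, JModel E F) ∞ (J1 E F π) := by
  apply isManifold_of_contDiffOn
  intro e e' he he'
  obtain ⟨c, ⟨⟨a, γ₀, rfl⟩, rfl⟩⟩ : ∃ c, ∃ hc : c ∈ (jetCore π).atlas,
      e = (jetCore π).openPartialHomeomorph c hc := by
    simpa [atlas, ChartedSpace.atlas] using he
  obtain ⟨c', ⟨⟨b, γ₁, rfl⟩, rfl⟩⟩ : ∃ c, ∃ hc : c ∈ (jetCore π).atlas,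
      e' = (jetCore π).openPartialHomeomorph c hc := by
    simpa [atlas, ChartedSpace.atlas] using he'
  have h1 := a.jetChart_trans_source b (mdiff_proj π) γ₀ γ₁
  have h2 := (a.contDiffOn_jetTrans b).congr (a.jetChart_trans_eqOn b (mdiff_proj π) γ₀ γ₁)
  rw [← h1] at h2
  simp only [modelWithCornersSelf_coe, modelWithCornersSelf_coe_symm, Set.range_id,
    Set.inter_univ, Set.preimage_id, Function.comp_id, Function.id_comp]
  exact h2

end Manifold

end Bundle

/-! ### Differential forms and connections on manifolds -/

section Forms

variable {G : Type*} [NormedAddCommGroup G] [NormedSpace ℝ G]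
  {M : Type*} [TopologicalSpace M] [ChartedSpace G M] {p : ℕ}

/-- The local expression, in the preferred chart at `x₀`, of a differential `p`-form `ψ` on a
manifold modelled on `G`. -/
def formInChart (x₀ : M) (ψ : M → G [⋀^Fin p]→L[ℝ] ℝ) (u : G) : G [⋀^Fin p]→L[ℝ] ℝ :=
  (ψ ((chartAt G x₀).symm u)).compContinuousLinearMap (dmap G G (chartAt G x₀).symm u)

/-- The exterior derivative of a differential form on a manifold. -/
def extD (ψ : M → G [⋀^Fin p]→L[ℝ] ℝ) (x : M) : G [⋀^Fin (p + 1)]→L[ℝ] ℝ :=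
  (extDeriv (formInChart x ψ) (chartAt G x x)).compContinuousLinearMap
    (dmap G G (chartAt G x) x)

/-- Smoothness on the set `U ⊆ S` of a `p`-form `ψ` along a map `j : S → M`, i.e. a section of the
pullback by `j` of the bundle of `p`-forms of `M`: near each point of `U` the components of `ψ` in a
coordinate frame of `M` are smooth functions on `S`. -/
def SmoothFormAlong (H : Type*) [NormedAddCommGroup H] [NormedSpace ℝ H]
    {S : Type*} [TopologicalSpace S] [ChartedSpace H S] (j : S → M)
    (ψ : S → G [⋀^Fin p]→L[ℝ] ℝ) (U : Set S) : Prop :=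
  ∀ s₀ ∈ U, ContMDiffAt 𝓘(ℝ, H) 𝓘(ℝ, G [⋀^Fin p]→L[ℝ] ℝ) ∞
    (fun s => (ψ s).compContinuousLinearMap
      (dmap G G (chartAt G (j s₀)).symm (chartAt G (j s₀) (j s)))) s₀

/-- Smoothness of a differential form on the open set `U ⊆ M`. -/
def SmoothForm (ψ : M → G [⋀^Fin p]→L[ℝ] ℝ) (U : Set M) : Prop :=
  SmoothFormAlong G (id : M → M) ψ U

/-- The derivation `i_A ψ` for a vector-valued `1`-form `A`:
`(i_A ψ)(v₀, …, v_p) = ∑ i, (-1) ^ i * ψ (A v_i, v₀, …, v̂_i, …, v_p)`. -/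
def insertEnd (A : G →L[ℝ] G) (ψ : G [⋀^Fin (p + 1)]→L[ℝ] ℝ) : G [⋀^Fin (p + 1)]→L[ℝ] ℝ :=
  ContinuousAlternatingMap.alternatizeUncurryFin (ψ.curryLeft ∘L A)

/-- The exterior product `α ∧ Φ` of a covector with a `p`-form:
`(α ∧ Φ)(v₀, …, v_p) = ∑ i, (-1) ^ i * α v_i * Φ (v₀, …, v̂_i, …, v_p)`. -/
def covWedge (α : G →L[ℝ] ℝ) (Φ : G [⋀^Fin p]→L[ℝ] ℝ) : G [⋀^Fin (p + 1)]→L[ℝ] ℝ :=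
  ContinuousAlternatingMap.alternatizeUncurryFin (α.smulRight Φ)

/-- A `1`-form at a point, as a covector. -/
def toCovector (θ : G [⋀^Fin 1]→L[ℝ] ℝ) : G →L[ℝ] ℝ :=
  (ContinuousAlternatingMap.ofSubsingleton ℝ G ℝ (0 : Fin 1)).symm θ

/-- `h` is the horizontal projector of an Ehresmann connection on `p : B → N`: a smooth field of
projections of the tangent spaces of `B`, whose kernels are the spaces of `p`-vertical vectors. -/
structure IsHorizontalProjector (E G : Type*) [NormedAddCommGroup E] [NormedSpace ℝ E]
    [NormedAddCommGroup G] [NormedSpace ℝ G]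
    {N B : Type*} [TopologicalSpace N] [ChartedSpace E N]
    [TopologicalSpace B] [ChartedSpace G B] [IsManifold 𝓘(ℝ, G) ∞ B]
    (p : B → N) (h : B → G →L[ℝ] G) : Prop where
  smooth : ContMDiff 𝓘(ℝ, G) (𝓘(ℝ, G).prod 𝓘(ℝ, G →L[ℝ] G)) ∞
    (fun b => Bundle.TotalSpace.mk' (G →L[ℝ] G)
      (E := fun b : B => TangentSpace 𝓘(ℝ, G) b →L[ℝ] TangentSpace 𝓘(ℝ, G) b) b (h b))
  idem : ∀ b v, h b (h b v) = h b v
  ker_eq : ∀ b v, h b v = 0 ↔ dmap G E p b v = 0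

end Forms

/-! ### Lagrangian field theory on `J¹π` -/

section Field

variable {E F : Type*} [NormedAddCommGroup E] [NormedSpace ℝ E]
  [NormedAddCommGroup F] [NormedSpace ℝ F]
  {X Y : Type*} [TopologicalSpace X] [ChartedSpace E X]
  [TopologicalSpace Y] [ChartedSpace (E × F) Y]
  [IsManifold 𝓘(ℝ, E) ∞ X] [IsManifold 𝓘(ℝ, E × F) ∞ Y]
  {π : Y → X} [IsSmoothFibreBundle E (E × F) F π]

/-- The projection `π₁ : J¹π → X`. The projection `π₁₀ : J¹π → Y` is `J1.pt`. -/
def J1.base (γ : J1 E F π) : X := π γ.pt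

/-- The vector space `Hom(T_x X, V_y π)`, on which the fibre of `J¹π` over `y` is modelled. -/
def vertHom (γ : J1 E F π) : Submodule ℝ (E →L[ℝ] E × F) where
  carrier := {A | ∀ v, dmap (E × F) E π γ.pt (A v) = 0}
  add_mem' := fun ha hb v => by simp [ha v, hb v]
  zero_mem' := fun v => by simp
  smul_mem' := fun c a ha v => by simp [ha v]

/-- The affine structure of the fibres of `J¹π → Y`. -/
def J1.add (γ : J1 E F π) (A : vertHom γ) : J1 E F π where
  pt := γ.pt
  lin := γ.lin + A.1
  proj_lin := fun v => by
    have h : dmap (E × F) E π γ.pt (A.1 v) = 0 := A.2 v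
    simp [γ.proj_lin v, h]

/-- The vertical lift `Hom(T_x X, V_y π) → T_γ J¹π`; it sends `dx^μ ⊗ ∂/∂y^a` to `∂/∂y^a_μ`. -/
def vertLift (γ : J1 E F π) : vertHom γ →L[ℝ] JModel E F :=
  dmap (vertHom γ) (JModel E F) (fun A : vertHom γ => γ.add A) 0

/-- The canonical contact form `θ = θ^a ⊗ ∂/∂y^a`, `θ^a = dy^a - y^a_ν dx^ν`, with values in the
vertical vectors of `Y`: `θ v = Tπ₁₀ v - γ (Tπ (Tπ₁₀ v))`. -/
def contactMap (γ : J1 E F π) : JModel E F →L[ℝ] E × F :=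
  dmap (JModel E F) (E × F) J1.pt γ -
    γ.lin ∘L dmap (E × F) E π γ.pt ∘L dmap (JModel E F) (E × F) J1.pt γ

theorem proj_contactMap (γ : J1 E F π) (v : JModel E F) :
    dmap (E × F) E π γ.pt (contactMap γ v) = 0 := by
  simp [contactMap, γ.proj_lin]

/-- For a covector `ε` on `X`, the map `v ↦ ε ⊗ θ v`. -/
def contactTensor (γ : J1 E F π) (ε : E →L[ℝ] ℝ) : JModel E F →L[ℝ] vertHom γ :=
  (ContinuousLinearMap.smulRightL ℝ E (E × F) ε ∘L contactMap γ).codRestrict (vertHom γ)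
    (fun v w => by simp [proj_contactMap])

variable [FiniteDimensional ℝ E] {n : ℕ}

/-- The `(n+1)`-form `S_η^* α = ⟨S_η, α⟩` on `T_γ J¹π`, for `α` in the dual of `T_γ J¹π` and
`S_η = θ^a ∧ dⁿx_μ ⊗ ∂/∂y^a_μ` the vertical endomorphism, with `dⁿx_μ = i_{∂_μ} η` for a basis
`∂_μ` of `T_x X`. -/
def vertEndoPullback (η : X → E [⋀^Fin (n + 1)]→L[ℝ] ℝ) (γ : J1 E F π)
    (α : JModel E F →L[ℝ] ℝ) : JModel E F [⋀^Fin (n + 1)]→L[ℝ] ℝ :=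
  ∑ μ, covWedge
    (α ∘L vertLift γ ∘L
      contactTensor γ (LinearMap.toContinuousLinearMap ((Module.finBasis ℝ E).coord μ)))
    (((η γ.base).curryLeft (Module.finBasis ℝ E μ)).compContinuousLinearMap
      (dmap (JModel E F) E (J1.base : J1 E F π → X) γ))

/-- `Θ_L = S_η^* dL + L η`. -/
def cartanForm (η : X → E [⋀^Fin (n + 1)]→L[ℝ] ℝ) (L : J1 E F π → ℝ) (γ : J1 E F π) :
    JModel E F [⋀^Fin (n + 1)]→L[ℝ] ℝ :=
  vertEndoPullback η γ (dmap (JModel E F) ℝ L γ) +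
    L γ • (η γ.base).compContinuousLinearMap
      (dmap (JModel E F) E (J1.base : J1 E F π → X) γ)

/-- The Poincaré–Cartan form `Ω_L = -dΘ_L`. -/
def poincareCartan (η : X → E [⋀^Fin (n + 1)]→L[ℝ] ℝ) (L : J1 E F π → ℝ) (γ : J1 E F π) :
    JModel E F [⋀^Fin (n + 2)]→L[ℝ] ℝ :=
  -extD (cartanForm η L) γ

/-- The Hessian of `f` at the origin is a non-degenerate bilinear form. -/
def HasNondegenerateHessian {V : Type*} [NormedAddCommGroup V] [NormedSpace ℝ V] (f : V → ℝ) :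
    Prop :=
  ∀ v : V, fderiv ℝ (fderiv ℝ f) 0 v = 0 → v = 0

/-- Regularity of the Lagrangian: the fibre Hessian `∂²L/∂y^a_μ∂y^b_ν` is non-degenerate. -/
def IsRegularLagrangian (L : J1 E F π → ℝ) : Prop :=
  ∀ γ : J1 E F π, HasNondegenerateHessian (fun A : vertHom γ => L (γ.add A))

/-- `σ` agrees on `U` with the first jet prolongation `j¹φ` of the local section `φ : U → Y`. -/
structure IsJetProlongation (U : Set X) (φ : X → Y) (σ : X → J1 E F π) : Prop where
  isOpen : IsOpen U
  smooth : ContMDiffOn 𝓘(ℝ, E) 𝓘(ℝ, E × F) ∞ φ U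
  sec : ∀ x ∈ U, π (φ x) = x
  pt_eq : ∀ x ∈ U, (σ x).pt = φ x
  lin_eq : ∀ x ∈ U, (σ x).lin = dmap E (E × F) φ x

/-- `θ` is a contact `1`-form on the open set `W ⊆ J¹π`: a smooth form with `(j¹φ)^* θ = 0` for
all local sections `φ` of `π`. -/
structure IsContactForm (W : Set (J1 E F π)) (θ : J1 E F π → JModel E F [⋀^Fin 1]→L[ℝ] ℝ) :
    Prop where
  smooth : SmoothForm θ W
  pullback_eq_zero : ∀ (U : Set X) (φ : X → Y) (σ : X → J1 E F π), IsJetProlongation U φ σ →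
    ∀ x ∈ U, σ x ∈ W → (θ (σ x)).compContinuousLinearMap (dmap E (JModel E F) σ x) = 0

/-! ### Nonholonomic constraints -/

section Constraint

variable (EC : Type*) [NormedAddCommGroup EC] [NormedSpace ℝ EC]
  (C : Set (J1 E F π)) [ChartedSpace EC C]

/-- The structure of a smooth manifold on `C` makes it an embedded submanifold of `J¹π` (`C` has
the subspace topology). -/
structure IsSubmanifold : Prop where
  smooth : ContMDiff 𝓘(ℝ, EC) 𝓘(ℝ, JModel E F) ∞ (Subtype.val : C → J1 E F π)
  immersion : ∀ c : C, Function.Injective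
    (dmap EC (JModel E F) (Subtype.val : C → J1 E F π) c)

/-- `T_γ C` as a subspace of `T_γ J¹π`. -/
def tangentSub (c : C) : Submodule ℝ (JModel E F) :=
  LinearMap.range (dmap EC (JModel E F) (Subtype.val : C → J1 E F π) c).toLinearMap

variable {C}

/-- `Fc` is a bundle of constraint forms along `C`: near each point of `C` it is spanned by `k`
smooth pointwise independent forms `Φ_α = (C_α)^μ_a θ^a ∧ dⁿx_μ`, i.e. by forms with values in the
image of `S_η^*`. -/
def IsConstraintBundle (η : X → E [⋀^Fin (n + 1)]→L[ℝ] ℝ) (k : ℕ)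
    (Fc : C → Submodule ℝ (JModel E F [⋀^Fin (n + 1)]→L[ℝ] ℝ)) : Prop :=
  ∀ c₀ : C, ∃ U : Set C, IsOpen U ∧ c₀ ∈ U ∧
    ∃ Φ : Fin k → C → JModel E F [⋀^Fin (n + 1)]→L[ℝ] ℝ,
      (∀ i, SmoothFormAlong EC (Subtype.val : C → J1 E F π) (Φ i) U) ∧
      ∀ c ∈ U, (∀ i, ∃ α, Φ i c = vertEndoPullback η c.1 α) ∧
        LinearIndependent ℝ (fun i => Φ i c) ∧
        Fc c = Submodule.span ℝ (Set.range fun i => Φ i c)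

/-- The `(n+2)`-form `ψ` along `C` belongs to the ideal generated by the constraint forms: locally
`ψ = ∑ λ_i ∧ Φ^i` with smooth `1`-forms `λ_i` along `C` and smooth sections `Φ^i` of `Fc`. -/
def MemConstraintIdeal (Fc : C → Submodule ℝ (JModel E F [⋀^Fin (n + 1)]→L[ℝ] ℝ))
    (ψ : C → JModel E F [⋀^Fin (n + 2)]→L[ℝ] ℝ) : Prop :=
  ∀ c₀ : C, ∃ U : Set C, IsOpen U ∧ c₀ ∈ U ∧
    ∃ (N : ℕ) (lam : Fin N → C → JModel E F [⋀^Fin 1]→L[ℝ] ℝ)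
      (Φ : Fin N → C → JModel E F [⋀^Fin (n + 1)]→L[ℝ] ℝ),
      (∀ i, SmoothFormAlong EC (Subtype.val : C → J1 E F π) (lam i) U) ∧
      (∀ i, SmoothFormAlong EC (Subtype.val : C → J1 E F π) (Φ i) U) ∧
      ∀ c ∈ U, (∀ i, Φ i c ∈ Fc c) ∧ ψ c = ∑ i, covWedge (toCovector (lam i c)) (Φ i c)

/-- The constraint distribution `D` along `C`: the `π₁₀`-vertical vectors `ζ` with `i_ζ Ω_L` in
the bundle of constraint forms. It is spanned by the vertical `ζ_α` with `i_{ζ_α} Ω_L = -Φ_α`. -/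
def constraintDist (η : X → E [⋀^Fin (n + 1)]→L[ℝ] ℝ) (L : J1 E F π → ℝ)
    (Fc : C → Submodule ℝ (JModel E F [⋀^Fin (n + 1)]→L[ℝ] ℝ)) (c : C) :
    Submodule ℝ (JModel E F) :=
  LinearMap.ker (dmap (JModel E F) (E × F) (J1.pt : J1 E F π → Y) c.1).toLinearMap ⊓
    (Fc c).comap (poincareCartan η L c.1).curryLeft.toLinearMap

variable [FiniteDimensional ℝ F]

open Classical in
/-- The nonholonomic projector `𝒫`: the projector of `T_γ J¹π = T_γ C ⊕ D(γ)` onto `T_γ C`. (The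
value is `0` if these subspaces are not complementary.) -/
def nonholProjector (η : X → E [⋀^Fin (n + 1)]→L[ℝ] ℝ) (L : J1 E F π → ℝ)
    (Fc : C → Submodule ℝ (JModel E F [⋀^Fin (n + 1)]→L[ℝ] ℝ)) (c : C) :
    JModel E F →L[ℝ] JModel E F :=
  if hc : IsCompl (tangentSub EC C c) (constraintDist η L Fc c) then
    LinearMap.toContinuousLinearMap (Submodule.projection _ _ hc)
  else 0

/-- The connection on `π₁|_C : C → X` with horizontal projector `hC` is semi-holonomic:
`i_{hC} j^* θ = 0` for each contact `1`-form `θ` (on an open subset of `J¹π`), where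
`j : C → J¹π` is the inclusion. -/
def IsSemiholonomic (hC : C → EC →L[ℝ] EC) : Prop :=
  ∀ (W : Set (J1 E F π)) (θ : J1 E F π → JModel E F [⋀^Fin 1]→L[ℝ] ℝ), IsOpen W →
    IsContactForm W θ → ∀ c : C, c.1 ∈ W →
      insertEnd (hC c) ((θ c.1).compContinuousLinearMap
        (dmap EC (JModel E F) (Subtype.val : C → J1 E F π) c)) = 0

end Constraint

end Field

end JetField

end

/-!
Everything is reduced to one formula for the Poincaré–Cartan form. In jet coordinates
`((x, y), (y_μ))` the derivative of the Cartan form along a fibre of `J¹π → Y` contains first and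
second derivatives of `L`; the terms with first derivatives cancel by Cramer's rule
(`sum_slot_smul`, `fderiv_cartanCoord`), and what remains says that, for a `π₁₀`-vertical vector
`ζ` given by `A ∈ Hom(T_x X, V_y π)`, one has `i_ζ Ω_L = -S_η^* α` for every covector `α` whose
restriction to the vertical vectors is the fibre Hessian of `L` applied to `A`
(`poincareCartan_curryLeft_vertLift`).

For a regular Lagrangian every `S_η^* α` is therefore a contraction of `Ω_L` with a vertical vector
(`exists_curryLeft_eq`). This has two consequences.

* The contraction with `Ω_L` maps `D(γ)` onto the space of constraint forms, so `dim D(γ) ≥ k`. As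
  `T_γ C` has codimension `k` and meets `D(γ)` trivially, the two are complementary
  (`isCompl_tangentSub_constraintDist`).
* Evaluating the De Donder–Weyl equation on one vertical vector `ζ` and `n + 1` horizontal vectors
  yields `Ω_L(ζ, h v₀, …, h v_n) = 0`, hence `S_η^* α (h v₀, …, h v_n) = 0` for all `α`. Thus the
  contact forms `θ^a` vanish on the image of `h` (`contactMap_horizontal_eq_zero`).

Vectors in `D` are `π₁₀`-vertical, so that `h ∘ P = h` (`horizontal_nonholProjector`); this makes
`P ∘ h` a projector with the kernel of `h`. Moreover `θ^a ∘ P = θ^a`, so that the image of `P ∘ h`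
is also annihilated by the `θ^a`. An arbitrary contact form vanishes on the common kernel of the
`θ^a`, because this kernel is spanned by tangent vectors to prolongations of quadratic local
sections (`IsContactForm.apply_eq_zero`); the restricted connection is thus semi-holonomic.

Finally `i_{P ∘ h} Ω_L - n Ω_L = i_{P ∘ h - h} Ω_L`, and `P ∘ h - h` takes values in `D`. Expanding
`i_{(P ∘ h - h) w} Ω_L = ∑ i, λ_i w • Φ i` shows that this form is `∑ i, λ_i ∧ Φ i`. The smoothness
of the `λ_i` and of the restriction of `P ∘ h` to `C` holds because the splitting of a vector into
its components in `T C` and `D` is the unique solution of a linear system with smooth coefficients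
(`exists_smooth_decomposition`, `exists_smooth_leftInverse`).
-/

noncomputable section

namespace JetField

set_option linter.unusedSectionVars false

/-! ### Multilinear algebra of forms -/

section Algebra

variable {V E : Type*} [NormedAddCommGroup V] [NormedSpace ℝ V]
  [NormedAddCommGroup E] [NormedSpace ℝ E] {p n : ℕ}

theorem neg_one_pow_smul_cons_removeNth (ψ : V [⋀^Fin (p + 1)]→L[ℝ] ℝ) (v : Fin (p + 1) → V)
    (i : Fin (p + 1)) (x : V) :
    (-1) ^ (i : ℕ) • ψ (Matrix.vecCons x (i.removeNth v)) = ψ (Function.update v i x) := by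
  rw [← ψ.map_insertNth, Fin.insertNth_removeNth]

theorem insertEnd_apply (A : V →L[ℝ] V) (ψ : V [⋀^Fin (p + 1)]→L[ℝ] ℝ) (v : Fin (p + 1) → V) :
    insertEnd A ψ v = ∑ i, ψ (Function.update v i (A (v i))) := by
  simp only [insertEnd, ContinuousAlternatingMap.alternatizeUncurryFin_apply,
    ContinuousLinearMap.comp_apply, ContinuousAlternatingMap.curryLeft_apply_apply,
    neg_one_pow_smul_cons_removeNth]

theorem covWedge_apply (α : V →L[ℝ] ℝ) (Φ : V [⋀^Fin p]→L[ℝ] ℝ) (v : Fin (p + 1) → V) :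
    covWedge α Φ v = ∑ i : Fin (p + 1), (-1) ^ (i : ℕ) * (α (v i) * Φ (i.removeNth v)) := by
  simp [covWedge, ContinuousAlternatingMap.alternatizeUncurryFin_apply]

/-- The covector `w ↦ ρ (v₀, …, w, …, v_p)`, with `w` in the place `i`. -/
def slot (ρ : E [⋀^Fin (p + 1)]→L[ℝ] ℝ) (v : Fin (p + 1) → E) (i : Fin (p + 1)) : E →L[ℝ] ℝ :=
  ρ.toContinuousMultilinearMap.toContinuousLinearMap v i

@[simp] theorem slot_apply (ρ : E [⋀^Fin (p + 1)]→L[ℝ] ℝ) (v : Fin (p + 1) → E)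
    (i : Fin (p + 1)) (w : E) : slot ρ v i w = ρ (Function.update v i w) := rfl

/-- The form `∑ c(ε^μ) ∧ T^* (i_{e_μ} ρ)`, evaluated without reference to the basis `e_μ`. -/
theorem sum_covWedge_contraction_apply {ι : Type*} [Fintype ι] (b : Module.Basis ι ℝ E)
    [FiniteDimensional ℝ E]
    (c : (E →L[ℝ] ℝ) →ₗ[ℝ] V →L[ℝ] ℝ) (T : V →L[ℝ] E) (ρ : E [⋀^Fin (p + 1)]→L[ℝ] ℝ)
    (v : Fin (p + 1) → V) :
    (∑ μ, covWedge (c (LinearMap.toContinuousLinearMap (b.coord μ)))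
      ((ρ.curryLeft (b μ)).compContinuousLinearMap T)) v =
      ∑ i, c (slot ρ (T ∘ v) i) (v i) := by
  have hr : ∀ r : E →L[ℝ] ℝ, c r = ∑ μ, r (b μ) • c (LinearMap.toContinuousLinearMap (b.coord μ)) := by
    intro r
    have hs : r = ∑ μ, r (b μ) • LinearMap.toContinuousLinearMap (b.coord μ) := by
      ext w
      nth_rewrite 1 [← b.sum_repr w]
      rw [map_sum, sum_apply]
      simp [mul_comm]
    nth_rewrite 1 [hs]
    simp
  rw [ContinuousAlternatingMap.sum_apply]
  simp only [covWedge_apply]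
  rw [Finset.sum_comm]
  refine Finset.sum_congr rfl fun i _ => ?_
  rw [hr, sum_apply]
  refine Finset.sum_congr rfl fun μ _ => ?_
  rw [smul_apply, slot_apply, ← neg_one_pow_smul_cons_removeNth]
  simp only [ContinuousAlternatingMap.compContinuousLinearMap_apply,
    ContinuousAlternatingMap.curryLeft_apply_apply, smul_eq_mul]
  have : (T ∘ i.removeNth v) = i.removeNth (T ∘ v) := rfl
  rw [this]; ring

/-- Cramer's rule, which holds because forms of degree larger than the dimension vanish. -/
theorem sum_slot_smul [FiniteDimensional ℝ E] (hn : Module.finrank ℝ E = n + 1)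
    (ρ : E [⋀^Fin (n + 1)]→L[ℝ] ℝ) (v : Fin (n + 1) → E) (w : E) :
    ∑ i, slot ρ v i w • v i = ρ v • w := by
  by_contra hne
  obtain ⟨β, hβ⟩ := SeparatingDual.exists_ne_zero (R := ℝ) (sub_ne_zero.2 hne)
  apply hβ
  have h0 : covWedge β ρ (Matrix.vecCons w v) = 0 := by
    apply (covWedge β ρ).toAlternatingMap.map_linearDependent
    intro h
    have := h.fintype_card_le_finrank
    simp [hn] at this
  rw [covWedge_apply, Fin.sum_univ_succ] at h0
  have h1 : ∀ i : Fin (n + 1), (-1) ^ (i.succ : ℕ) * (β (Matrix.vecCons w v i.succ) *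
      ρ (i.succ.removeNth (Matrix.vecCons w v))) = -(slot ρ v i w * β (v i)) := by
    intro i
    have h2 : i.succ.removeNth (Matrix.vecCons w v) = Matrix.vecCons w (i.removeNth v) := by
      ext j
      refine Fin.cases ?_ (fun j => ?_) j <;> simp [Fin.removeNth]
    rw [h2, slot_apply, ← neg_one_pow_smul_cons_removeNth]
    simp [pow_succ]
    ring
  have h3 : Fin.removeNth 0 (Matrix.vecCons w v) = v := by ext j; simp [Fin.removeNth]
  simp only [h1, h3, Finset.sum_neg_distrib] at h0
  simp only [map_sub, map_sum, map_smul, smul_eq_mul]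
  simp only [Fin.val_zero, pow_zero, Matrix.cons_val_zero, one_mul] at h0
  linarith

/-- If `A` is a finite sum of endomorphisms `λ ⊗ ζ`, then `i_A ψ` is the sum of the forms
`λ ∧ i_ζ ψ`; here the forms `i_{A w} ψ` are expanded in a family `Φ`. -/
theorem insertEnd_eq_sum_covWedge {ι : Type*} [Fintype ι] (A : V →L[ℝ] V)
    (ψ : V [⋀^Fin (p + 1)]→L[ℝ] ℝ) (Φ : ι → V [⋀^Fin p]→L[ℝ] ℝ) (lam : ι → V →L[ℝ] ℝ)
    (h : ∀ w, ψ.curryLeft (A w) = ∑ i, lam i w • Φ i) :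
    insertEnd A ψ = ∑ i, covWedge (lam i) (Φ i) := by
  have : ψ.curryLeft ∘L A = ∑ i, (lam i).smulRight (Φ i) := by
    ext1 w; simp [h w, sum_apply]
  rw [insertEnd, this]
  exact map_sum (ContinuousAlternatingMap.alternatizeUncurryFinCLM ℝ V ℝ) _ _

theorem insertEnd_sub (A B : V →L[ℝ] V) (ψ : V [⋀^Fin (p + 1)]→L[ℝ] ℝ) :
    insertEnd (A - B) ψ = insertEnd A ψ - insertEnd B ψ := by
  rw [insertEnd, ContinuousLinearMap.comp_sub]
  exact map_sub (ContinuousAlternatingMap.alternatizeUncurryFinCLM ℝ V ℝ) _ _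

end Algebra

/-! ### Smooth families of forms and of linear equations -/

section Smooth

variable {V W E B : Type*} [NormedAddCommGroup V] [NormedSpace ℝ V]
  [NormedAddCommGroup W] [NormedSpace ℝ W]
  [NormedAddCommGroup E] [NormedSpace ℝ E] [NormedAddCommGroup B] [NormedSpace ℝ B] {p : ℕ}

/-- On a finite-dimensional space, a family of forms is smooth if all its values are. -/
theorem contDiff_alternating_of_apply [FiniteDimensional ℝ V] {f : E → V [⋀^Fin p]→L[ℝ] ℝ}
    (h : ∀ v, ContDiff ℝ ∞ (fun y => f y v)) : ContDiff ℝ ∞ f := by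
  induction p with
  | zero =>
    have := (ContinuousAlternatingMap.constOfIsEmptyLIE ℝ V ℝ (Fin 0)).contDiff.comp (n := ∞) (h 0)
    convert this using 1
    funext y
    ext v
    simp [Subsingleton.elim v 0]
  | succ p ih =>
    have h1 : ContDiff ℝ ∞ (fun y => (f y).curryLeft) :=
      contDiff_clm_apply_iff.2 fun w => ih fun v => h (Matrix.vecCons w v)
    have h2 := ((ContinuousAlternatingMap.alternatizeUncurryFinCLM (n := p) ℝ V ℝ).contDiff.comp
      (n := ∞) h1).const_smul ((p + 1 : ℝ)⁻¹)
    convert h2 using 1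
    funext y
    have hp : (p + 1 : ℝ) ≠ 0 := by positivity
    simp [ContinuousAlternatingMap.alternatizeUncurryFin_curryLeft,
      ← Nat.cast_smul_eq_nsmul ℝ, smul_smul, inv_mul_cancel₀ hp]

theorem contDiff_alternating_apply {f : E → V [⋀^Fin p]→L[ℝ] ℝ} {v : E → Fin p → V}
    (hf : ContDiff ℝ ∞ f) (hv : ∀ i, ContDiff ℝ ∞ (fun y => v y i)) :
    ContDiff ℝ ∞ (fun y => f y (v y)) := by
  induction p with
  | zero =>
    have := (ContinuousAlternatingMap.constOfIsEmptyLIE ℝ V ℝ (Fin 0)).symm.contDiff.comp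
      (n := ∞) hf
    convert this using 1
    funext y
    rw [Subsingleton.elim (v y) 0]
    rfl
  | succ p ih =>
    have hc : ContDiff ℝ ∞ (fun g : V [⋀^Fin (p + 1)]→L[ℝ] ℝ => g.curryLeft) :=
      IsBoundedLinearMap.contDiff ⟨⟨ContinuousAlternatingMap.curryLeft_add,
        ContinuousAlternatingMap.curryLeft_smul⟩, 1, one_pos,
        fun g => by rw [one_mul]; exact g.norm_curryLeft.le⟩
    have h0 : ContDiff ℝ ∞ (fun y => (f y).curryLeft) := hc.comp hf
    have h1 : ContDiff ℝ ∞ (fun y => (f y).curryLeft (v y 0)) := h0.clm_apply (hv 0)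
    convert ih h1 (v := fun y => Fin.tail (v y)) (fun i => hv i.succ) using 1
    funext y
    rw [ContinuousAlternatingMap.curryLeft_apply_apply]
    congr 1
    exact (Fin.cons_self_tail (v y)).symm

theorem contDiff_smul_alternating [FiniteDimensional ℝ V] :
    ContDiff ℝ ∞ (fun q : ℝ × (V [⋀^Fin p]→L[ℝ] ℝ) => q.1 • q.2) :=
  contDiff_alternating_of_apply fun v => by
    simp only [ContinuousAlternatingMap.smul_apply]
    exact contDiff_fst.smul (contDiff_alternating_apply contDiff_snd fun _ => contDiff_const)

/-- The pullback `(ψ, g) ↦ g^* ψ` of forms by linear maps is smooth. -/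
theorem contDiff_compContinuousLinearMap [FiniteDimensional ℝ V] :
    ContDiff ℝ ∞ (fun q : (W [⋀^Fin p]→L[ℝ] ℝ) × (V →L[ℝ] W) => q.1.compContinuousLinearMap q.2) :=
  contDiff_alternating_of_apply fun _ =>
    contDiff_alternating_apply (V := W) contDiff_fst fun _ => contDiff_snd.clm_apply contDiff_const

/-- An injective linear map on a finite-dimensional space has a continuous left inverse. -/
theorem exists_leftInverse_clm [FiniteDimensional ℝ V] (A : V →L[ℝ] W)
    (hA : Function.Injective A) : ∃ R : W →L[ℝ] V, R ∘L A = ContinuousLinearMap.id ℝ V := by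
  let e := LinearEquiv.ofInjective A.toLinearMap hA
  have := e.finiteDimensional
  obtain ⟨R, hR⟩ := ContinuousLinearMap.exist_extension_of_finiteDimensional_range
    (LinearMap.toContinuousLinearMap (e.symm : A.toLinearMap.range →ₗ[ℝ] V))
  refine ⟨R, ?_⟩
  ext v
  have := congrArg (fun f : A.toLinearMap.range →L[ℝ] V => f (e v)) hR
  simpa [e] using this.symm

/-- Solving linear equations smoothly: a smooth family of linear maps on a finite-dimensional
space, injective at one point, has a smooth family of left inverses near this point. -/
theorem exists_smooth_leftInverse {H S : Type*} [NormedAddCommGroup H] [NormedSpace ℝ H]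
    [TopologicalSpace S] [ChartedSpace H S] [FiniteDimensional ℝ V]
    {A : S → V →L[ℝ] W} {s₀ : S} (hA : ContMDiffAt 𝓘(ℝ, H) 𝓘(ℝ, V →L[ℝ] W) ∞ A s₀)
    (hinj : Function.Injective (A s₀)) :
    ∃ G : S → W →L[ℝ] V, ContMDiffAt 𝓘(ℝ, H) 𝓘(ℝ, W →L[ℝ] V) ∞ G s₀ ∧
      ∀ᶠ s in 𝓝 s₀, ∀ v, G s (A s v) = v := by
  have : CompleteSpace V := FiniteDimensional.complete ℝ V
  obtain ⟨R, hR⟩ : ∃ R : W →L[ℝ] V, R ∘L A s₀ = ContinuousLinearMap.id ℝ V :=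
    exists_leftInverse_clm _ hinj
  have hR' : ContMDiffAt 𝓘(ℝ, H) 𝓘(ℝ, V →L[ℝ] V) ∞ (fun s => R ∘L A s) s₀ :=
    contMDiffAt_const.clm_comp hA
  have hinv : ContDiffAt ℝ ∞ (Ring.inverse : (V →L[ℝ] V) → V →L[ℝ] V) (R ∘L A s₀) := by
    rw [hR]; exact contDiffAt_ringInverse ℝ (1 : (V →L[ℝ] V)ˣ)
  refine ⟨fun s => Ring.inverse (R ∘L A s) ∘L R,
    (hinv.contMDiffAt.comp s₀ hR').clm_comp contMDiffAt_const, ?_⟩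
  have hu : ∀ᶠ s in 𝓝 s₀, IsUnit (R ∘L A s) := by
    refine hR'.continuousAt.eventually (Units.isOpen.mem_nhds (x := R ∘L A s₀) ?_)
    rw [hR]; exact isUnit_one
  filter_upwards [hu] with s hs v
  have := Ring.inverse_mul_cancel _ hs
  exact congrArg (fun f : V →L[ℝ] V => f v) this

end Smooth

/-! ### Jet coordinates -/

section Jet

variable {E F : Type*} [NormedAddCommGroup E] [NormedSpace ℝ E]
  [NormedAddCommGroup F] [NormedSpace ℝ F]
  {X Y : Type*} [TopologicalSpace X] [ChartedSpace E X]
  [TopologicalSpace Y] [ChartedSpace (E × F) Y]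
  [IsManifold 𝓘(ℝ, E) ∞ X] [IsManifold 𝓘(ℝ, E × F) ∞ Y]
  {π : Y → X} [IsSmoothFibreBundle E (E × F) F π]

namespace AdaptedChart

variable (a : AdaptedChart E F π) (γ₀ : J1 E F π) {γ : J1 E F π}

/-- The jet coordinates induced by an adapted chart, as a chart of the manifold `J¹π`. -/
def jetHomeo : OpenPartialHomeomorph (J1 E F π) (JModel E F) :=
  (jetCore π).openPartialHomeomorph (a.jetChart (mdiff_proj π) γ₀) ⟨a, γ₀, rfl⟩

theorem jetHomeo_mem_atlas : a.jetHomeo γ₀ ∈ atlas (JModel E F) (J1 E F π) :=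
  Set.mem_iUnion₂.2 ⟨_, ⟨a, γ₀, rfl⟩, rfl⟩

theorem jetHomeo_mem_maximalAtlas :
    a.jetHomeo γ₀ ∈ IsManifold.maximalAtlas 𝓘(ℝ, JModel E F) ∞ (J1 E F π) :=
  IsManifold.subset_maximalAtlas (a.jetHomeo_mem_atlas γ₀)

theorem jetHomeo_apply : a.jetHomeo γ₀ γ = (a.tot γ.pt, ContinuousLinearMap.snd ℝ E F ∘L
    a.dTot γ.pt ∘L γ.lin ∘L a.dBaseSymm (a.base (π γ.pt))) := rfl

theorem jetHomeo_symm_pt {z : JModel E F} (hz : z.1 ∈ a.tot.target) :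
    ((a.jetHomeo γ₀).symm z).pt = a.tot.symm z.1 := by
  change ((a.jetChart (mdiff_proj π) γ₀).symm z).pt = _
  simp [jetChart, hz]

theorem jetHomeo_symm_lin {z : JModel E F} (hz : z.1 ∈ a.tot.target) :
    ((a.jetHomeo γ₀).symm z).lin = a.dTotSymm z.1 ∘L ((ContinuousLinearMap.id ℝ E).prod z.2) ∘L
          a.dBase (π (a.tot.symm z.1)) := by
  change ((a.jetChart (mdiff_proj π) γ₀).symm z).lin = _
  simp [jetChart, hz]

theorem base_proj_tot_symm {z : E × F} (hz : z ∈ a.tot.target) :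
    π (a.tot.symm z) = a.base.symm z.1 := by
  have h := a.base_proj _ (a.tot.map_target hz)
  rw [a.tot.right_inv hz] at h
  rw [← h, a.base.left_inv (a.proj_mem _ (a.tot.map_target hz))]

theorem jetHomeo_mdiff :
    (a.jetHomeo γ₀).MDifferentiable 𝓘(ℝ, JModel E F) 𝓘(ℝ, JModel E F) :=
  mdifferentiable_of_mem_atlas (a.jetHomeo_mem_atlas γ₀)

/-- Derivative of the jet coordinates. -/
def dJet (γ : J1 E F π) : JModel E F →L[ℝ] JModel E F :=
  dmap (JModel E F) (JModel E F) (a.jetHomeo γ₀) γ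

/-- Derivative of the inverse of the jet coordinates. -/
def dJetSymm (z : JModel E F) : JModel E F →L[ℝ] JModel E F :=
  dmap (JModel E F) (JModel E F) (a.jetHomeo γ₀).symm z

theorem dJetSymm_dJet (hγ : γ.pt ∈ a.tot.source) (v : JModel E F) :
    a.dJetSymm γ₀ (a.jetHomeo γ₀ γ) (a.dJet γ₀ γ v) = v :=
  congrArg (fun f : JModel E F →L[ℝ] JModel E F => f v) ((a.jetHomeo_mdiff γ₀).symm_comp_deriv hγ)

theorem dJet_dJetSymm (hγ : γ.pt ∈ a.tot.source) (v : JModel E F) :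
    a.dJet γ₀ γ (a.dJetSymm γ₀ (a.jetHomeo γ₀ γ) v) = v := by
  have h := congrArg (fun f : JModel E F →L[ℝ] JModel E F => f v)
    ((a.jetHomeo_mdiff γ₀).comp_symm_deriv ((a.jetHomeo γ₀).map_source hγ))
  have h2 : (a.jetHomeo γ₀).symm (a.jetHomeo γ₀ γ) = γ := (a.jetHomeo γ₀).left_inv hγ
  have h3 : a.dJet γ₀ ((a.jetHomeo γ₀).symm (a.jetHomeo γ₀ γ))
    (a.dJetSymm γ₀ (a.jetHomeo γ₀ γ) v) = v := h
  rwa [h2] at h3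

theorem pt_eventuallyEq (hγ : γ.pt ∈ a.tot.source) :
    (J1.pt : J1 E F π → Y) =ᶠ[𝓝 γ] a.tot.symm ∘ (Prod.fst ∘ a.jetHomeo γ₀) := by
  filter_upwards [(a.jetHomeo γ₀).open_source.mem_nhds hγ] with δ hδ
  exact (a.tot.left_inv hδ).symm

end AdaptedChart

theorem contMDiff_pt : ContMDiff 𝓘(ℝ, JModel E F) 𝓘(ℝ, E × F) ∞ (J1.pt : J1 E F π → Y) := by
  intro γ
  obtain ⟨a, hγ⟩ : ∃ a : AdaptedChart E F π, γ.pt ∈ a.tot.source := exists_adaptedChart π γ.pt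
  refine ContMDiffAt.congr_of_eventuallyEq ?_ (a.pt_eventuallyEq γ hγ)
  have h1 : ContMDiffAt 𝓘(ℝ, E × F) 𝓘(ℝ, E × F) ∞ a.tot.symm (a.jetHomeo γ γ).1 :=
    a.tot_symm_smooth.contMDiffAt (a.tot.open_target.mem_nhds (a.tot.map_source hγ))
  have h2 : ContMDiffAt 𝓘(ℝ, JModel E F) 𝓘(ℝ, JModel E F) ∞ (a.jetHomeo γ) γ :=
    contMDiffAt_of_mem_maximalAtlas (a.jetHomeo_mem_maximalAtlas γ) hγ
  have h3 : ContMDiffAt 𝓘(ℝ, JModel E F) 𝓘(ℝ, E × F) ∞ (Prod.fst : JModel E F → E × F)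
      (a.jetHomeo γ γ) := contDiffAt_fst.contMDiffAt
  exact h1.comp γ (h3.comp γ h2)

theorem contMDiff_base : ContMDiff 𝓘(ℝ, JModel E F) 𝓘(ℝ, E) ∞ (J1.base : J1 E F π → X) :=
  (IsSmoothFibreBundle.smooth (K := F) (p := π)).comp contMDiff_pt

theorem dmap_base (γ : J1 E F π) (v : JModel E F) :
    dmap (JModel E F) E (J1.base : J1 E F π → X) γ v =
      dmap (E × F) E π γ.pt (dmap (JModel E F) (E × F) J1.pt γ v) :=
  congrArg (fun f : JModel E F →L[ℝ] E => f v)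
    (mfderiv_comp γ (mdiff_proj π γ.pt) (contMDiff_pt.mdifferentiableAt (by simp)))

namespace AdaptedChart

variable (a : AdaptedChart E F π) (γ₀ : J1 E F π) {γ : J1 E F π}

theorem dmap_pt (hγ : γ.pt ∈ a.tot.source) (v : JModel E F) :
    dmap (JModel E F) (E × F) (J1.pt : J1 E F π → Y) γ v =
      a.dTotSymm (a.tot γ.pt) (a.dJet γ₀ γ v).1 := by
  have h1 : mfderiv 𝓘(ℝ, JModel E F) 𝓘(ℝ, E × F) (J1.pt : J1 E F π → Y) γ =
      mfderiv 𝓘(ℝ, JModel E F) 𝓘(ℝ, E × F)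
        (a.tot.symm ∘ (ContinuousLinearMap.fst ℝ (E × F) (E →L[ℝ] F) ∘ a.jetHomeo γ₀)) γ :=
    (a.pt_eventuallyEq γ₀ hγ).mfderiv_eq
  have hd : MDifferentiableAt 𝓘(ℝ, JModel E F) 𝓘(ℝ, JModel E F) (a.jetHomeo γ₀) γ :=
    (a.jetHomeo_mdiff γ₀).mdifferentiableAt hγ
  have hf : MDifferentiableAt 𝓘(ℝ, JModel E F) 𝓘(ℝ, E × F)
      (ContinuousLinearMap.fst ℝ (E × F) (E →L[ℝ] F)) (a.jetHomeo γ₀ γ) :=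
    (ContinuousLinearMap.fst ℝ (E × F) (E →L[ℝ] F)).differentiableAt.mdifferentiableAt
  have ht : MDifferentiableAt 𝓘(ℝ, E × F) 𝓘(ℝ, E × F) a.tot.symm
      ((ContinuousLinearMap.fst ℝ (E × F) (E →L[ℝ] F) ∘ a.jetHomeo γ₀) γ) :=
    a.tot_mdiff.mdifferentiableAt_symm (a.tot.map_source hγ)
  rw [mfderiv_comp γ ht (hf.comp γ hd), mfderiv_comp γ hf hd, mfderiv_eq_fderiv,
    ContinuousLinearMap.fderiv] at h1
  exact congrArg (fun f : JModel E F →L[ℝ] E × F => f v) h1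

theorem dTot_dmap_pt (hγ : γ.pt ∈ a.tot.source) (v : JModel E F) :
    a.dTot γ.pt (dmap (JModel E F) (E × F) (J1.pt : J1 E F π → Y) γ v) = (a.dJet γ₀ γ v).1 := by
  rw [a.dmap_pt γ₀ hγ]
  have := a.dTot_dTotSymm (a.tot.map_source hγ) (a.dJet γ₀ γ v).1
  rwa [a.tot.left_inv hγ] at this

theorem dBase_dmap_base (hγ : γ.pt ∈ a.tot.source) (v : JModel E F) :
    a.dBase (π γ.pt) (dmap (JModel E F) E (J1.base : J1 E F π → X) γ v) =
      (a.dJet γ₀ γ v).1.1 := by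
  rw [dmap_base, a.dBase_dπ (mdiff_proj π _) hγ, a.dTot_dmap_pt γ₀ hγ]

theorem dmap_base_eq (hγ : γ.pt ∈ a.tot.source) (v : JModel E F) :
    dmap (JModel E F) E (J1.base : J1 E F π → X) γ v =
      a.dBaseSymm (a.base (π γ.pt)) (a.dJet γ₀ γ v).1.1 := by
  rw [← a.dBase_dmap_base γ₀ hγ, a.dBaseSymm_dBase (a.proj_mem _ hγ)]

/-- The linear part of a jet in coordinates. -/
theorem dTot_lin (hγ : γ.pt ∈ a.tot.source) (u : E) :
    a.dTot γ.pt (γ.lin (a.dBaseSymm (a.base (π γ.pt)) u)) = (u, (a.jetHomeo γ₀ γ).2 u) := by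
  ext1
  · rw [← a.dBase_dπ (mdiff_proj π _) hγ, γ.proj_lin, a.dBase_dBaseSymm (a.proj_mem _ hγ)]
  · rfl

/-- The contact form in coordinates is `dy^a - y^a_ν dx^ν`. -/
theorem dTot_contactMap (hγ : γ.pt ∈ a.tot.source) (v : JModel E F) :
    a.dTot γ.pt (contactMap γ v) =
      (0, (a.dJet γ₀ γ v).1.2 - (a.jetHomeo γ₀ γ).2 (a.dJet γ₀ γ v).1.1) := by
  have h : contactMap γ v = dmap (JModel E F) (E × F) J1.pt γ v -
      γ.lin (dmap (JModel E F) E (J1.base : J1 E F π → X) γ v) := by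
    rw [dmap_base]; rfl
  rw [h, map_sub, a.dTot_dmap_pt γ₀ hγ, a.dmap_base_eq γ₀ hγ, a.dTot_lin γ₀ hγ]
  ext1 <;> simp

/-- The coordinates `A ↦ (A^a_μ)` on the vector space `Hom(T_x X, V_y π)`. -/
def vertCoord (γ : J1 E F π) : vertHom γ →L[ℝ] E →L[ℝ] F :=
  ContinuousLinearMap.compL ℝ E (E × F) F (ContinuousLinearMap.snd ℝ E F ∘L a.dTot γ.pt) ∘L
    (ContinuousLinearMap.compL ℝ E E (E × F)).flip (a.dBaseSymm (a.base (π γ.pt))) ∘L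
    (vertHom γ).subtypeL

theorem vertCoord_apply (γ : J1 E F π) (A : vertHom γ) (u : E) :
    a.vertCoord γ A u = (a.dTot γ.pt (A.1 (a.dBaseSymm (a.base (π γ.pt)) u))).2 := rfl

theorem dTot_vertHom (hγ : γ.pt ∈ a.tot.source) (A : vertHom γ) (u : E) :
    a.dTot γ.pt (A.1 (a.dBaseSymm (a.base (π γ.pt)) u)) = (0, a.vertCoord γ A u) := by
  ext1
  · rw [← a.dBase_dπ (mdiff_proj π _) hγ]
    have : dmap (E × F) E π γ.pt (A.1 (a.dBaseSymm (a.base (π γ.pt)) u)) = 0 := A.2 _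
    rw [this]; simp
  · rfl

theorem jetHomeo_add (γ : J1 E F π) (A : vertHom γ) :
    a.jetHomeo γ₀ (γ.add A) = ((a.jetHomeo γ₀ γ).1, (a.jetHomeo γ₀ γ).2 + a.vertCoord γ A) := by
  rw [jetHomeo_apply, jetHomeo_apply]
  ext1
  · rfl
  · ext u
    simp [J1.add, vertCoord]

theorem add_eq (hγ : γ.pt ∈ a.tot.source) :
    (fun A : vertHom γ => γ.add A) = (a.jetHomeo γ₀).symm ∘
      fun A => ((a.jetHomeo γ₀ γ).1, (a.jetHomeo γ₀ γ).2 + a.vertCoord γ A) := by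
  funext A
  rw [Function.comp_apply, ← a.jetHomeo_add γ₀]
  exact ((a.jetHomeo γ₀).left_inv (x := γ.add A) hγ).symm

theorem hasFDerivAt_fibre {V : Type*} [NormedAddCommGroup V] [NormedSpace ℝ V]
    (z : JModel E F) (σ : V →L[ℝ] E →L[ℝ] F) (A : V) :
    HasFDerivAt (fun A => ((z.1, z.2 + σ A) : JModel E F))
      (ContinuousLinearMap.inr ℝ (E × F) (E →L[ℝ] F) ∘L σ) A :=
  (hasFDerivAt_const z.1 A).prodMk (σ.hasFDerivAt.const_add z.2)

/-- The vertical lift in coordinates. -/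
theorem vertLift_eq (hγ : γ.pt ∈ a.tot.source) (A : vertHom γ) :
    vertLift γ A = a.dJetSymm γ₀ (a.jetHomeo γ₀ γ) (0, a.vertCoord γ A) := by
  have hd := hasFDerivAt_fibre (V := vertHom γ) (a.jetHomeo γ₀ γ) (a.vertCoord γ) 0
  have h1 : mfderiv 𝓘(ℝ, vertHom γ) 𝓘(ℝ, JModel E F) (fun A : vertHom γ => γ.add A) 0 =
      mfderiv 𝓘(ℝ, vertHom γ) 𝓘(ℝ, JModel E F) ((a.jetHomeo γ₀).symm ∘
        fun A => ((a.jetHomeo γ₀ γ).1, (a.jetHomeo γ₀ γ).2 + a.vertCoord γ A)) 0 := by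
    rw [a.add_eq γ₀ hγ]
  have hs : MDifferentiableAt 𝓘(ℝ, JModel E F) 𝓘(ℝ, JModel E F) (a.jetHomeo γ₀).symm
      ((a.jetHomeo γ₀ γ).1, (a.jetHomeo γ₀ γ).2 + a.vertCoord γ 0) := by
    rw [map_zero, add_zero]
    exact (a.jetHomeo_mdiff γ₀).mdifferentiableAt_symm ((a.jetHomeo γ₀).map_source hγ)
  rw [mfderiv_comp 0 hs hd.differentiableAt.mdifferentiableAt, mfderiv_eq_fderiv, hd.fderiv] at h1
  have h2 := congrArg (fun f : vertHom γ →L[ℝ] JModel E F => f A) h1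
  have h3 : vertLift γ A = a.dJetSymm γ₀ ((a.jetHomeo γ₀ γ).1, (a.jetHomeo γ₀ γ).2 + a.vertCoord γ 0)
    (0, a.vertCoord γ A) := h2
  rwa [map_zero, add_zero] at h3

theorem dJet_vertLift (hγ : γ.pt ∈ a.tot.source) (A : vertHom γ) :
    a.dJet γ₀ γ (vertLift γ A) = (0, a.vertCoord γ A) := by
  rw [a.vertLift_eq γ₀ hγ, a.dJet_dJetSymm γ₀ hγ]

theorem vertCoord_surjective (hγ : γ.pt ∈ a.tot.source) :
    Function.Surjective (a.vertCoord γ) := by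
  intro B
  have hx := a.proj_mem _ hγ
  have key : ∀ w, a.dTot γ.pt (a.dTotSymm (a.tot γ.pt) w) = w := by
    intro w
    have := a.dTot_dTotSymm (a.tot.map_source hγ) w
    rwa [a.tot.left_inv hγ] at this
  refine ⟨⟨a.dTotSymm (a.tot γ.pt) ∘L ContinuousLinearMap.inr ℝ E F ∘L B ∘L a.dBase (π γ.pt),
    fun v => ?_⟩, ?_⟩
  · rw [← a.dBaseSymm_dBase hx (dmap (E × F) E π γ.pt _), a.dBase_dπ (mdiff_proj π _) hγ]
    simp only [ContinuousLinearMap.comp_apply]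
    rw [key]; simp
  · ext u
    rw [vertCoord_apply]
    simp only [ContinuousLinearMap.comp_apply]
    rw [key, a.dBase_dBaseSymm hx]; rfl

end AdaptedChart

theorem dmap_pt_vertLift (γ : J1 E F π) (A : vertHom γ) :
    dmap (JModel E F) (E × F) (J1.pt : J1 E F π → Y) γ (vertLift γ A) = 0 := by
  obtain ⟨a, hγ⟩ : ∃ a : AdaptedChart E F π, γ.pt ∈ a.tot.source := exists_adaptedChart π γ.pt
  rw [a.dmap_pt γ hγ, a.dJet_vertLift γ hγ, map_zero]

theorem vertLift_injective (γ : J1 E F π) : Function.Injective (vertLift γ) := by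
  obtain ⟨a, hγ⟩ : ∃ a : AdaptedChart E F π, γ.pt ∈ a.tot.source := exists_adaptedChart π γ.pt
  rw [injective_iff_map_eq_zero]
  intro A hA
  have h := a.dJet_vertLift γ hγ A
  rw [hA, map_zero] at h
  have h2 : a.vertCoord γ A = 0 := congrArg Prod.snd h.symm
  ext1
  ext1 v
  rw [← a.dTotSymm_dTot hγ (A.1 v), ← a.dBaseSymm_dBase (a.proj_mem _ hγ) v, a.dTot_vertHom hγ, h2]
  exact map_zero _

theorem dmap_base_surjective (γ : J1 E F π) :
    Function.Surjective (dmap (JModel E F) E (J1.base : J1 E F π → X) γ) := by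
  obtain ⟨a, hγ⟩ : ∃ a : AdaptedChart E F π, γ.pt ∈ a.tot.source := exists_adaptedChart π γ.pt
  intro u
  refine ⟨a.dJetSymm γ (a.jetHomeo γ γ) ((a.dBase (π γ.pt) u, 0), 0), ?_⟩
  rw [a.dmap_base_eq γ hγ, a.dJet_dJetSymm γ hγ, a.dBaseSymm_dBase (a.proj_mem _ hγ)]

end Jet

/-! ### The Cartan form in jet coordinates -/

section CoordinateForms

variable {E F : Type*} [NormedAddCommGroup E] [NormedSpace ℝ E] [FiniteDimensional ℝ E]
  [NormedAddCommGroup F] [NormedSpace ℝ F] {n : ℕ}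

/-- The projection of `J¹π` onto `X`, in coordinates: `((x, y), (y_μ)) ↦ x`. -/
def baseCoord (E F : Type*) [NormedAddCommGroup E] [NormedSpace ℝ E]
    [NormedAddCommGroup F] [NormedSpace ℝ F] : JModel E F →L[ℝ] E :=
  ContinuousLinearMap.fst ℝ E F ∘L ContinuousLinearMap.fst ℝ (E × F) (E →L[ℝ] F)

@[simp] theorem baseCoord_apply (w : JModel E F) : baseCoord E F w = w.1.1 := rfl

/-- The contact forms `dy^a - y^a_ν dx^ν` in coordinates, at a point with `(y_ν) = A`. -/
def contactCoord (A : E →L[ℝ] F) : JModel E F →L[ℝ] F :=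
  ContinuousLinearMap.snd ℝ E F ∘L ContinuousLinearMap.fst ℝ (E × F) (E →L[ℝ] F) -
    A ∘L baseCoord E F

@[simp] theorem contactCoord_apply (A : E →L[ℝ] F) (w : JModel E F) :
    contactCoord A w = w.1.2 - A w.1.1 := rfl

/-- The form `S_η^* α` in coordinates, where `ρ` is the coordinate expression of `η`. -/
def coordEndo (ρ : E [⋀^Fin (n + 1)]→L[ℝ] ℝ) (A : E →L[ℝ] F) (α : JModel E F →L[ℝ] ℝ) :
    JModel E F [⋀^Fin (n + 1)]→L[ℝ] ℝ :=
  ∑ μ, covWedge (α ∘L ContinuousLinearMap.inr ℝ (E × F) (E →L[ℝ] F) ∘L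
      ContinuousLinearMap.smulRightL ℝ E F
        (LinearMap.toContinuousLinearMap ((Module.finBasis ℝ E).coord μ)) ∘L contactCoord A)
    ((ρ.curryLeft (Module.finBasis ℝ E μ)).compContinuousLinearMap (baseCoord E F))

theorem coordEndo_apply (ρ : E [⋀^Fin (n + 1)]→L[ℝ] ℝ) (A : E →L[ℝ] F) (α : JModel E F →L[ℝ] ℝ)
    (v : Fin (n + 1) → JModel E F) :
    coordEndo ρ A α v =
      ∑ i, α (0, (slot ρ (fun j => (v j).1.1) i).smulRight (contactCoord A (v i))) :=
  sum_covWedge_contraction_apply (Module.finBasis ℝ E)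
    { toFun := fun ε => α ∘L ContinuousLinearMap.inr ℝ (E × F) (E →L[ℝ] F) ∘L
        ContinuousLinearMap.smulRightL ℝ E F ε ∘L contactCoord A
      map_add' := fun ε ε' => ContinuousLinearMap.ext fun w => by simp
      map_smul' := fun c ε => ContinuousLinearMap.ext fun w => by simp } (baseCoord E F) ρ v

/-- The form `S_η^* α` vanishes on `π₁₀`-vertical vectors. -/
theorem coordEndo_eq_zero (ρ : E [⋀^Fin (n + 1)]→L[ℝ] ℝ) (A : E →L[ℝ] F)
    (α : JModel E F →L[ℝ] ℝ) (v : Fin (n + 1) → JModel E F) (j : Fin (n + 1))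
    (hj : (v j).1 = 0) : coordEndo ρ A α v = 0 := by
  rw [coordEndo_apply]
  refine Finset.sum_eq_zero fun i _ => ?_
  by_cases hij : i = j
  · subst hij
    have : contactCoord A (v i) = 0 := by simp [hj]
    rw [this, show (slot ρ (fun j => (v j).1.1) i).smulRight (0 : F) = 0 from by ext; simp]
    exact map_zero α
  · have : slot ρ (fun j => (v j).1.1) i = 0 := by
      ext w
      rw [slot_apply]
      refine ρ.map_coord_zero j ?_
      rw [Function.update_of_ne (Ne.symm hij)]
      simp [hj]
    rw [this, show (0 : E →L[ℝ] ℝ).smulRight (contactCoord A (v i)) = 0 from by ext; simp]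
    exact map_zero α

theorem contDiff_coordEndo [FiniteDimensional ℝ F] : ContDiff ℝ ∞
    (fun q : (E [⋀^Fin (n + 1)]→L[ℝ] ℝ) × (E →L[ℝ] F) × (JModel E F →L[ℝ] ℝ) =>
      coordEndo q.1 q.2.1 q.2.2) := by
  refine contDiff_alternating_of_apply fun v => ?_
  simp only [coordEndo_apply]
  have hα : ContDiff ℝ ∞ (fun q : (E [⋀^Fin (n + 1)]→L[ℝ] ℝ) × (E →L[ℝ] F) ×
      (JModel E F →L[ℝ] ℝ) => q.2.2) := contDiff_snd.snd
  have hA : ContDiff ℝ ∞ (fun q : (E [⋀^Fin (n + 1)]→L[ℝ] ℝ) × (E →L[ℝ] F) ×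
      (JModel E F →L[ℝ] ℝ) => q.2.1) := contDiff_snd.fst
  refine ContDiff.sum fun i _ => hα.clm_apply (contDiff_const.prodMk ?_)
  refine contDiff_clm_apply_iff.2 fun u => ?_
  simp only [ContinuousLinearMap.smulRight_apply, slot_apply, contactCoord_apply]
  have h1 : ContDiff ℝ ∞ (fun q : (E [⋀^Fin (n + 1)]→L[ℝ] ℝ) × (E →L[ℝ] F) ×
      (JModel E F →L[ℝ] ℝ) => q.1 (Function.update (fun j => (v j).1.1) i u)) :=
    contDiff_alternating_apply contDiff_fst fun _ => contDiff_const
  have h2 : ContDiff ℝ ∞ (fun q : (E [⋀^Fin (n + 1)]→L[ℝ] ℝ) × (E →L[ℝ] F) ×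
      (JModel E F →L[ℝ] ℝ) => (v i).1.2 - q.2.1 (v i).1.1) :=
    contDiff_const.sub (hA.clm_apply contDiff_const)
  exact h1.smul h2

/-- The Cartan form in coordinates, for a Lagrangian `f` and a volume form `ρ`. -/
def cartanCoord (ρ : E → E [⋀^Fin (n + 1)]→L[ℝ] ℝ) (f : JModel E F → ℝ) (z : JModel E F) :
    JModel E F [⋀^Fin (n + 1)]→L[ℝ] ℝ :=
  coordEndo (ρ z.1.1) z.2 (fderiv ℝ f z) +
    f z • (ρ z.1.1).compContinuousLinearMap (baseCoord E F)

theorem cartanCoord_eq_zero (ρ : E → E [⋀^Fin (n + 1)]→L[ℝ] ℝ) (f : JModel E F → ℝ)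
    (z : JModel E F) (v : Fin (n + 1) → JModel E F) (j : Fin (n + 1))
    (hj : (v j).1 = 0) : cartanCoord ρ f z v = 0 := by
  have h : (ρ z.1.1).compContinuousLinearMap (baseCoord E F) v = 0 :=
    (ρ z.1.1).map_coord_zero j (by simp [hj])
  simp [cartanCoord, coordEndo_eq_zero _ _ _ v j hj, h]

/-- Along the fibres of `J¹π → Y`, the derivative of the Cartan form only involves second
derivatives of the Lagrangian: by Cramer's rule, the terms with first derivatives cancel. -/
theorem fderiv_cartanCoord (hn : Module.finrank ℝ E = n + 1)
    (ρ : E → E [⋀^Fin (n + 1)]→L[ℝ] ℝ) (f : JModel E F → ℝ)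
    {z : JModel E F} (hf : ContDiffAt ℝ ∞ f z) (hd : DifferentiableAt ℝ (cartanCoord ρ f) z)
    (B : E →L[ℝ] F) :
    fderiv ℝ (cartanCoord ρ f) z (0, B) =
      coordEndo (ρ z.1.1) z.2 (fderiv ℝ (fderiv ℝ f) z (0, B)) := by
  -- differentiate along the line `z + t (0, B)`, on which only the fibre coordinates change
  ext v
  have hline : HasDerivAt (fun t : ℝ => z + t • ((0, B) : JModel E F)) (0, B) 0 := by
    simpa using ((hasDerivAt_id (0 : ℝ)).smul_const ((0, B) : JModel E F)).const_add z
  have hz0 : z + (0 : ℝ) • ((0, B) : JModel E F) = z := by simp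
  have h1 : HasDerivAt (fun t : ℝ => cartanCoord ρ f (z + t • ((0, B) : JModel E F)) v)
      (fderiv ℝ (cartanCoord ρ f) z (0, B) v) 0 := by
    rw [← fderiv_continuousAlternatingMap_apply_const_apply hd]
    exact HasFDerivAt.comp_hasDerivAt_of_eq (0 : ℝ)
      (hd.continuousAlternatingMap_apply_const v).hasFDerivAt hline hz0.symm
  have hf1 : HasDerivAt (fun t : ℝ => f (z + t • ((0, B) : JModel E F)))
      (fderiv ℝ f z (0, B)) 0 :=
    HasFDerivAt.comp_hasDerivAt_of_eq (0 : ℝ) (hf.differentiableAt (by simp)).hasFDerivAt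
      hline hz0.symm
  have hf2 : HasDerivAt (fun t : ℝ => fderiv ℝ f (z + t • ((0, B) : JModel E F)))
      (fderiv ℝ (fderiv ℝ f) z (0, B)) 0 :=
    HasFDerivAt.comp_hasDerivAt_of_eq (0 : ℝ)
      ((hf.fderiv_right (m := ∞) (by simp)).differentiableAt (by simp)).hasFDerivAt
      hline hz0.symm
  have hexp : ∀ t : ℝ, cartanCoord ρ f (z + t • ((0, B) : JModel E F)) v =
      ∑ i, fderiv ℝ f (z + t • ((0, B) : JModel E F))
        ((0, (slot (ρ z.1.1) (fun j => (v j).1.1) i).smulRight (contactCoord z.2 (v i))) -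
          t • (0, (slot (ρ z.1.1) (fun j => (v j).1.1) i).smulRight (B (v i).1.1))) +
      f (z + t • ((0, B) : JModel E F)) * ρ z.1.1 (fun j => (v j).1.1) := by
    intro t
    have hz1 : (z + t • ((0, B) : JModel E F)).1 = z.1 := by simp
    rw [cartanCoord, ContinuousAlternatingMap.add_apply, coordEndo_apply, hz1]
    congr 1
    refine Finset.sum_congr rfl fun i _ => congrArg _ ?_
    ext1
    · simp
    · ext u
      simp [smul_sub, smul_add, smul_comm t]
      abel
  have hsum : HasDerivAt (fun t : ℝ => cartanCoord ρ f (z + t • ((0, B) : JModel E F)) v)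
      (∑ i, (fderiv ℝ (fderiv ℝ f) z (0, B)
          (0, (slot (ρ z.1.1) (fun j => (v j).1.1) i).smulRight (contactCoord z.2 (v i))) -
        fderiv ℝ f z (0, (slot (ρ z.1.1) (fun j => (v j).1.1) i).smulRight (B (v i).1.1))) +
      fderiv ℝ f z (0, B) * ρ z.1.1 (fun j => (v j).1.1)) 0 := by
    rw [funext hexp]
    refine HasDerivAt.add ?_ (hf1.mul_const _)
    refine HasDerivAt.fun_sum fun i _ => ?_
    have hc : ∀ c d : JModel E F, HasDerivAt (fun t : ℝ => c - t • d) (-d) 0 := fun c d => by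
      simpa using ((hasDerivAt_id (0 : ℝ)).smul_const d).const_sub c
    have := hf2.clm_apply (hc
      (0, (slot (ρ z.1.1) (fun j => (v j).1.1) i).smulRight (contactCoord z.2 (v i)))
      (0, (slot (ρ z.1.1) (fun j => (v j).1.1) i).smulRight (B (v i).1.1)))
    simpa only [zero_smul, add_zero, sub_zero, map_neg, ← sub_eq_add_neg] using this
  -- the terms with first derivatives of `f`: Cramer's rule, after applying `B`
  have hcancel : ∑ i, fderiv ℝ f z
      (0, (slot (ρ z.1.1) (fun j => (v j).1.1) i).smulRight (B (v i).1.1)) =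
      fderiv ℝ f z (0, B) * ρ z.1.1 (fun j => (v j).1.1) := by
    rw [← map_sum, mul_comm, ← smul_eq_mul, ← map_smul]
    congr 1
    ext1
    · simp [Prod.fst_sum]
    · ext u
      have h := congrArg B (sum_slot_smul hn (ρ z.1.1) (fun j => (v j).1.1) u)
      simp only [map_sum, map_smul] at h
      simp only [Prod.snd_sum, sum_apply, ContinuousLinearMap.smulRight_apply, Prod.smul_snd,
        smul_apply]
      exact h
  rw [h1.unique hsum, Finset.sum_sub_distrib, hcancel, coordEndo_apply]
  ring

/-- `i_ζ d ψ` is the derivative of `ψ` in the direction `ζ` if `ψ` is annihilated by the constant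
vector field `ζ`. -/
theorem extDeriv_curryLeft {V : Type*} [NormedAddCommGroup V] [NormedSpace ℝ V] {p : ℕ}
    (ψ : V → V [⋀^Fin (p + 1)]→L[ℝ] ℝ) (z ζ : V) (hd : DifferentiableAt ℝ ψ z)
    (h0 : ∀ z' v, ψ z' (Matrix.vecCons ζ v) = 0) :
    (extDeriv ψ z).curryLeft ζ = fderiv ℝ ψ z ζ := by
  ext v
  rw [ContinuousAlternatingMap.curryLeft_apply_apply, extDeriv_apply hd, Fin.sum_univ_succ]
  have h1 : ∀ j : Fin (p + 1), (ψ · (j.succ.removeNth (Matrix.vecCons ζ v))) = fun _ => (0 : ℝ) := by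
    intro j
    have h2 : j.succ.removeNth (Matrix.vecCons ζ v) = Matrix.vecCons ζ (j.removeNth v) := by
      ext k
      refine Fin.cases ?_ (fun k => ?_) k <;> simp [Fin.removeNth]
    funext z'
    rw [h2, h0]
  have h3 : Fin.removeNth 0 (Matrix.vecCons ζ v) = v := by ext j; simp [Fin.removeNth]
  simp only [h1, h3, fderiv_const_apply]
  simp [fderiv_continuousAlternatingMap_apply_const_apply, hd]

end CoordinateForms

/-! ### The Poincaré–Cartan form on vertical vectors -/

/-- The Hessian of a function at the origin. -/
def hessianZero {V : Type*} [NormedAddCommGroup V] [NormedSpace ℝ V] (f : V → ℝ) :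
    V →L[ℝ] V →L[ℝ] ℝ :=
  fderiv ℝ (fderiv ℝ f) 0

section Field

variable {E F : Type*} [NormedAddCommGroup E] [NormedSpace ℝ E] [FiniteDimensional ℝ E]
  [NormedAddCommGroup F] [NormedSpace ℝ F]
  {X Y : Type*} [TopologicalSpace X] [ChartedSpace E X]
  [TopologicalSpace Y] [ChartedSpace (E × F) Y]
  [IsManifold 𝓘(ℝ, E) ∞ X] [IsManifold 𝓘(ℝ, E × F) ∞ Y]
  {π : Y → X} [IsSmoothFibreBundle E (E × F) F π] {n : ℕ}

theorem contactTensor_apply (γ : J1 E F π) (ε : E →L[ℝ] ℝ) (v : JModel E F) (u : E) :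
    (contactTensor γ ε v).1 u = ε u • contactMap γ v := rfl

theorem vertEndoPullback_apply (η : X → E [⋀^Fin (n + 1)]→L[ℝ] ℝ) (γ : J1 E F π)
    (α : JModel E F →L[ℝ] ℝ) (v : Fin (n + 1) → JModel E F) :
    vertEndoPullback η γ α v = ∑ i, α (vertLift γ (contactTensor γ
      (slot (η γ.base) (fun j => dmap (JModel E F) E (J1.base : J1 E F π → X) γ (v j)) i) (v i))) :=
  sum_covWedge_contraction_apply (Module.finBasis ℝ E)
    { toFun := fun ε => α ∘L vertLift γ ∘L contactTensor γ ε
      map_add' := fun ε ε' => ContinuousLinearMap.ext fun w => by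
        have : contactTensor γ (ε + ε') w = contactTensor γ ε w + contactTensor γ ε' w :=
          Subtype.ext (ContinuousLinearMap.ext fun u => add_smul (ε u) (ε' u) (contactMap γ w))
        simp only [ContinuousLinearMap.comp_apply, add_apply, this, map_add]
      map_smul' := fun c ε => ContinuousLinearMap.ext fun w => by
        have : contactTensor γ (c • ε) w = c • contactTensor γ ε w :=
          Subtype.ext (ContinuousLinearMap.ext fun u => mul_smul c (ε u) (contactMap γ w))
        simp only [ContinuousLinearMap.comp_apply, smul_apply, this, map_smul, RingHom.id_apply] }
    (dmap (JModel E F) E (J1.base : J1 E F π → X) γ) (η γ.base) v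

namespace AdaptedChart

variable (a : AdaptedChart E F π) (γ₀ : J1 E F π) {γ : J1 E F π}

/-- The coordinate expression of a form on `X`: its pullback by the inverse of the coordinates. -/
def baseForm (η : X → E [⋀^Fin (n + 1)]→L[ℝ] ℝ) (u : E) : E [⋀^Fin (n + 1)]→L[ℝ] ℝ :=
  (η (a.base.symm u)).compContinuousLinearMap (a.dBaseSymm u)

theorem jetHomeo_fst_fst (hγ : γ.pt ∈ a.tot.source) :
    (a.jetHomeo γ₀ γ).1.1 = a.base (π γ.pt) := (a.base_proj _ hγ).symm

theorem baseForm_jetHomeo (η : X → E [⋀^Fin (n + 1)]→L[ℝ] ℝ) (hγ : γ.pt ∈ a.tot.source) :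
    a.baseForm η (a.jetHomeo γ₀ γ).1.1 =
      (η γ.base).compContinuousLinearMap (a.dBaseSymm (a.base (π γ.pt))) := by
  rw [a.jetHomeo_fst_fst γ₀ hγ, baseForm, a.base.left_inv (a.proj_mem _ hγ)]; rfl

/-- The operation `S_η^*` in jet coordinates. -/
theorem vertEndoPullback_eq (η : X → E [⋀^Fin (n + 1)]→L[ℝ] ℝ) (hγ : γ.pt ∈ a.tot.source)
    (α : JModel E F →L[ℝ] ℝ) :
    vertEndoPullback η γ (α ∘L a.dJet γ₀ γ) =
      (coordEndo (a.baseForm η (a.jetHomeo γ₀ γ).1.1) (a.jetHomeo γ₀ γ).2 α).compContinuousLinearMap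
        (a.dJet γ₀ γ) := by
  ext v
  rw [vertEndoPullback_apply, ContinuousAlternatingMap.compContinuousLinearMap_apply,
    coordEndo_apply]
  refine Finset.sum_congr rfl fun i _ => ?_
  rw [ContinuousLinearMap.comp_apply, a.dJet_vertLift γ₀ hγ]
  congr 2
  ext u
  rw [a.vertCoord_apply, contactTensor_apply, map_smul, Prod.smul_snd, a.dTot_contactMap γ₀ hγ,
    ContinuousLinearMap.smulRight_apply]
  simp only [slot_apply, a.baseForm_jetHomeo γ₀ η hγ,
    ContinuousAlternatingMap.compContinuousLinearMap_apply]
  congr 2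
  funext j
  by_cases hij : j = i
  · subst hij; simp
  · simp [Function.update_of_ne hij, a.dmap_base_eq γ₀ hγ]

theorem dmap_comp_jetHomeo {L : J1 E F π → ℝ} (hL : ContMDiff 𝓘(ℝ, JModel E F) 𝓘(ℝ, ℝ) ∞ L)
    (hγ : γ.pt ∈ a.tot.source) :
    dmap (JModel E F) ℝ L γ =
      fderiv ℝ (L ∘ (a.jetHomeo γ₀).symm) (a.jetHomeo γ₀ γ) ∘L a.dJet γ₀ γ := by
  have hz := (a.jetHomeo γ₀).map_source hγ
  have hinv : (a.jetHomeo γ₀).symm (a.jetHomeo γ₀ γ) = γ := (a.jetHomeo γ₀).left_inv hγ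
  have h1 : fderiv ℝ (L ∘ (a.jetHomeo γ₀).symm) (a.jetHomeo γ₀ γ) =
      dmap (JModel E F) ℝ L ((a.jetHomeo γ₀).symm (a.jetHomeo γ₀ γ)) ∘L
        a.dJetSymm γ₀ (a.jetHomeo γ₀ γ) := by
    rw [← mfderiv_eq_fderiv]
    exact mfderiv_comp _ (hL.mdifferentiableAt (by simp))
      ((a.jetHomeo_mdiff γ₀).mdifferentiableAt_symm hz)
  rw [hinv] at h1
  rw [h1]
  refine ContinuousLinearMap.ext fun v => ?_
  simp only [ContinuousLinearMap.comp_apply]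
  rw [a.dJetSymm_dJet γ₀ hγ]

theorem contDiffOn_comp_jetHomeo_symm {L : J1 E F π → ℝ}
    (hL : ContMDiff 𝓘(ℝ, JModel E F) 𝓘(ℝ, ℝ) ∞ L) :
    ContDiffOn ℝ ∞ (L ∘ (a.jetHomeo γ₀).symm) (a.jetHomeo γ₀).target :=
  (hL.comp_contMDiffOn
    (contMDiffOn_symm_of_mem_maximalAtlas (a.jetHomeo_mem_maximalAtlas γ₀))).contDiffOn

theorem cartanForm_eq (η : X → E [⋀^Fin (n + 1)]→L[ℝ] ℝ) {L : J1 E F π → ℝ}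
    (hL : ContMDiff 𝓘(ℝ, JModel E F) 𝓘(ℝ, ℝ) ∞ L) (hγ : γ.pt ∈ a.tot.source) :
    cartanForm η L γ = (cartanCoord (a.baseForm η) (L ∘ (a.jetHomeo γ₀).symm)
      (a.jetHomeo γ₀ γ)).compContinuousLinearMap (a.dJet γ₀ γ) := by
  have hinv : (a.jetHomeo γ₀).symm (a.jetHomeo γ₀ γ) = γ := (a.jetHomeo γ₀).left_inv hγ
  rw [cartanForm, a.dmap_comp_jetHomeo γ₀ hL hγ, a.vertEndoPullback_eq γ₀ η hγ]
  ext v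
  simp only [cartanCoord, ContinuousAlternatingMap.add_apply,
    ContinuousAlternatingMap.compContinuousLinearMap_apply, ContinuousAlternatingMap.smul_apply,
    Function.comp_apply, hinv, a.baseForm_jetHomeo γ₀ η hγ]
  congr 3
  funext j
  exact a.dmap_base_eq γ₀ hγ _

/-- The coordinate expression of a smooth form on `X` is smooth. -/
theorem contDiffAt_baseForm {η : X → E [⋀^Fin (n + 1)]→L[ℝ] ℝ} (hη : SmoothForm η Set.univ)
    {u : E} (hu : u ∈ a.base.target) : ContDiffAt ℝ ∞ (a.baseForm η) u := by
  set x := a.base.symm u with hx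
  have hxs : x ∈ (chartAt E x).source := mem_chart_source E x
  have h1 := hη x (Set.mem_univ _)
  have hs : ContMDiffAt 𝓘(ℝ, E) 𝓘(ℝ, E) ∞ a.base.symm u :=
    a.base_symm_smooth.contMDiffAt (a.base.open_target.mem_nhds hu)
  have h2 := (h1.comp u hs).contDiffAt
  have hev : ∀ᶠ w in 𝓝 u, w ∈ a.base.target ∧ a.base.symm w ∈ (chartAt E x).source :=
    (a.base.open_target.eventually_mem hu).and
      (hs.continuousAt.eventually ((chartAt E x).open_source.mem_nhds hxs))
  have hch : ContDiffAt ℝ ∞ (chartAt E x ∘ a.base.symm) u :=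
    ((contMDiffAt_of_mem_maximalAtlas (IsManifold.chart_mem_maximalAtlas x) hxs).comp u
      hs).contDiffAt
  have h3 := contDiff_compContinuousLinearMap.contDiffAt.comp u
    (h2.prodMk (hch.fderiv_right (m := ∞) (by simp)))
  refine h3.congr_of_eventuallyEq ?_
  filter_upwards [hev] with w hw
  have hm : MDifferentiableAt 𝓘(ℝ, E) 𝓘(ℝ, E) a.base.symm w :=
    a.base_mdiff.mdifferentiableAt_symm hw.1
  have hc : (chartAt E x).MDifferentiable 𝓘(ℝ, E) 𝓘(ℝ, E) :=
    mdifferentiable_of_mem_atlas (chart_mem_atlas E x)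
  have h4 : fderiv ℝ (chartAt E x ∘ a.base.symm) w =
      dmap E E (chartAt E x) (a.base.symm w) ∘L a.dBaseSymm w := by
    rw [← mfderiv_eq_fderiv]
    exact mfderiv_comp w (hc.mdifferentiableAt hw.2) hm
  ext v
  simp only [baseForm, Function.comp_apply, h4,
    ContinuousAlternatingMap.compContinuousLinearMap_apply]
  congr 1
  funext j
  exact (congrArg (fun f : E →L[ℝ] E => f (a.dBaseSymm w (v j))) (hc.symm_comp_deriv hw.2)).symm

theorem contDiffAt_cartanCoord [FiniteDimensional ℝ F] {η : X → E [⋀^Fin (n + 1)]→L[ℝ] ℝ}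
    (hη : SmoothForm η Set.univ) {L : J1 E F π → ℝ}
    (hL : ContMDiff 𝓘(ℝ, JModel E F) 𝓘(ℝ, ℝ) ∞ L) {z : JModel E F}
    (hz : z ∈ (a.jetHomeo γ₀).target) :
    ContDiffAt ℝ ∞ (cartanCoord (a.baseForm η) (L ∘ (a.jetHomeo γ₀).symm)) z := by
  have hf : ContDiffAt ℝ ∞ (L ∘ (a.jetHomeo γ₀).symm) z :=
    (a.contDiffOn_comp_jetHomeo_symm γ₀ hL).contDiffAt ((a.jetHomeo γ₀).open_target.mem_nhds hz)
  have hz1 : z.1.1 ∈ a.base.target := by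
    have h := a.tot.map_target hz
    have h2 := a.base_proj _ h
    rw [a.tot.right_inv hz] at h2
    rw [← h2]
    exact a.base.map_source (a.proj_mem _ h)
  have hρ : ContDiffAt ℝ ∞ (fun z : JModel E F => a.baseForm η z.1.1) z :=
    ContDiffAt.comp z (f := fun z : JModel E F => z.1.1) (a.contDiffAt_baseForm hη hz1)
      contDiffAt_fst.fst
  exact (contDiff_coordEndo.contDiffAt.comp z
    (hρ.prodMk (contDiffAt_snd.prodMk (hf.fderiv_right (m := ∞) (by simp))))).add
    (contDiff_smul_alternating.contDiffAt.comp z (hf.prodMk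
      (contDiff_compContinuousLinearMap.contDiffAt.comp z (hρ.prodMk contDiffAt_const))))

/-- The Hessian of a function on the model space of `J¹π`, restricted to an affine subspace of a
fibre that is parametrized by the linear map `s`. -/
theorem hessianZero_comp_fibre {V : Type*} [NormedAddCommGroup V] [NormedSpace ℝ V]
    (g : V → ℝ) (f : JModel E F → ℝ) (z : JModel E F) (s : V → E →L[ℝ] F)
    (hs : ∃ σ : V →L[ℝ] E →L[ℝ] F, s = σ)
    (hf : ∀ A, ContDiffAt ℝ ∞ f (z.1, z.2 + s A)) (hg : ∀ A, g A = f (z.1, z.2 + s A)) (A A' : V) :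
    hessianZero g A A' = fderiv ℝ (fderiv ℝ f) z (0, s A) (0, s A') := by
  obtain ⟨σ, rfl⟩ := hs
  obtain rfl : g = _ := funext hg
  set ι := ContinuousLinearMap.inr ℝ (E × F) (E →L[ℝ] F) ∘L σ
  have h1 : (fderiv ℝ fun A => f (z.1, z.2 + σ A)) =
      fun A => (ContinuousLinearMap.compL ℝ V (JModel E F) ℝ).flip ι
        (fderiv ℝ f (z.1, z.2 + σ A)) := by
    funext A
    exact (((hf A).differentiableAt (by simp)).hasFDerivAt.comp A
      (hasFDerivAt_fibre z σ A)).fderiv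
  have h2 : DifferentiableAt ℝ (fderiv ℝ f) (z.1, z.2 + σ 0) :=
    ((hf 0).fderiv_right (m := ∞) (by simp)).differentiableAt (by simp)
  have h4 : HasFDerivAt (fun A => fderiv ℝ f (z.1, z.2 + σ A))
      (fderiv ℝ (fderiv ℝ f) (z.1, z.2 + σ 0) ∘L ι) 0 :=
    HasFDerivAt.comp (G := JModel E F →L[ℝ] ℝ) (g := fderiv ℝ f)
      (f := fun A => ((z.1, z.2 + σ A) : JModel E F)) 0 h2.hasFDerivAt (hasFDerivAt_fibre z σ 0)
  have h3 := HasFDerivAt.comp (E := V) (F := JModel E F →L[ℝ] ℝ) (G := V →L[ℝ] ℝ)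
    (g := (ContinuousLinearMap.compL ℝ V (JModel E F) ℝ).flip ι) (0 : V)
    ((ContinuousLinearMap.compL ℝ V (JModel E F) ℝ).flip ι).hasFDerivAt h4
  rw [hessianZero, h1]
  refine (congrArg (fun g : V →L[ℝ] V →L[ℝ] ℝ => g A A') h3.fderiv).trans ?_
  rw [map_zero, add_zero]
  rfl

/-- The fibre Hessian of the Lagrangian in coordinates. -/
theorem hessianZero_fibre {L : J1 E F π → ℝ} (hL : ContMDiff 𝓘(ℝ, JModel E F) 𝓘(ℝ, ℝ) ∞ L)
    (hγ : γ.pt ∈ a.tot.source) (A A' : vertHom γ) :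
    hessianZero (fun A : vertHom γ => L (γ.add A)) A A' =
      fderiv ℝ (fderiv ℝ (L ∘ (a.jetHomeo γ₀).symm)) (a.jetHomeo γ₀ γ) (0, a.vertCoord γ A)
        (0, a.vertCoord γ A') := by
  have hf : ∀ A : vertHom γ, ContDiffAt ℝ ∞ (L ∘ (a.jetHomeo γ₀).symm)
      ((a.jetHomeo γ₀ γ).1, (a.jetHomeo γ₀ γ).2 + a.vertCoord γ A) := fun A =>
    (a.contDiffOn_comp_jetHomeo_symm γ₀ hL).contDiffAt
      ((a.jetHomeo γ₀).open_target.mem_nhds (a.tot.map_source hγ))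
  have h0 : ∀ A : vertHom γ, L (γ.add A) = (L ∘ (a.jetHomeo γ₀).symm)
      ((a.jetHomeo γ₀ γ).1, (a.jetHomeo γ₀ γ).2 + a.vertCoord γ A) := fun A =>
    congrArg (fun g => L (g A)) (a.add_eq γ₀ hγ)
  have h1 := hessianZero_comp_fibre (V := vertHom γ) (fun A => L (γ.add A))
    (L ∘ (a.jetHomeo γ₀).symm) (a.jetHomeo γ₀ γ) (fun A => a.vertCoord γ A)
    ⟨a.vertCoord γ, rfl⟩ hf h0 A A'
  exact h1

end AdaptedChart

/-- Contracting the Poincaré–Cartan form with a vertical vector gives the form `-S_η^* α`, where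
`α` is the contraction of the fibre Hessian of the Lagrangian with this vector. -/
theorem poincareCartan_curryLeft_vertLift [FiniteDimensional ℝ F]
    (hn : Module.finrank ℝ E = n + 1) {η : X → E [⋀^Fin (n + 1)]→L[ℝ] ℝ}
    (hη : SmoothForm η Set.univ) {L : J1 E F π → ℝ}
    (hL : ContMDiff 𝓘(ℝ, JModel E F) 𝓘(ℝ, ℝ) ∞ L) (γ : J1 E F π) (A : vertHom γ)
    (α : JModel E F →L[ℝ] ℝ) (hα : ∀ A' : vertHom γ, α (vertLift γ A') =
      hessianZero (fun A : vertHom γ => L (γ.add A)) A A') :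
    (poincareCartan η L γ).curryLeft (vertLift γ A) = -vertEndoPullback η γ α := by
  -- the preferred chart at `γ`, which occurs in the definition of the exterior derivative
  let a : AdaptedChart E F π := (exists_adaptedChart π γ.pt).choose
  have hγ : γ.pt ∈ a.tot.source := (exists_adaptedChart π γ.pt).choose_spec
  have hch : chartAt (JModel E F) γ = a.jetHomeo γ := rfl
  have hz := (a.jetHomeo γ).map_source (x := γ) hγ
  have hloc : formInChart γ (cartanForm η L) =ᶠ[𝓝 (a.jetHomeo γ γ)]
      cartanCoord (a.baseForm η) (L ∘ (a.jetHomeo γ).symm) := by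
    filter_upwards [(a.jetHomeo γ).open_target.mem_nhds hz] with z hz
    have hs : ((a.jetHomeo γ).symm z).pt ∈ a.tot.source := (a.jetHomeo γ).map_target hz
    rw [formInChart, hch, a.cartanForm_eq γ η hL hs, (a.jetHomeo γ).right_inv hz]
    ext v
    simp only [ContinuousAlternatingMap.compContinuousLinearMap_apply]
    congr 1
    funext j
    have := a.dJet_dJetSymm γ hs (v j)
    rw [(a.jetHomeo γ).right_inv hz] at this
    exact this
  have hsm := a.contDiffAt_cartanCoord γ hη hL hz
  have hf : ContDiffAt ℝ ∞ (L ∘ (a.jetHomeo γ).symm) (a.jetHomeo γ γ) :=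
    (a.contDiffOn_comp_jetHomeo_symm γ hL).contDiffAt ((a.jetHomeo γ).open_target.mem_nhds hz)
  have hd := hsm.differentiableAt (by simp)
  have hΩ : poincareCartan η L γ = -(extDeriv (cartanCoord (a.baseForm η)
      (L ∘ (a.jetHomeo γ).symm)) (a.jetHomeo γ γ)).compContinuousLinearMap (a.dJet γ γ) := by
    rw [← hloc.extDeriv_eq]; rfl
  have hα' : vertEndoPullback η γ α = vertEndoPullback η γ
      (fderiv ℝ (fderiv ℝ (L ∘ (a.jetHomeo γ).symm)) (a.jetHomeo γ γ) (0, a.vertCoord γ A) ∘L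
        a.dJet γ γ) := by
    ext v
    simp only [vertEndoPullback_apply]
    refine Finset.sum_congr rfl fun i _ => ?_
    rw [hα, a.hessianZero_fibre γ hL hγ, ContinuousLinearMap.comp_apply, a.dJet_vertLift γ hγ]
  rw [hα', a.vertEndoPullback_eq γ η hγ, ← fderiv_cartanCoord hn _ _ hf hd,
    ← extDeriv_curryLeft _ _ _ hd (fun z' v => cartanCoord_eq_zero _ _ _ _ 0 rfl), hΩ]
  ext v
  simp only [ContinuousAlternatingMap.curryLeft_apply_apply, ContinuousAlternatingMap.neg_apply,
    ContinuousAlternatingMap.compContinuousLinearMap_apply]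
  congr 2
  funext j
  refine Fin.cases ?_ (fun j => ?_) j
  · exact a.dJet_vertLift γ hγ A
  · rfl

end Field

/-! ### Consequences of regularity -/

section Regular

variable {E F : Type*} [NormedAddCommGroup E] [NormedSpace ℝ E] [FiniteDimensional ℝ E]
  [NormedAddCommGroup F] [NormedSpace ℝ F] [FiniteDimensional ℝ F]
  {X Y : Type*} [TopologicalSpace X] [ChartedSpace E X]
  [TopologicalSpace Y] [ChartedSpace (E × F) Y]
  [IsManifold 𝓘(ℝ, E) ∞ X] [IsManifold 𝓘(ℝ, E × F) ∞ Y]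
  {π : Y → X} [IsSmoothFibreBundle E (E × F) F π] {n : ℕ}

/-- Every linear form is the contraction of a non-degenerate Hessian with some vector. -/
theorem exists_hessianZero_eq {V : Type*} [NormedAddCommGroup V] [NormedSpace ℝ V]
    [FiniteDimensional ℝ V] {f : V → ℝ} (hf : HasNondegenerateHessian f) {ℓ : V → ℝ}
    (hℓ : IsLinearMap ℝ ℓ) : ∃ v, ∀ w, ℓ w = hessianZero f v w := by
  let T : V →ₗ[ℝ] Module.Dual ℝ V :=
    (ContinuousLinearMap.coeLM ℝ).comp (hessianZero f).toLinearMap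
  have hinj : Function.Injective T := by
    rw [injective_iff_map_eq_zero]
    intro v hv
    refine hf v (ContinuousLinearMap.ext fun w => ?_)
    exact congrArg (fun g : Module.Dual ℝ V => g w) hv
  have hsurj := (LinearMap.injective_iff_surjective_of_finrank_eq_finrank
    (Subspace.dual_finrank_eq (K := ℝ) (V := V)).symm).1 hinj
  obtain ⟨v, hv⟩ := hsurj (hℓ.mk' ℓ)
  exact ⟨v, fun w => (congrArg (fun g : Module.Dual ℝ V => g w) hv).symm⟩

/-- For a regular Lagrangian, every form `S_η^* α` is a contraction of the Poincaré–Cartan form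
with a vertical vector. -/
theorem exists_curryLeft_eq (hn : Module.finrank ℝ E = n + 1)
    {η : X → E [⋀^Fin (n + 1)]→L[ℝ] ℝ} (hη : SmoothForm η Set.univ) {L : J1 E F π → ℝ}
    (hL : ContMDiff 𝓘(ℝ, JModel E F) 𝓘(ℝ, ℝ) ∞ L) (hreg : IsRegularLagrangian L)
    (γ : J1 E F π) (α : JModel E F →L[ℝ] ℝ) :
    ∃ A : vertHom γ, (poincareCartan η L γ).curryLeft (vertLift γ A) = -vertEndoPullback η γ α := by
  obtain ⟨A, hA⟩ := exists_hessianZero_eq (V := vertHom γ) (hreg γ)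
    (ℓ := fun A' => α (vertLift γ A'))
    ⟨fun x y => by rw [map_add, map_add], fun c x => by rw [map_smul, map_smul]⟩
  exact ⟨A, poincareCartan_curryLeft_vertLift hn hη hL γ A α hA⟩

/-- A horizontal projector which solves the De Donder–Weyl equation of a regular Lagrangian takes
values in the kernel of the contact forms, i.e. it is semi-holonomic. -/
theorem contactMap_horizontal_eq_zero (hn : Module.finrank ℝ E = n + 1)
    {η : X → E [⋀^Fin (n + 1)]→L[ℝ] ℝ} (hη : SmoothForm η Set.univ) {L : J1 E F π → ℝ}
    (hL : ContMDiff 𝓘(ℝ, JModel E F) 𝓘(ℝ, ℝ) ∞ L) (hreg : IsRegularLagrangian L)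
    (γ : J1 E F π) (hη0 : η γ.base ≠ 0) (H : JModel E F →L[ℝ] JModel E F)
    (hidem : ∀ v, H (H v) = H v)
    (hker : ∀ v, H v = 0 ↔ dmap (JModel E F) E (J1.base : J1 E F π → X) γ v = 0)
    (hDDW : insertEnd H (poincareCartan η L γ) = (n : ℝ) • poincareCartan η L γ)
    (w : JModel E F) : contactMap γ (H w) = 0 := by
  set T := dmap (JModel E F) E (J1.base : J1 E F π → X) γ with hT
  set Ω := poincareCartan η L γ with hΩ
  have hTH : ∀ v, T (H v) = T v := fun v => by
    rw [← sub_eq_zero, ← map_sub, ← hker, map_sub, hidem, sub_self]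
  let b := Module.finBasisOfFinrankEq ℝ E hn
  choose v hv using fun i => dmap_base_surjective γ (b i)
  set u : Fin (n + 1) → JModel E F := fun i => H (v i) with hu
  have hTu : (fun j => T (u j)) = b := funext fun j => (hTH _).trans (hv j)
  have hb : η γ.base b ≠ 0 := fun h0 => hη0 (by
    have := (AlternatingMap.map_basis_eq_zero_iff b (η γ.base).toAlternatingMap).1 h0
    exact ContinuousAlternatingMap.toAlternatingMap_injective this)
  -- evaluate the equation on one vertical and `n + 1` horizontal vectors
  have h1 : ∀ α, vertEndoPullback η γ α u = 0 := by
    intro α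
    obtain ⟨A, hA⟩ := exists_curryLeft_eq hn hη hL hreg γ α
    have h2 := congrArg (fun ψ : JModel E F [⋀^Fin (n + 1)]→L[ℝ] ℝ => ψ u) hA
    have h3 := congrArg (fun ψ : JModel E F [⋀^Fin (n + 1 + 1)]→L[ℝ] ℝ =>
      ψ (Matrix.vecCons (vertLift γ A) u)) hDDW
    simp only [ContinuousAlternatingMap.curryLeft_apply_apply,
      ContinuousAlternatingMap.neg_apply] at h2
    have hζ : H (vertLift γ A) = 0 := by
      rw [hker, hT, dmap_base, dmap_pt_vertLift, map_zero]
    have h4 : ∀ i : Fin (n + 1), Function.update (Matrix.vecCons (vertLift γ A) u) i.succ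
        (H (Matrix.vecCons (vertLift γ A) u i.succ)) = Matrix.vecCons (vertLift γ A) u := by
      intro i
      rw [Function.update_eq_self_iff]
      simp [hu, hidem]
    have h5 : Ω (Function.update (Matrix.vecCons (vertLift γ A) u) 0
        (H (Matrix.vecCons (vertLift γ A) u 0))) = 0 :=
      Ω.map_coord_zero 0 (by simp [hζ])
    simp only [insertEnd_apply, Fin.sum_univ_succ, h4, h5, Finset.sum_const, Finset.card_univ,
      Fintype.card_fin, ContinuousAlternatingMap.smul_apply, nsmul_eq_mul, smul_eq_mul] at h3
    push_cast at h3
    have h6 : Ω (Matrix.vecCons (vertLift γ A) u) = 0 := by linarith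
    rw [h6] at h2
    linarith
  set B : vertHom γ := ∑ i, contactTensor γ (slot (η γ.base) b i) (u i) with hB
  -- the sum in `vertEndoPullback_apply` is `α (vertLift γ B)`
  have h2 : vertLift γ B = 0 := by
    by_contra hne
    obtain ⟨α, hα⟩ := SeparatingDual.exists_ne_zero (R := ℝ) hne
    apply hα
    have := h1 α
    rw [vertEndoPullback_apply, hTu] at this
    rw [hB, map_sum, map_sum]
    exact this
  have h3 : B = 0 := vertLift_injective γ (by rw [h2, map_zero])
  -- the horizontal vectors `u i` project to the basis `b`, so `B (b j) = η(b) • θ (u j)`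
  have h4 : ∀ j, contactMap γ (u j) = 0 := by
    intro j
    have h5 : B.1 (b j) = η γ.base b • contactMap γ (u j) := by
      rw [hB, Submodule.coe_sum, sum_apply, Finset.sum_eq_single j]
      · rw [contactTensor_apply, slot_apply, Function.update_eq_self]
      · intro i _ hij
        have h0 : η γ.base (Function.update b i (b j)) = 0 :=
          (η γ.base).toAlternatingMap.map_update_self b hij
        rw [contactTensor_apply, slot_apply, h0, zero_smul]
      · simp
    rw [h3] at h5
    exact (smul_eq_zero.1 h5.symm).resolve_left hb
  have h5 : H w = ∑ j, b.repr (T w) j • u j := by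
    have h6 : H (w - ∑ j, b.repr (T w) j • v j) = 0 := by
      rw [hker, map_sub, map_sum]
      simp only [map_smul]
      rw [sub_eq_zero]
      conv_lhs => rw [← b.sum_repr (T w)]
      exact Finset.sum_congr rfl fun j _ => congrArg _ (hv j).symm
    rw [map_sub, sub_eq_zero, map_sum] at h6
    simpa only [map_smul] using h6
  rw [h5, map_sum]
  exact Finset.sum_eq_zero fun j _ => by rw [map_smul, h4, smul_zero]

end Regular

/-! ### Contact forms -/

section Contact

variable {E F : Type*} [NormedAddCommGroup E] [NormedSpace ℝ E] [FiniteDimensional ℝ E]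
  [NormedAddCommGroup F] [NormedSpace ℝ F]
  {X Y : Type*} [TopologicalSpace X] [ChartedSpace E X]
  [TopologicalSpace Y] [ChartedSpace (E × F) Y]
  [IsManifold 𝓘(ℝ, E) ∞ X] [IsManifold 𝓘(ℝ, E × F) ∞ Y]
  {π : Y → X} [IsSmoothFibreBundle E (E × F) F π]

/-- For each vector `w ≠ 0`, a symmetric bilinear map `Q` with `Q w = β`. -/
theorem exists_symmetric_bilinear_apply_eq {w : E} (hw : w ≠ 0) (β : E →L[ℝ] F) :
    ∃ Q : E →L[ℝ] E →L[ℝ] F, (∀ u v, Q u v = Q v u) ∧ Q w = β := by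
  obtain ⟨ε, hε⟩ := SeparatingDual.exists_eq_one (R := ℝ) hw
  refine ⟨ε.smulRight β + (ContinuousLinearMap.smulRightL ℝ E F ε) ∘L β -
    ε.smulRight (ε.smulRight (β w)), fun u v => ?_, ?_⟩
  · simp [smul_smul, mul_comm (ε u)]
    abel
  · ext v
    simp [hε]

/-- Quadratic local sections: through each jet `γ` there is a local section whose prolongation has,
in coordinates, the derivative `w ↦ ((w, A w), Q w)`, where `A` is the linear part of `γ` and `Q` is
a given symmetric bilinear map. -/
theorem AdaptedChart.exists_jetProlongation (a : AdaptedChart E F π) {γ : J1 E F π}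
    (hγ : γ.pt ∈ a.tot.source) (Q : E →L[ℝ] E →L[ℝ] F) (hQ : ∀ u v, Q u v = Q v u) :
    ∃ (U : Set X) (φ : X → Y) (σ : X → J1 E F π), IsJetProlongation U φ σ ∧ γ.base ∈ U ∧
      σ γ.base = γ ∧ ∀ v, dmap E (JModel E F) σ γ.base v =
        a.dJetSymm γ (a.jetHomeo γ γ) ((a.dBase γ.base v,
          (a.jetHomeo γ γ).2 (a.dBase γ.base v)), Q (a.dBase γ.base v)) := by
  set z := a.jetHomeo γ γ with hz
  set x₀ := z.1.1 with hx₀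
  let A : E → E →L[ℝ] F := fun u => z.2 + Q (u - x₀)
  let f : E → F := fun u => z.1.2 + z.2 (u - x₀) + (2⁻¹ : ℝ) • Q (u - x₀) (u - x₀)
  have hA : ContDiff ℝ ∞ A := contDiff_const.add (Q.contDiff.comp (contDiff_id.sub contDiff_const))
  have hA' : ∀ u, HasFDerivAt A Q u := fun u =>
    (Q.hasFDerivAt.comp u ((hasFDerivAt_id u).sub_const x₀)).const_add z.2
  have hf : ∀ u, HasFDerivAt f (A u) u := by
    intro u
    have h1 : HasFDerivAt (fun u : E => u - x₀) (ContinuousLinearMap.id ℝ E) u :=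
      (hasFDerivAt_id u).sub_const x₀
    have h2 : HasFDerivAt (fun u : E => Q (u - x₀)) Q u := Q.hasFDerivAt.comp u h1
    have h3 := ((z.2.hasFDerivAt.comp u h1).const_add z.1.2).add
      ((h2.clm_apply h1).const_smul (2⁻¹ : ℝ))
    refine h3.congr_fderiv ?_
    refine ContinuousLinearMap.ext fun v => ?_
    change z.2 v + (2⁻¹ : ℝ) • (Q (u - x₀) v + Q v (u - x₀)) = z.2 v + Q (u - x₀) v
    rw [hQ v (u - x₀), ← two_smul ℝ, smul_smul, inv_mul_cancel₀ two_ne_zero, one_smul]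
  have hfs : ContDiff ℝ ∞ f := by
    have h1 : ContDiff ℝ ∞ (fun u : E => u - x₀) := contDiff_id.sub contDiff_const
    exact (contDiff_const.add (z.2.contDiff.comp h1)).add
      (((Q.contDiff.comp h1).clm_apply h1).const_smul (2⁻¹ : ℝ))
  have hfz : f x₀ = z.1.2 := by simp [f]
  have hAz : A x₀ = z.2 := by simp [A]
  let g : E → E × F := fun u => (u, f u)
  have hg : ∀ u, HasFDerivAt g ((ContinuousLinearMap.id ℝ E).prod (A u)) u := fun u =>
    (hasFDerivAt_id u).prodMk (hf u)
  have hgs : ContDiff ℝ ∞ g := contDiff_id.prodMk hfs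
  let G : E → JModel E F := fun u => (g u, A u)
  have hG : ∀ u, HasFDerivAt G (((ContinuousLinearMap.id ℝ E).prod (A u)).prod Q) u := fun u =>
    (hg u).prodMk (hA' u)
  let U : Set X := a.base.source ∩ a.base ⁻¹' (g ⁻¹' a.tot.target)
  have hxb : a.base γ.base = x₀ := (a.jetHomeo_fst_fst γ hγ).symm
  have hGx : G x₀ = z := by
    change ((x₀, f x₀), A x₀) = z
    rw [hfz, hAz]
  have hbs : γ.base ∈ a.base.source := a.proj_mem _ hγ
  refine ⟨U, fun x => a.tot.symm (g (a.base x)), fun x => (a.jetHomeo γ).symm (G (a.base x)),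
    ⟨?_, ?_, ?_, ?_, ?_⟩, ?_, ?_, ?_⟩
  · exact a.base.isOpen_inter_preimage (a.tot.open_target.preimage hgs.continuous)
  · refine a.tot_symm_smooth.comp (hgs.contMDiff.comp_contMDiffOn (a.base_smooth.mono
      Set.inter_subset_left)) fun x hx => hx.2
  · intro x hx
    rw [a.base_proj_tot_symm hx.2]
    exact a.base.left_inv hx.1
  · intro x hx
    exact a.jetHomeo_symm_pt γ (z := G (a.base x)) hx.2
  · intro x hx
    rw [a.jetHomeo_symm_lin γ (z := G (a.base x)) hx.2, a.base_proj_tot_symm (z := g (a.base x)) hx.2]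
    have h1 : a.base.symm (g (a.base x)).1 = x := a.base.left_inv hx.1
    have h2 : dmap E (E × F) (fun x => a.tot.symm (g (a.base x))) x =
        a.dTotSymm (g (a.base x)) ∘L dmap E (E × F) (g ∘ a.base) x :=
      mfderiv_comp x (a.tot_mdiff.mdifferentiableAt_symm hx.2)
        ((hg _).differentiableAt.mdifferentiableAt.comp x (a.base_mdiff.mdifferentiableAt hx.1))
    have h3 : dmap E (E × F) (g ∘ a.base) x =
        dmap E (E × F) g (a.base x) ∘L a.dBase x :=
      mfderiv_comp x (hg _).differentiableAt.mdifferentiableAt (a.base_mdiff.mdifferentiableAt hx.1)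
    have h4 : dmap E (E × F) g (a.base x) = (ContinuousLinearMap.id ℝ E).prod (A (a.base x)) := by
      rw [dmap, mfderiv_eq_fderiv]; exact (hg _).fderiv
    rw [h2, h3, h4, h1]
  · refine ⟨hbs, ?_⟩
    change g (a.base γ.base) ∈ a.tot.target
    rw [hxb]
    change (G x₀).1 ∈ a.tot.target
    rw [hGx]
    exact a.tot.map_source hγ
  · change (a.jetHomeo γ).symm (G (a.base γ.base)) = γ
    rw [hxb, hGx]
    exact (a.jetHomeo γ).left_inv hγ
  · intro v
    have hmem : G (a.base γ.base) ∈ (a.jetHomeo γ).target := by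
      rw [hxb, hGx]; exact (a.jetHomeo γ).map_source hγ
    have h2 : dmap E (JModel E F) (fun x => (a.jetHomeo γ).symm (G (a.base x))) γ.base =
        a.dJetSymm γ (G (a.base γ.base)) ∘L dmap E (JModel E F) (G ∘ a.base) γ.base :=
      mfderiv_comp γ.base ((a.jetHomeo_mdiff γ).mdifferentiableAt_symm hmem)
        ((hG _).differentiableAt.mdifferentiableAt.comp γ.base (a.base_mdiff.mdifferentiableAt hbs))
    have h3 : dmap E (JModel E F) (G ∘ a.base) γ.base =
        dmap E (JModel E F) G (a.base γ.base) ∘L a.dBase γ.base :=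
      mfderiv_comp γ.base (hG _).differentiableAt.mdifferentiableAt
        (a.base_mdiff.mdifferentiableAt hbs)
    have h4 : dmap E (JModel E F) G (a.base γ.base) =
        ((ContinuousLinearMap.id ℝ E).prod (A (a.base γ.base))).prod Q := by
      rw [dmap, mfderiv_eq_fderiv]; exact (hG _).fderiv
    rw [h2, h3, h4, hxb, hGx, hAz]
    rfl

/-- Contact `1`-forms vanish on the common kernel of the forms `θ^a`. -/
theorem IsContactForm.apply_eq_zero [Nontrivial E] {W : Set (J1 E F π)}
    {θ : J1 E F π → JModel E F [⋀^Fin 1]→L[ℝ] ℝ} (hθ : IsContactForm W θ)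
    {γ : J1 E F π} (hγW : γ ∈ W) {v : JModel E F} (hv : contactMap γ v = 0) :
    θ γ (fun _ => v) = 0 := by
  obtain ⟨a, hγ⟩ : ∃ a : AdaptedChart E F π, γ.pt ∈ a.tot.source := exists_adaptedChart π γ.pt
  set z := a.jetHomeo γ γ with hz
  let s : E → (E →L[ℝ] F) → JModel E F := fun w β => a.dJetSymm γ z ((w, z.2 w), β)
  -- tangent vectors to prolonged sections
  have key : ∀ w β, w ≠ 0 → toCovector (θ γ) (s w β) = 0 := by
    intro w β hw
    obtain ⟨Q, hQ, hQw⟩ := exists_symmetric_bilinear_apply_eq hw β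
    obtain ⟨U, φ, σ, hσ, hU, hσγ, hdσ⟩ := a.exists_jetProlongation hγ Q hQ
    have h1 := hθ.pullback_eq_zero U φ σ hσ γ.base hU (by rwa [hσγ])
    rw [hσγ] at h1
    have h2 := congrArg (fun ψ : E [⋀^Fin 1]→L[ℝ] ℝ =>
      ψ (fun _ => a.dBaseSymm (a.base γ.base) w)) h1
    have h3 : dmap E (JModel E F) σ γ.base (a.dBaseSymm (a.base γ.base) w) = s w β := by
      have h5 : a.dBase γ.base (a.dBaseSymm (a.base γ.base) w) = w :=
        a.dBase_dBaseSymm (a.proj_mem _ hγ) w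
      rw [hdσ, h5, hQw]
    have h4 : θ γ (fun _ => s w β) = 0 := by
      rw [← h3]; exact h2
    exact h4
  have hs : v = s (a.dJet γ γ v).1.1 (a.dJet γ γ v).2 := by
    have h1 := congrArg Prod.snd (a.dTot_contactMap γ hγ v)
    rw [hv, map_zero] at h1
    have h2 : (a.dJet γ γ v).1.2 = z.2 (a.dJet γ γ v).1.1 := (sub_eq_zero.1 h1.symm)
    have h3 : ((((a.dJet γ γ v).1.1, z.2 (a.dJet γ γ v).1.1), (a.dJet γ γ v).2) : JModel E F) =
        a.dJet γ γ v := by rw [← h2]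
    change v = a.dJetSymm γ z _
    rw [h3, a.dJetSymm_dJet γ hγ]
  change toCovector (θ γ) v = 0
  rw [hs]
  by_cases hw : (a.dJet γ γ v).1.1 = 0
  · -- vertical vectors are differences of tangent vectors to prolonged sections
    obtain ⟨w, hw0⟩ := exists_ne (0 : E)
    have h1 : s (a.dJet γ γ v).1.1 (a.dJet γ γ v).2 = s w (a.dJet γ γ v).2 - s w 0 := by
      rw [hw, ← map_sub]
      simp [s]
      rfl
    rw [h1, map_sub, key _ _ hw0, key _ _ hw0, sub_zero]
  · exact key _ _ hw

end Contact

/-! ### The nonholonomic splitting -/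

section Splitting

variable {E F : Type*} [NormedAddCommGroup E] [NormedSpace ℝ E] [FiniteDimensional ℝ E]
  [NormedAddCommGroup F] [NormedSpace ℝ F] [FiniteDimensional ℝ F]
  {X Y : Type*} [TopologicalSpace X] [ChartedSpace E X]
  [TopologicalSpace Y] [ChartedSpace (E × F) Y]
  [IsManifold 𝓘(ℝ, E) ∞ X] [IsManifold 𝓘(ℝ, E × F) ∞ Y]
  {π : Y → X} [IsSmoothFibreBundle E (E × F) F π] {n : ℕ}
  {EC : Type*} [NormedAddCommGroup EC] [NormedSpace ℝ EC] [FiniteDimensional ℝ EC]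
  {C : Set (J1 E F π)} [ChartedSpace EC C]

/-- By regularity `D` has at least the rank of the bundle of constraint forms, so that it is a
complement of the tangent spaces of `C` if it is transversal to them. -/
theorem isCompl_tangentSub_constraintDist (hn : Module.finrank ℝ E = n + 1)
    {η : X → E [⋀^Fin (n + 1)]→L[ℝ] ℝ} (hη : SmoothForm η Set.univ) {L : J1 E F π → ℝ}
    (hL : ContMDiff 𝓘(ℝ, JModel E F) 𝓘(ℝ, ℝ) ∞ L) (hreg : IsRegularLagrangian L)
    (hC : IsSubmanifold EC C) {k : ℕ}
    (hk : Module.finrank ℝ EC + k = Module.finrank ℝ (JModel E F))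
    {Fc : C → Submodule ℝ (JModel E F [⋀^Fin (n + 1)]→L[ℝ] ℝ)}
    (hF : IsConstraintBundle EC η k Fc) (c : C)
    (hcomp : constraintDist η L Fc c ⊓ tangentSub EC C c = ⊥) :
    IsCompl (tangentSub EC C c) (constraintDist η L Fc c) := by
  obtain ⟨U, -, hcU, Φ, -, hΦ⟩ := hF c
  obtain ⟨himg, hli, hspan⟩ := hΦ c hcU
  have hT : Module.finrank ℝ (tangentSub EC C c) = Module.finrank ℝ EC :=
    LinearMap.finrank_range_of_inj (hC.immersion c)
  have hle : Fc c ≤ (constraintDist η L Fc c).map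
      (poincareCartan η L c.1).curryLeft.toLinearMap := by
    rw [hspan, Submodule.span_le]
    rintro _ ⟨i, rfl⟩
    obtain ⟨α, hα⟩ := himg i
    obtain ⟨A, hA⟩ := exists_curryLeft_eq hn hη hL hreg c.1 α
    have h1 : (poincareCartan η L c.1).curryLeft (-vertLift c.1 A) = Φ i c := by
      rw [map_neg, hA, neg_neg, hα]
    have h2 : dmap (JModel E F) (E × F) (J1.pt : J1 E F π → Y) c.1 (-vertLift c.1 A) = 0 := by
      rw [map_neg, dmap_pt_vertLift, neg_zero]
    have h3 : (poincareCartan η L c.1).curryLeft (-vertLift c.1 A) ∈ Fc c := by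
      rw [h1, hspan]
      exact Submodule.subset_span ⟨i, rfl⟩
    exact ⟨-vertLift c.1 A, ⟨h2, h3⟩, h1⟩
  have hFk : Module.finrank ℝ (Fc c) = k := by
    rw [hspan, finrank_span_eq_card hli, Fintype.card_fin]
  have hD : k ≤ Module.finrank ℝ (constraintDist η L Fc c) := by
    rw [← hFk]
    exact (Submodule.finrank_mono hle).trans (Submodule.finrank_map_le _ _)
  have hdisj : Disjoint (tangentSub EC C c) (constraintDist η L Fc c) := by
    rw [disjoint_iff, inf_comm]; exact hcomp
  exact ⟨hdisj, codisjoint_iff.2 (Submodule.eq_top_of_disjoint _ _ (by omega) hdisj)⟩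

end Splitting

/-! ### Smooth fields of linear maps -/

section Fields

variable {G H : Type*} [NormedAddCommGroup G] [NormedSpace ℝ G]
  [NormedAddCommGroup H] [NormedSpace ℝ H]
  {M N : Type*} [TopologicalSpace M] [ChartedSpace G M] [TopologicalSpace N] [ChartedSpace H N]

/-- The coordinate coframe of the preferred chart at `x₀`: the derivative of this chart at `x`. -/
def chartCoframe (x₀ x : M) : G →L[ℝ] G := dmap G G (chartAt G x₀) x

/-- The coordinate frame of the preferred chart at `x₀`: the inverse of `chartCoframe x₀ x` for `x` in
the domain of this chart. -/
def chartFrame (x₀ x : M) : G →L[ℝ] G := dmap G G (chartAt G x₀).symm (chartAt G x₀ x)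

theorem chartFrame_chartCoframe [IsManifold 𝓘(ℝ, G) ∞ M] {x₀ x : M}
    (hx : x ∈ (chartAt G x₀).source) (v : G) :
    chartFrame x₀ x (chartCoframe x₀ x v) = v := by
  have : IsManifold 𝓘(ℝ, G) 1 M := IsManifold.of_le (n := ∞) (by simp)
  exact congrArg (fun f : G →L[ℝ] G => f v)
    ((mdifferentiable_chart (I := 𝓘(ℝ, G)) x₀).symm_comp_deriv hx)

theorem chartCoframe_chartFrame [IsManifold 𝓘(ℝ, G) ∞ M] {x₀ x : M}
    (hx : x ∈ (chartAt G x₀).source) (v : G) :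
    chartCoframe x₀ x (chartFrame x₀ x v) = v := by
  have : IsManifold 𝓘(ℝ, G) 1 M := IsManifold.of_le (n := ∞) (by simp)
  have h := congrArg (fun f : G →L[ℝ] G => f v)
    ((mdifferentiable_chart (I := 𝓘(ℝ, G)) x₀).comp_symm_deriv ((chartAt G x₀).map_source hx))
  have h2 : (chartAt G x₀).symm (chartAt G x₀ x) = x := (chartAt G x₀).left_inv hx
  have h3 : chartCoframe x₀ ((chartAt G x₀).symm (chartAt G x₀ x)) (chartFrame x₀ x v) = v := h
  rwa [h2] at h3

theorem inTangentCoordinates_eq_chartFrame [IsManifold 𝓘(ℝ, G) ∞ M] [IsManifold 𝓘(ℝ, H) ∞ N]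
    (f : M → N) (A : M → G →L[ℝ] H) {x₀ x : M} (hx : x ∈ (chartAt G x₀).source)
    (hfx : f x ∈ (chartAt H (f x₀)).source) :
    inTangentCoordinates 𝓘(ℝ, G) 𝓘(ℝ, H) id f A x₀ x =
      chartCoframe (f x₀) (f x) ∘L A x ∘L chartFrame x₀ x := by
  have : IsManifold 𝓘(ℝ, G) 1 M := IsManifold.of_le (n := ∞) (by simp)
  have : IsManifold 𝓘(ℝ, H) 1 N := IsManifold.of_le (n := ∞) (by simp)
  have h1 : (chartFrame x₀ x : G →L[ℝ] G) = mfderivWithin 𝓘(ℝ, G) 𝓘(ℝ, G)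
      (extChartAt 𝓘(ℝ, G) x₀).symm (Set.range 𝓘(ℝ, G)) (extChartAt 𝓘(ℝ, G) x₀ x) := by
    simp [chartFrame, dmap]
    rfl
  have h2 : (chartCoframe (f x₀) (f x) : H →L[ℝ] H) =
      mfderiv 𝓘(ℝ, H) 𝓘(ℝ, H) (extChartAt 𝓘(ℝ, H) (f x₀)) (f x) := by
    simp [chartCoframe, dmap]
    rfl
  refine (inTangentCoordinates_eq_mfderiv_comp (I := 𝓘(ℝ, G)) (I' := 𝓘(ℝ, H)) (f := id) (g := f)
    (ϕ := A) hx hfx).trans ?_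
  exact congrArg₂ (fun (S : H →L[ℝ] H) (T : G →L[ℝ] G) => S ∘L A x ∘L T) h2.symm h1.symm

/-- Smoothness of the derivative of a smooth map, in frames. -/
theorem contMDiffAt_dmap [IsManifold 𝓘(ℝ, G) ∞ M] [IsManifold 𝓘(ℝ, H) ∞ N]
    {f : M → N} (hf : ContMDiff 𝓘(ℝ, G) 𝓘(ℝ, H) ∞ f) (x₀ : M) :
    ContMDiffAt 𝓘(ℝ, G) 𝓘(ℝ, G →L[ℝ] H) ∞
      (fun x => chartCoframe (f x₀) (f x) ∘L dmap G H f x ∘L chartFrame x₀ x) x₀ := by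
  have h1 := (hf.contMDiffAt (x := x₀)).mfderiv_const (m := ∞) (by simp)
  refine h1.congr_of_eventuallyEq ?_
  filter_upwards [(chartAt G x₀).open_source.mem_nhds (mem_chart_source G x₀),
    hf.continuous.continuousAt.preimage_mem_nhds
      ((chartAt H (f x₀)).open_source.mem_nhds (mem_chart_source H (f x₀)))] with x hx hfx
  exact (inTangentCoordinates_eq_chartFrame f (dmap G H f) hx hfx).symm

/-- A field of endomorphisms of the tangent spaces is a smooth section of the bundle of
endomorphisms if and only if its components in coordinate frames are smooth. -/
theorem contMDiff_endomorphism_iff [IsManifold 𝓘(ℝ, G) ∞ M] (A : M → G →L[ℝ] G) :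
    ContMDiff 𝓘(ℝ, G) (𝓘(ℝ, G).prod 𝓘(ℝ, G →L[ℝ] G)) ∞
      (fun b => Bundle.TotalSpace.mk' (G →L[ℝ] G)
        (E := fun b : M => TangentSpace 𝓘(ℝ, G) b →L[ℝ] TangentSpace 𝓘(ℝ, G) b) b (A b)) ↔
    ∀ x₀, ContMDiffAt 𝓘(ℝ, G) 𝓘(ℝ, G →L[ℝ] G) ∞
      (fun x => chartCoframe x₀ x ∘L A x ∘L chartFrame x₀ x) x₀ := by
  refine forall_congr' fun x₀ => ?_
  rw [contMDiffAt_hom_bundle]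
  refine (and_iff_right contMDiffAt_id).trans ?_
  refine Filter.EventuallyEq.contMDiffAt_iff ?_
  filter_upwards [(chartAt G x₀).open_source.mem_nhds (mem_chart_source G x₀)] with x hx
  exact inTangentCoordinates_eq_chartFrame id A hx hx

/-- A family of linear maps on a finite-dimensional space is smooth if its values are. -/
theorem contMDiffAt_clm_of_apply {V W : Type*} [NormedAddCommGroup V] [NormedSpace ℝ V]
    [FiniteDimensional ℝ V] [NormedAddCommGroup W] [NormedSpace ℝ W] {A : M → V →L[ℝ] W} {x₀ : M}
    (hA : ∀ v, ContMDiffAt 𝓘(ℝ, G) 𝓘(ℝ, W) ∞ (fun x => A x v) x₀) :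
    ContMDiffAt 𝓘(ℝ, G) 𝓘(ℝ, V →L[ℝ] W) ∞ A x₀ := by
  let b := Module.finBasis ℝ V
  let T : (Fin (Module.finrank ℝ V) → W) →L[ℝ] V →L[ℝ] W :=
    ∑ i, ContinuousLinearMap.smulRightL ℝ V W (LinearMap.toContinuousLinearMap (b.coord i)) ∘L
      ContinuousLinearMap.proj i
  have h1 : ContMDiffAt 𝓘(ℝ, G) 𝓘(ℝ, Fin (Module.finrank ℝ V) → W) ∞ (fun x i => A x (b i)) x₀ :=
    contMDiffAt_pi_space.2 fun i => hA (b i)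
  refine (T.contMDiff.contMDiffAt.comp x₀ h1).congr_of_eventuallyEq
    (Filter.Eventually.of_forall fun x => ContinuousLinearMap.ext fun v => ?_)
  simp only [T, Function.comp_apply, sum_apply, ContinuousLinearMap.comp_apply,
    ContinuousLinearMap.proj_apply, ContinuousLinearMap.smulRightL_apply_apply]
  conv_lhs => rw [← b.sum_repr v, map_sum]
  exact Finset.sum_congr rfl fun i _ => map_smul _ _ _

/-- Solving linear equations smoothly, for a family of linear maps whose values are smooth. -/
theorem exists_smooth_leftInverse_of_apply {V W : Type*} [NormedAddCommGroup V] [NormedSpace ℝ V]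
    [FiniteDimensional ℝ V] [NormedAddCommGroup W] [NormedSpace ℝ W] {A : M → V → W} {x₀ : M}
    (hlin : ∀ x, IsLinearMap ℝ (A x))
    (hA : ∀ v, ContMDiffAt 𝓘(ℝ, G) 𝓘(ℝ, W) ∞ (fun x => A x v) x₀)
    (hinj : ∀ v, A x₀ v = 0 → v = 0) :
    ∃ B : M → W →L[ℝ] V, ContMDiffAt 𝓘(ℝ, G) 𝓘(ℝ, W →L[ℝ] V) ∞ B x₀ ∧
      ∀ᶠ x in 𝓝 x₀, ∀ v, B x (A x v) = v :=
  exists_smooth_leftInverse (A := fun x => LinearMap.toContinuousLinearMap ((hlin x).mk' (A x)))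
    (contMDiffAt_clm_of_apply hA) ((injective_iff_map_eq_zero _).2 hinj)

end Fields

/-! ### Smoothness of the nonholonomic projector -/

section Smooth

variable {E F : Type*} [NormedAddCommGroup E] [NormedSpace ℝ E] [FiniteDimensional ℝ E]
  [NormedAddCommGroup F] [NormedSpace ℝ F] [FiniteDimensional ℝ F]
  {X Y : Type*} [TopologicalSpace X] [ChartedSpace E X]
  [TopologicalSpace Y] [ChartedSpace (E × F) Y]
  [IsManifold 𝓘(ℝ, E) ∞ X] [IsManifold 𝓘(ℝ, E × F) ∞ Y]
  {π : Y → X} [IsSmoothFibreBundle E (E × F) F π] {n : ℕ}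

/-- The preferred charts of `J¹π` are jet coordinates. -/
theorem exists_adaptedChart_chartAt_eq (γ₀ : J1 E F π) : ∃ a : AdaptedChart E F π,
    γ₀.pt ∈ a.tot.source ∧ chartAt (JModel E F) γ₀ = a.jetHomeo γ₀ :=
  ⟨_, (exists_adaptedChart π γ₀.pt).choose_spec, rfl⟩

theorem coordEndo_add (ρ : E [⋀^Fin (n + 1)]→L[ℝ] ℝ) (A : E →L[ℝ] F) (α β : JModel E F →L[ℝ] ℝ) :
    coordEndo ρ A (α + β) = coordEndo ρ A α + coordEndo ρ A β := by
  ext v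
  simp only [ContinuousAlternatingMap.add_apply, coordEndo_apply, add_apply,
    Finset.sum_add_distrib]

theorem coordEndo_smul (ρ : E [⋀^Fin (n + 1)]→L[ℝ] ℝ) (A : E →L[ℝ] F) (r : ℝ)
    (α : JModel E F →L[ℝ] ℝ) : coordEndo ρ A (r • α) = r • coordEndo ρ A α := by
  ext v
  simp only [ContinuousAlternatingMap.smul_apply, coordEndo_apply, smul_apply, Finset.smul_sum]

/-- Contractions of the Poincaré–Cartan form with `π₁₀`-vertical vectors, in coordinates. -/
theorem AdaptedChart.poincareCartan_curryLeft_eq (a : AdaptedChart E F π) (γ₀ : J1 E F π)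
    (hn : Module.finrank ℝ E = n + 1) {η : X → E [⋀^Fin (n + 1)]→L[ℝ] ℝ}
    (hη : SmoothForm η Set.univ) {L : J1 E F π → ℝ}
    (hL : ContMDiff 𝓘(ℝ, JModel E F) 𝓘(ℝ, ℝ) ∞ L) {γ : J1 E F π} (hγ : γ.pt ∈ a.tot.source)
    (B : E →L[ℝ] F) :
    ((poincareCartan η L γ).curryLeft
      (a.dJetSymm γ₀ (a.jetHomeo γ₀ γ) (0, B))).compContinuousLinearMap
        (a.dJetSymm γ₀ (a.jetHomeo γ₀ γ)) =
      -coordEndo (a.baseForm η (a.jetHomeo γ₀ γ).1.1) (a.jetHomeo γ₀ γ).2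
        (fderiv ℝ (fderiv ℝ (L ∘ (a.jetHomeo γ₀).symm)) (a.jetHomeo γ₀ γ) (0, B)) := by
  obtain ⟨A, rfl⟩ := a.vertCoord_surjective hγ B
  rw [← a.vertLift_eq γ₀ hγ, poincareCartan_curryLeft_vertLift hn hη hL γ A
    (fderiv ℝ (fderiv ℝ (L ∘ (a.jetHomeo γ₀).symm)) (a.jetHomeo γ₀ γ) (0, a.vertCoord γ A) ∘L
      a.dJet γ₀ γ) fun A' => ?_, a.vertEndoPullback_eq γ₀ η hγ]
  · ext v
    have h1 : (a.dJet γ₀ γ ∘ a.dJetSymm γ₀ (a.jetHomeo γ₀ γ) ∘ v) = v :=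
      funext fun i => a.dJet_dJetSymm γ₀ hγ (v i)
    simp only [ContinuousAlternatingMap.compContinuousLinearMap_apply,
      ContinuousAlternatingMap.neg_apply, h1]
  · rw [ContinuousLinearMap.comp_apply, a.dJet_vertLift γ₀ hγ, a.hessianZero_fibre γ₀ hL hγ]

end Smooth

section Nonholonomic

variable {E F : Type*} [NormedAddCommGroup E] [NormedSpace ℝ E] [FiniteDimensional ℝ E]
  [NormedAddCommGroup F] [NormedSpace ℝ F] [FiniteDimensional ℝ F]
  {X Y : Type*} [TopologicalSpace X] [ChartedSpace E X]
  [TopologicalSpace Y] [ChartedSpace (E × F) Y]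
  [IsManifold 𝓘(ℝ, E) ∞ X] [IsManifold 𝓘(ℝ, E × F) ∞ Y]
  {π : Y → X} [IsSmoothFibreBundle E (E × F) F π] {n : ℕ}
  {EC : Type*} [NormedAddCommGroup EC] [NormedSpace ℝ EC] [FiniteDimensional ℝ EC]
  {C : Set (J1 E F π)} [ChartedSpace EC C]

/-- The tangent map of the inclusion `C → J¹π`. -/
abbrev dIncl (EC : Type*) [NormedAddCommGroup EC] [NormedSpace ℝ EC]
    {C : Set (J1 E F π)} [ChartedSpace EC C] (c : C) : EC →L[ℝ] JModel E F :=
  dmap EC (JModel E F) (Subtype.val : C → J1 E F π) c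

section Pointwise

variable {η : X → E [⋀^Fin (n + 1)]→L[ℝ] ℝ} {L : J1 E F π → ℝ}
  {Fc : C → Submodule ℝ (JModel E F [⋀^Fin (n + 1)]→L[ℝ] ℝ)} {c : C}

theorem nonholProjector_mem (hc : IsCompl (tangentSub EC C c) (constraintDist η L Fc c))
    (w : JModel E F) : nonholProjector EC η L Fc c w ∈ tangentSub EC C c := by
  rw [nonholProjector, dif_pos hc]
  exact Submodule.projection_apply_mem hc w

theorem nonholProjector_apply_of_mem
    (hc : IsCompl (tangentSub EC C c) (constraintDist η L Fc c)) {w : JModel E F}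
    (hw : w ∈ tangentSub EC C c) : nonholProjector EC η L Fc c w = w := by
  rw [nonholProjector, dif_pos hc]
  exact (Submodule.projection_eq_self_iff hc w).2 hw

theorem sub_nonholProjector_mem (hc : IsCompl (tangentSub EC C c) (constraintDist η L Fc c))
    (w : JModel E F) : w - nonholProjector EC η L Fc c w ∈ constraintDist η L Fc c := by
  have h : nonholProjector EC η L Fc c (w - nonholProjector EC η L Fc c w) = 0 := by
    rw [map_sub, nonholProjector_apply_of_mem hc (nonholProjector_mem hc w), sub_self]
  revert h
  generalize w - nonholProjector EC η L Fc c w = v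
  rw [nonholProjector, dif_pos hc]
  exact fun h => (Submodule.projection_apply_eq_zero_iff hc).1 h

theorem dmap_pt_nonholProjector (hc : IsCompl (tangentSub EC C c) (constraintDist η L Fc c))
    (w : JModel E F) :
    dmap (JModel E F) (E × F) (J1.pt : J1 E F π → Y) c.1 (nonholProjector EC η L Fc c w) =
      dmap (JModel E F) (E × F) (J1.pt : J1 E F π → Y) c.1 w := by
  have h : dmap (JModel E F) (E × F) (J1.pt : J1 E F π → Y) c.1
    (w - nonholProjector EC η L Fc c w) = 0 := (sub_nonholProjector_mem hc w).1
  rw [map_sub, sub_eq_zero] at h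
  exact h.symm

end Pointwise

theorem contDiffAt_fderiv_fderiv_apply {V : Type*} [NormedAddCommGroup V] [NormedSpace ℝ V]
    {f : V → ℝ} {z : V} (hf : ContDiffAt ℝ ∞ f z) (v : V) :
    ContDiffAt ℝ ∞ (fun z => fderiv ℝ (fderiv ℝ f) z v) z :=
  ((hf.fderiv_right (m := ∞) (by simp)).fderiv_right (m := ∞) (by simp)).clm_apply contDiffAt_const

/-- The coefficients of the contraction of the Poincaré–Cartan form with a vertical coordinate field
are smooth. -/
theorem AdaptedChart.contDiffAt_coordEndo_hessian (a : AdaptedChart E F π) (γ₀ : J1 E F π)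
    {η : X → E [⋀^Fin (n + 1)]→L[ℝ] ℝ} (hη : SmoothForm η Set.univ) {L : J1 E F π → ℝ}
    (hL : ContMDiff 𝓘(ℝ, JModel E F) 𝓘(ℝ, ℝ) ∞ L) {γ : J1 E F π} (hγ : γ.pt ∈ a.tot.source)
    (B : E →L[ℝ] F) :
    ContDiffAt ℝ ∞ (fun z : JModel E F => coordEndo (a.baseForm η z.1.1) z.2
      (fderiv ℝ (fderiv ℝ (L ∘ (a.jetHomeo γ₀).symm)) z (0, B))) (a.jetHomeo γ₀ γ) := by
  have hz : a.jetHomeo γ₀ γ ∈ (a.jetHomeo γ₀).target := (a.jetHomeo γ₀).map_source hγ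
  have hD := contDiffAt_fderiv_fderiv_apply ((a.contDiffOn_comp_jetHomeo_symm γ₀ hL).contDiffAt
    ((a.jetHomeo γ₀).open_target.mem_nhds hz)) (0, B)
  have hb : (a.jetHomeo γ₀ γ).1.1 ∈ a.base.target := by
    rw [a.jetHomeo_fst_fst γ₀ hγ]
    exact a.base.map_source (a.proj_mem _ hγ)
  have hρ : ContDiffAt ℝ ∞ (fun z : JModel E F => a.baseForm η z.1.1) (a.jetHomeo γ₀ γ) :=
    ContDiffAt.comp (g := a.baseForm η) (f := fun z : JModel E F => z.1.1) (a.jetHomeo γ₀ γ)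
      (a.contDiffAt_baseForm hη hb) contDiffAt_fst.fst
  exact ContDiffAt.comp (g := fun q : (E [⋀^Fin (n + 1)]→L[ℝ] ℝ) × (E →L[ℝ] F) ×
      (JModel E F →L[ℝ] ℝ) => coordEndo q.1 q.2.1 q.2.2)
    (f := fun z : JModel E F => (a.baseForm η z.1.1, z.2,
      fderiv ℝ (fderiv ℝ (L ∘ (a.jetHomeo γ₀).symm)) z (0, B))) (a.jetHomeo γ₀ γ)
    contDiff_coordEndo.contDiffAt (hρ.prodMk (contDiffAt_snd.prodMk hD))

set_option maxHeartbeats 1000000 in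
/-- Near a point `c₀` of `C`, the decomposition `w = T j u + ζ` of a vector `w` with
`i_ζ Ω_L = ∑ i, t i • Φ i` is the solution of a linear system with smooth coefficients in the
unknowns `u`, `ζ`, `t`. Hence `u` and `t` depend smoothly on the point. -/
theorem exists_smooth_decomposition [IsManifold 𝓘(ℝ, EC) ∞ C] (hn : Module.finrank ℝ E = n + 1)
    {η : X → E [⋀^Fin (n + 1)]→L[ℝ] ℝ} (hη : SmoothForm η Set.univ) {L : J1 E F π → ℝ}
    (hL : ContMDiff 𝓘(ℝ, JModel E F) 𝓘(ℝ, ℝ) ∞ L) (hC : IsSubmanifold EC C)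
    {Fc : C → Submodule ℝ (JModel E F [⋀^Fin (n + 1)]→L[ℝ] ℝ)}
    (hcompl : ∀ c : C, IsCompl (tangentSub EC C c) (constraintDist η L Fc c))
    {k : ℕ} {U : Set C} (hU : IsOpen U) {Φ : Fin k → C → JModel E F [⋀^Fin (n + 1)]→L[ℝ] ℝ}
    (hΦ : ∀ i, SmoothFormAlong EC (Subtype.val : C → J1 E F π) (Φ i) U)
    (hli : ∀ c ∈ U, LinearIndependent ℝ fun i => Φ i c)
    (hspan : ∀ c ∈ U, Fc c = Submodule.span ℝ (Set.range fun i => Φ i c))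
    {c₀ : C} (hc₀ : c₀ ∈ U) :
    ∃ (u : C → JModel E F →L[ℝ] EC) (t : C → JModel E F →L[ℝ] (Fin k → ℝ)),
      ContMDiffAt 𝓘(ℝ, EC) 𝓘(ℝ, JModel E F →L[ℝ] EC) ∞ u c₀ ∧
      ContMDiffAt 𝓘(ℝ, EC) 𝓘(ℝ, JModel E F →L[ℝ] (Fin k → ℝ)) ∞ t c₀ ∧
      ∀ᶠ c in 𝓝 c₀, ∀ w, dIncl EC c (chartFrame c₀ c (u c (chartCoframe c₀.1 c.1 w))) =
          nonholProjector EC η L Fc c w ∧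
        (poincareCartan η L c.1).curryLeft (w - nonholProjector EC η L Fc c w) =
          ∑ i, t c (chartCoframe c₀.1 c.1 w) i • Φ i c := by
  obtain ⟨a, hγ, ha⟩ := exists_adaptedChart_chartAt_eq c₀.1
  set e := a.jetHomeo c₀.1 with he
  let f : JModel E F → ℝ := L ∘ e.symm
  -- the linear system in coordinates
  let J : C → EC →L[ℝ] JModel E F := fun c =>
    chartCoframe c₀.1 c.1 ∘L dIncl EC c ∘L chartFrame c₀ c
  let Φ' : Fin k → C → JModel E F [⋀^Fin (n + 1)]→L[ℝ] ℝ := fun i c =>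
    (Φ i c).compContinuousLinearMap (chartFrame c₀.1 c.1)
  let K : C → (E →L[ℝ] F) → JModel E F [⋀^Fin (n + 1)]→L[ℝ] ℝ := fun c B =>
    coordEndo (a.baseForm η (e c.1).1.1) (e c.1).2 (fderiv ℝ (fderiv ℝ f) (e c.1) (0, B))
  let M : C → EC × (E →L[ℝ] F) × (Fin k → ℝ) →
      JModel E F × (JModel E F [⋀^Fin (n + 1)]→L[ℝ] ℝ) := fun c p =>
    (J c p.1 + (0, p.2.1), -K c p.2.1 - ∑ i, p.2.2 i • Φ' i c)
  have hframe : ∀ γ : J1 E F π, chartFrame c₀.1 γ = a.dJetSymm c₀.1 (e γ) := fun γ => by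
    rw [chartFrame, ha]; rfl
  have hcoframe : ∀ γ : J1 E F π, chartCoframe c₀.1 γ = a.dJet c₀.1 γ := fun γ => by
    rw [chartCoframe, ha]; rfl
  have hKΩ : ∀ c : C, c.1.pt ∈ a.tot.source → ∀ B,
      ((poincareCartan η L c.1).curryLeft (chartFrame c₀.1 c.1 (0, B))).compContinuousLinearMap
        (chartFrame c₀.1 c.1) = -K c B := fun c hc B => by
    rw [hframe]
    exact a.poincareCartan_curryLeft_eq c₀.1 hn hη hL hc B
  have hKadd : ∀ c B B', K c (B + B') = K c B + K c B' := fun c B B' => by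
    have h : ((0, B + B') : JModel E F) = (0, B) + (0, B') := by simp
    simp only [K, h, map_add, coordEndo_add]
  have hKsmul : ∀ c (r : ℝ) B, K c (r • B) = r • K c B := fun c r B => by
    have h : ((0, r • B) : JModel E F) = r • (0, B) := by simp
    simp only [K, h, map_smul, coordEndo_smul]
  have hlin : ∀ c, IsLinearMap ℝ (M c) := by
    intro c
    constructor
    · intro p q
      refine Prod.ext ?_ ?_
      · have h : ((0, (p + q).2.1) : JModel E F) = (0, p.2.1) + (0, q.2.1) := by simp
        simp only [M, h, Prod.fst_add, map_add]
        abel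
      · simp only [M, Prod.snd_add, Prod.fst_add, hKadd, Pi.add_apply, add_smul,
          Finset.sum_add_distrib]
        abel
    · intro r p
      refine Prod.ext ?_ ?_
      · have h : ((0, (r • p).2.1) : JModel E F) = r • (0, p.2.1) := by simp
        simp only [M, h, Prod.smul_fst, map_smul, smul_add]
      · simp only [M, Prod.smul_snd, Prod.smul_fst, hKsmul, Pi.smul_apply, smul_eq_mul, mul_smul,
          ← Finset.smul_sum]
        rw [smul_sub, smul_neg]
  have hez : ContMDiffAt 𝓘(ℝ, EC) 𝓘(ℝ, JModel E F) ∞ (fun c : C => e c.1) c₀ := by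
    have h1 : ContMDiffAt 𝓘(ℝ, JModel E F) 𝓘(ℝ, JModel E F) ∞ e c₀.1 :=
      contMDiffAt_of_mem_maximalAtlas (a.jetHomeo_mem_maximalAtlas c₀.1) hγ
    exact h1.comp c₀ hC.smooth.contMDiffAt
  have hJ : ContMDiffAt 𝓘(ℝ, EC) 𝓘(ℝ, EC →L[ℝ] JModel E F) ∞ J c₀ := contMDiffAt_dmap hC.smooth c₀
  have hΦ' : ∀ i, ContMDiffAt 𝓘(ℝ, EC) 𝓘(ℝ, JModel E F [⋀^Fin (n + 1)]→L[ℝ] ℝ) ∞ (Φ' i) c₀ :=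
    fun i => hΦ i c₀ hc₀
  have hK : ∀ B, ContMDiffAt 𝓘(ℝ, EC) 𝓘(ℝ, JModel E F [⋀^Fin (n + 1)]→L[ℝ] ℝ) ∞
      (fun c => K c B) c₀ := by
    intro B
    have h1 := a.contDiffAt_coordEndo_hessian c₀.1 hη hL hγ B
    exact ContMDiffAt.comp (f := fun c : C => e c.1) c₀ h1.contMDiffAt hez
  have hsmooth : ∀ p, ContMDiffAt 𝓘(ℝ, EC)
      𝓘(ℝ, JModel E F × (JModel E F [⋀^Fin (n + 1)]→L[ℝ] ℝ)) ∞ (fun c => M c p) c₀ := by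
    intro p
    have h1 : ContDiff ℝ ∞ (fun q : (JModel E F × (JModel E F [⋀^Fin (n + 1)]→L[ℝ] ℝ)) ×
        (Fin k → JModel E F [⋀^Fin (n + 1)]→L[ℝ] ℝ) =>
          (q.1.1 + (0, p.2.1), -q.1.2 - ∑ i, p.2.2 i • q.2 i)) :=
      (contDiff_fst.fst.add contDiff_const).prodMk (contDiff_fst.snd.neg.sub
        (ContDiff.sum fun i _ => ((contDiff_apply ℝ _ i).comp contDiff_snd).const_smul _))
    have h2 := ((hJ.clm_apply (contMDiffAt_const (c := p.1))).prodMk_space (hK p.2.1)).prodMk_space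
      (contMDiffAt_pi_space.2 hΦ')
    exact h1.contMDiff.contMDiffAt.comp c₀ h2
  have hev : ∀ᶠ c in 𝓝 c₀, c ∈ U ∧ c ∈ (chartAt EC c₀).source ∧ c.1.pt ∈ a.tot.source := by
    have h1 : ∀ᶠ c : C in 𝓝 c₀, c.1 ∈ e.source :=
      continuous_subtype_val.continuousAt.eventually (e.open_source.mem_nhds hγ)
    filter_upwards [hU.mem_nhds hc₀,
      (chartAt EC c₀).open_source.mem_nhds (mem_chart_source EC c₀), h1] with c h2 h3 h4
    exact ⟨h2, h3, h4⟩
  have hsrc : ∀ γ : J1 E F π, γ.pt ∈ a.tot.source → γ ∈ (chartAt (JModel E F) c₀.1).source :=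
    fun γ h => by rw [ha]; exact h
  have hsum : ∀ c (t : Fin k → ℝ), ∑ i, t i • Φ' i c =
      (∑ i, t i • Φ i c).compContinuousLinearMap (chartFrame c₀.1 c.1) := by
    intro c t
    ext v
    simp only [Φ', ContinuousAlternatingMap.sum_apply, ContinuousAlternatingMap.smul_apply,
      ContinuousAlternatingMap.compContinuousLinearMap_apply]
  -- a solution of the homogeneous system is a vector in the intersection of `T C` and `D`
  have hinj : ∀ p, M c₀ p = 0 → p = 0 := by
    rintro ⟨u, B, t⟩ h0
    have h1 : J c₀ u + (0, B) = 0 := congrArg Prod.fst h0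
    have h2 : -K c₀ B - ∑ i, t i • Φ' i c₀ = 0 := congrArg Prod.snd h0
    set ζ := chartFrame c₀.1 c₀.1 ((0, B) : JModel E F) with hζ
    have h3 : dIncl EC c₀ (chartFrame c₀ c₀ u) + ζ = 0 := by
      have := congrArg (chartFrame c₀.1 c₀.1) h1
      rw [map_add, map_zero] at this
      rwa [← chartFrame_chartCoframe (hsrc _ hγ) (dIncl EC c₀ (chartFrame c₀ c₀ u))]
    have h4 : (poincareCartan η L c₀.1).curryLeft ζ = ∑ i, t i • Φ i c₀ := by
      rw [← hKΩ c₀ hγ, hsum, sub_eq_zero] at h2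
      ext v
      have := congrArg (fun ψ : JModel E F [⋀^Fin (n + 1)]→L[ℝ] ℝ =>
        ψ (fun i => chartCoframe c₀.1 c₀.1 (v i))) h2
      simp only [ContinuousAlternatingMap.compContinuousLinearMap_apply, Function.comp_def,
        chartFrame_chartCoframe (hsrc _ hγ)] at this
      exact this
    have h5 : ζ ∈ constraintDist η L Fc c₀ := by
      have h6 : dmap (JModel E F) (E × F) (J1.pt : J1 E F π → Y) c₀.1 ζ = 0 := by
        rw [a.dmap_pt c₀.1 hγ, hζ, hframe, a.dJet_dJetSymm c₀.1 hγ, map_zero]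
      have h7 : (poincareCartan η L c₀.1).curryLeft ζ ∈ Fc c₀ := by
        rw [h4, hspan c₀ hc₀]
        exact Submodule.sum_mem _ fun i _ =>
          Submodule.smul_mem _ _ (Submodule.subset_span ⟨i, rfl⟩)
      exact ⟨h6, h7⟩
    have h6 : ζ ∈ tangentSub EC C c₀ := by
      rw [eq_neg_of_add_eq_zero_right h3]
      exact Submodule.neg_mem _ ⟨_, rfl⟩
    have h7 : ζ = 0 := (Submodule.disjoint_def.1 (hcompl c₀).disjoint) ζ h6 h5
    have hB : B = 0 := by
      have := chartCoframe_chartFrame (hsrc _ hγ) ((0, B) : JModel E F)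
      rw [← hζ, h7, map_zero] at this
      exact (congrArg Prod.snd this).symm
    have hu : u = 0 := by
      rw [h7, add_zero] at h3
      have h8 : chartFrame c₀ c₀ u = 0 := hC.immersion c₀ (h3.trans (map_zero _).symm)
      rw [← chartCoframe_chartFrame (mem_chart_source EC c₀) u, h8, map_zero]
    have ht : t = 0 := by
      rw [h7, map_zero] at h4
      exact funext (Fintype.linearIndependent_iff.1 (hli c₀ hc₀) t h4.symm)
    rw [hB, hu, ht]; rfl
  obtain ⟨G, hG, hGM⟩ := exists_smooth_leftInverse_of_apply hlin hsmooth hinj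
  let ι := ContinuousLinearMap.inl ℝ (JModel E F) (JModel E F [⋀^Fin (n + 1)]→L[ℝ] ℝ)
  refine ⟨fun c => ContinuousLinearMap.fst ℝ EC ((E →L[ℝ] F) × (Fin k → ℝ)) ∘L G c ∘L ι,
    fun c => (ContinuousLinearMap.snd ℝ (E →L[ℝ] F) (Fin k → ℝ) ∘L
      ContinuousLinearMap.snd ℝ EC ((E →L[ℝ] F) × (Fin k → ℝ))) ∘L G c ∘L ι,
    contMDiffAt_const.clm_comp (hG.clm_comp contMDiffAt_const),
    contMDiffAt_const.clm_comp (hG.clm_comp contMDiffAt_const), ?_⟩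
  filter_upwards [hGM, hev] with c hGc ⟨hcU, hcs, hca⟩ w
  obtain ⟨u, hu⟩ := nonholProjector_mem (hcompl c) w
  have hu' : dIncl EC c u = nonholProjector EC η L Fc c w := hu
  have hζD := sub_nonholProjector_mem (hcompl c) w
  set ζ := w - nonholProjector EC η L Fc c w with hζ
  have hζ1 : dmap (JModel E F) (E × F) (J1.pt : J1 E F π → Y) c.1 ζ = 0 := hζD.1
  have hζ2 : (poincareCartan η L c.1).curryLeft ζ ∈ Fc c := hζD.2
  rw [hspan c hcU, Submodule.mem_span_range_iff_exists_fun] at hζ2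
  obtain ⟨t, ht⟩ := hζ2
  have h1 : ((0, (chartCoframe c₀.1 c.1 ζ).2) : JModel E F) = chartCoframe c₀.1 c.1 ζ := by
    have := a.dTot_dmap_pt c₀.1 hca ζ
    rw [hζ1, map_zero, ← hcoframe] at this
    exact Prod.ext this rfl
  -- the components of `w` solve the linear system
  have h2 : M c (chartCoframe c₀ c u, (chartCoframe c₀.1 c.1 ζ).2, t) =
      (chartCoframe c₀.1 c.1 w, 0) := by
    refine Prod.ext ?_ ?_
    · change chartCoframe c₀.1 c.1 (dIncl EC c (chartFrame c₀ c (chartCoframe c₀ c u))) +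
        (0, (chartCoframe c₀.1 c.1 ζ).2) = chartCoframe c₀.1 c.1 w
      rw [h1, chartFrame_chartCoframe hcs, hu', hζ, map_sub]
      abel
    · change -K c (chartCoframe c₀.1 c.1 ζ).2 - ∑ i, t i • Φ' i c = 0
      rw [← hKΩ c hca, h1, chartFrame_chartCoframe (hsrc _ hca), hsum, ht, sub_self]
  have h3 : G c (chartCoframe c₀.1 c.1 w, 0) =
      (chartCoframe c₀ c u, (chartCoframe c₀.1 c.1 ζ).2, t) := by
    rw [← h2, hGc]
  constructor
  · change dIncl EC c (chartFrame c₀ c (G c (chartCoframe c₀.1 c.1 w, 0)).1) = _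
    rw [h3, chartFrame_chartCoframe hcs, hu']
  · change _ = ∑ i, (G c (chartCoframe c₀.1 c.1 w, 0)).2.2 i • Φ i c
    rw [h3, ht]

end Nonholonomic

/-! ### The nonholonomic solution -/

section Solution

variable {E F : Type*} [NormedAddCommGroup E] [NormedSpace ℝ E] [FiniteDimensional ℝ E]
  [NormedAddCommGroup F] [NormedSpace ℝ F] [FiniteDimensional ℝ F]
  {X Y : Type*} [TopologicalSpace X] [ChartedSpace E X]
  [TopologicalSpace Y] [ChartedSpace (E × F) Y]
  [IsManifold 𝓘(ℝ, E) ∞ X] [IsManifold 𝓘(ℝ, E × F) ∞ Y]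
  {π : Y → X} [IsSmoothFibreBundle E (E × F) F π] {n : ℕ}
  {EC : Type*} [NormedAddCommGroup EC] [NormedSpace ℝ EC] [FiniteDimensional ℝ EC]
  {C : Set (J1 E F π)} [ChartedSpace EC C]
  {η : X → E [⋀^Fin (n + 1)]→L[ℝ] ℝ} {L : J1 E F π → ℝ}
  {Fc : C → Submodule ℝ (JModel E F [⋀^Fin (n + 1)]→L[ℝ] ℝ)}
  {h : J1 E F π → JModel E F →L[ℝ] JModel E F}

theorem contactMap_eq_of_dmap_pt_eq {γ : J1 E F π} {v w : JModel E F}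
    (hvw : dmap (JModel E F) (E × F) (J1.pt : J1 E F π → Y) γ v =
      dmap (JModel E F) (E × F) (J1.pt : J1 E F π → Y) γ w) :
    contactMap γ v = contactMap γ w := by
  simp only [contactMap, sub_apply, ContinuousLinearMap.comp_apply, hvw]

/-- A horizontal projector does not see the difference between a vector and its nonholonomic
projection, as this difference is vertical. -/
theorem horizontal_nonholProjector
    (hh : IsHorizontalProjector E (JModel E F) (J1.base : J1 E F π → X) h) {c : C}
    (hc : IsCompl (tangentSub EC C c) (constraintDist η L Fc c)) (w : JModel E F) :
    h c.1 (nonholProjector EC η L Fc c w) = h c.1 w := by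
  rw [← sub_eq_zero, ← map_sub, hh.ker_eq, map_sub, dmap_base, dmap_base,
    dmap_pt_nonholProjector hc, sub_self]

/-- A horizontal projector, in frames, along the submanifold `C`. -/
theorem IsHorizontalProjector.contMDiffAt_along
    (hh : IsHorizontalProjector E (JModel E F) (J1.base : J1 E F π → X) h)
    (hC : IsSubmanifold EC C) (c₀ : C) :
    ContMDiffAt 𝓘(ℝ, EC) 𝓘(ℝ, JModel E F →L[ℝ] JModel E F) ∞
      (fun c : C => chartCoframe c₀.1 c.1 ∘L h c.1 ∘L chartFrame c₀.1 c.1) c₀ :=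
  ContMDiffAt.comp (f := (Subtype.val : C → J1 E F π)) c₀
    ((contMDiff_endomorphism_iff h).1 hh.smooth c₀.1) hC.smooth.contMDiffAt

theorem eventually_mem_chart_source (c₀ : C) :
    ∀ᶠ c : C in 𝓝 c₀, c.1 ∈ (chartAt (JModel E F) c₀.1).source :=
  continuous_subtype_val.continuousAt.eventually
    ((chartAt (JModel E F) c₀.1).open_source.mem_nhds (mem_chart_source _ c₀.1))

/-- The nonholonomic projection of a solution of the De Donder–Weyl equation solves this equation
modulo the ideal of the constraint forms. -/
theorem memConstraintIdeal_nonholProjector [IsManifold 𝓘(ℝ, EC) ∞ C]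
    (hn : Module.finrank ℝ E = n + 1) (hη : SmoothForm η Set.univ)
    (hL : ContMDiff 𝓘(ℝ, JModel E F) 𝓘(ℝ, ℝ) ∞ L) (hC : IsSubmanifold EC C) {k : ℕ}
    (hF : IsConstraintBundle EC η k Fc)
    (hcompl : ∀ c : C, IsCompl (tangentSub EC C c) (constraintDist η L Fc c))
    (hh : IsHorizontalProjector E (JModel E F) (J1.base : J1 E F π → X) h)
    (hDDW : ∀ γ, insertEnd (h γ) (poincareCartan η L γ) = (n : ℝ) • poincareCartan η L γ) :
    MemConstraintIdeal EC Fc (fun c =>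
      insertEnd (nonholProjector EC η L Fc c ∘L h c.1) (poincareCartan η L c.1) -
        (n : ℝ) • poincareCartan η L c.1) := by
  intro c₀
  obtain ⟨U, hU, hc₀, Φ, hΦ, hpt⟩ := hF c₀
  have hdec := fun c (hc : c ∈ U) => exists_smooth_decomposition hn hη hL hC hcompl hU hΦ
    (fun c hc => (hpt c hc).2.1) (fun c hc => (hpt c hc).2.2) hc
  -- the coefficients of `i_ζ Ω_L` in the basis `Φ i`, where `ζ` is the component of `w` in `D`
  have hT : ∀ c, ∃ T : JModel E F →L[ℝ] (Fin k → ℝ), c ∈ U → ∀ w,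
      (poincareCartan η L c.1).curryLeft (w - nonholProjector EC η L Fc c w) =
        ∑ i, T w i • Φ i c := by
    intro c
    by_cases hc : c ∈ U
    · obtain ⟨u, t, -, -, hev⟩ := hdec c hc
      exact ⟨t c ∘L chartCoframe c.1 c.1, fun _ w => (hev.self_of_nhds w).2⟩
    · exact ⟨0, fun h => absurd h hc⟩
  choose T hT using hT
  refine ⟨U, hU, hc₀, k, fun i c => ContinuousAlternatingMap.ofSubsingleton ℝ (JModel E F) ℝ 0
    (-(ContinuousLinearMap.proj i ∘L T c ∘L h c.1)), Φ, ?_, hΦ, ?_⟩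
  · intro i s hs
    obtain ⟨u, t, -, ht, hev⟩ := hdec s hs
    have h1 : ContMDiffAt 𝓘(ℝ, EC) 𝓘(ℝ, JModel E F →L[ℝ] ℝ) ∞ (fun c : C =>
        ContinuousLinearMap.proj i ∘L t c ∘L (chartCoframe s.1 c.1 ∘L h c.1 ∘L chartFrame s.1 c.1))
        s := contMDiffAt_const.clm_comp (ht.clm_comp (hh.contMDiffAt_along hC s))
    have h2 : ContDiff ℝ ∞ (fun α : JModel E F →L[ℝ] ℝ =>
        ContinuousAlternatingMap.ofSubsingleton ℝ (JModel E F) ℝ (0 : Fin 1) (-α)) :=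
      contDiff_alternating_of_apply fun v => (contDiff_id.clm_apply contDiff_const).neg
    refine ContMDiffAt.congr_of_eventuallyEq (ContMDiffAt.comp
      (g := fun α : JModel E F →L[ℝ] ℝ =>
        ContinuousAlternatingMap.ofSubsingleton ℝ (JModel E F) ℝ (0 : Fin 1) (-α)) s
      h2.contMDiff.contMDiffAt h1) ?_
    filter_upwards [hev, hU.mem_nhds hs] with c hc hcU
    ext v
    have h3 : t c (chartCoframe s.1 c.1 (h c.1 (chartFrame s.1 c.1 (v 0)))) =
        T c (h c.1 (chartFrame s.1 c.1 (v 0))) := by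
      have h4 := (hc (h c.1 (chartFrame s.1 c.1 (v 0)))).2
      rw [hT c hcU] at h4
      exact funext ((hpt c hcU).2.1.eq_coords_of_eq h4.symm)
    change -(T c (h c.1 (chartFrame s.1 c.1 (v 0))) i) =
      -(t c (chartCoframe s.1 c.1 (h c.1 (chartFrame s.1 c.1 (v 0)))) i)
    rw [h3]
  · intro c hc
    refine ⟨fun i => ?_, ?_⟩
    · rw [(hpt c hc).2.2]
      exact Submodule.subset_span ⟨i, rfl⟩
    · beta_reduce
      rw [← hDDW c.1, ← insertEnd_sub]
      refine insertEnd_eq_sum_covWedge _ _ _ _ fun w => ?_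
      have h1 : (nonholProjector EC η L Fc c ∘L h c.1 - h c.1) w =
          -(h c.1 w - nonholProjector EC η L Fc c (h c.1 w)) := by
        simp
      rw [h1, map_neg, hT c hc, ← Finset.sum_neg_distrib]
      refine Finset.sum_congr rfl fun i _ => ?_
      rw [← neg_smul]
      rfl

/-- The endomorphism `P ∘ h` restricts to the tangent spaces of `C`. Injectivity of the tangent map of
the inclusion makes the restriction unique. -/
theorem exists_dIncl_eq (hC : IsSubmanifold EC C)
    (hcompl : ∀ c : C, IsCompl (tangentSub EC C c) (constraintDist η L Fc c)) (c : C) :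
    ∃ A : EC →L[ℝ] EC, ∀ v, dIncl EC c (A v) =
      nonholProjector EC η L Fc c (h c.1 (dIncl EC c v)) := by
  obtain ⟨R, hR⟩ := exists_leftInverse_clm (dIncl EC c) (hC.immersion c)
  refine ⟨R ∘L nonholProjector EC η L Fc c ∘L h c.1 ∘L dIncl EC c, fun v => ?_⟩
  obtain ⟨u, hu⟩ := nonholProjector_mem (hcompl c) (h c.1 (dIncl EC c v))
  have hu' : dIncl EC c u = nonholProjector EC η L Fc c (h c.1 (dIncl EC c v)) := hu
  simp only [ContinuousLinearMap.comp_apply]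
  rw [← hu']
  exact congrArg (dIncl EC c) (congrArg (fun f : EC →L[ℝ] EC => f u) hR)

/-- The restriction of `P ∘ h` to the tangent spaces of `C` is a smooth horizontal projector. -/
theorem isHorizontalProjector_restrict [IsManifold 𝓘(ℝ, EC) ∞ C]
    (hn : Module.finrank ℝ E = n + 1) (hη : SmoothForm η Set.univ)
    (hL : ContMDiff 𝓘(ℝ, JModel E F) 𝓘(ℝ, ℝ) ∞ L) (hC : IsSubmanifold EC C) {k : ℕ}
    (hF : IsConstraintBundle EC η k Fc)
    (hcompl : ∀ c : C, IsCompl (tangentSub EC C c) (constraintDist η L Fc c))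
    (hh : IsHorizontalProjector E (JModel E F) (J1.base : J1 E F π → X) h)
    {hP : C → EC →L[ℝ] EC} (hPh : ∀ c v, dIncl EC c (hP c v) =
      nonholProjector EC η L Fc c (h c.1 (dIncl EC c v))) :
    IsHorizontalProjector E EC (fun c : C => c.1.base) hP := by
  refine ⟨(contMDiff_endomorphism_iff hP).2 fun c₀ => ?_, fun c v => ?_, fun c v => ?_⟩
  · obtain ⟨U, hU, hc₀, Φ, hΦ, hpt⟩ := hF c₀
    obtain ⟨u, t, hu, -, hev⟩ := exists_smooth_decomposition hn hη hL hC hcompl hU hΦ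
      (fun c hc => (hpt c hc).2.1) (fun c hc => (hpt c hc).2.2) hc₀
    have h1 := hu.clm_comp ((hh.contMDiffAt_along hC c₀).clm_comp (contMDiffAt_dmap hC.smooth c₀))
    refine h1.congr_of_eventuallyEq ?_
    filter_upwards [hev, eventually_mem_chart_source c₀,
      (chartAt EC c₀).open_source.mem_nhds (mem_chart_source EC c₀)] with c hc hcs hcC
    refine ContinuousLinearMap.ext fun v => ?_
    have h2 := (hc (h c.1 (dIncl EC c (chartFrame c₀ c v)))).1
    rw [← hPh] at h2
    have h3 := congrArg (chartCoframe c₀ c) (hC.immersion c h2)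
    rw [chartCoframe_chartFrame hcC] at h3
    simp only [ContinuousLinearMap.comp_apply]
    rw [chartFrame_chartCoframe hcs, ← h3]
  · refine hC.immersion c ?_
    change dIncl EC c (hP c (hP c v)) = dIncl EC c (hP c v)
    rw [hPh, hPh, horizontal_nonholProjector hh (hcompl c), hh.idem]
  · have h1 : dmap EC E (fun c : C => c.1.base) c v =
        dmap (JModel E F) E (J1.base : J1 E F π → X) c.1 (dIncl EC c v) :=
      congrArg (fun f : EC →L[ℝ] E => f v) (mfderiv_comp c
        (contMDiff_base.mdifferentiableAt (by simp)) (hC.smooth.mdifferentiableAt (by simp)))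
    rw [h1, ← hh.ker_eq]
    constructor
    · intro h0
      have h2 := hPh c v
      rw [h0, map_zero] at h2
      rw [← hh.idem, ← horizontal_nonholProjector hh (hcompl c), ← h2, map_zero]
    · intro h0
      refine hC.immersion c ?_
      change dIncl EC c (hP c v) = dIncl EC c 0
      rw [hPh, h0, map_zero, map_zero]

/-- The restricted connection is semi-holonomic, since the free solution is, and the nonholonomic
projector only changes vectors by `π₁₀`-vertical ones, on which contact forms vanish. -/
theorem isSemiholonomic_restrict
    (hn : Module.finrank ℝ E = n + 1) (hη : SmoothForm η Set.univ) (hη0 : ∀ x, η x ≠ 0)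
    (hL : ContMDiff 𝓘(ℝ, JModel E F) 𝓘(ℝ, ℝ) ∞ L) (hreg : IsRegularLagrangian L)
    (hcompl : ∀ c : C, IsCompl (tangentSub EC C c) (constraintDist η L Fc c))
    (hh : IsHorizontalProjector E (JModel E F) (J1.base : J1 E F π → X) h)
    (hDDW : ∀ γ, insertEnd (h γ) (poincareCartan η L γ) = (n : ℝ) • poincareCartan η L γ)
    {hP : C → EC →L[ℝ] EC} (hPh : ∀ c v, dIncl EC c (hP c v) =
      nonholProjector EC η L Fc c (h c.1 (dIncl EC c v))) :
    IsSemiholonomic EC hP := by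
  intro W θ _ hθ c hcW
  have : Nontrivial E := Module.nontrivial_of_finrank_pos (R := ℝ) (by omega)
  ext v
  rw [insertEnd_apply, Fin.sum_univ_one]
  have h1 : dIncl EC c ∘ Function.update v 0 (hP c (v 0)) =
      fun _ => nonholProjector EC η L Fc c (h c.1 (dIncl EC c (v 0))) := by
    funext i
    rw [Fin.fin_one_eq_zero i, Function.comp_apply, Function.update_self, hPh]
  rw [ContinuousAlternatingMap.compContinuousLinearMap_apply]
  refine (congrArg (θ c.1) h1).trans ?_
  refine hθ.apply_eq_zero hcW ?_
  rw [contactMap_eq_of_dmap_pt_eq (dmap_pt_nonholProjector (hcompl c) _)]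
  exact contactMap_horizontal_eq_zero hn hη hL hreg c.1 (hη0 _) (h c.1) (hh.idem _) (hh.ker_eq _)
    (hDDW _) _

end Solution

end JetField

end

open JetField in
theorem mainTheorem1
    {E F X Y EC K : Type*}
    [NormedAddCommGroup E] [NormedSpace ℝ E] [FiniteDimensional ℝ E]
    [NormedAddCommGroup F] [NormedSpace ℝ F] [FiniteDimensional ℝ F]
    [NormedAddCommGroup EC] [NormedSpace ℝ EC] [FiniteDimensional ℝ EC]
    [NormedAddCommGroup K] [NormedSpace ℝ K]
    -- the fibre bundle `π : Y → X` over a manifold of dimension `n + 1`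
    [TopologicalSpace X] [ChartedSpace E X] [IsManifold 𝓘(ℝ, E) ∞ X]
    [TopologicalSpace Y] [ChartedSpace (E × F) Y] [IsManifold 𝓘(ℝ, E × F) ∞ Y]
    (n : ℕ) (hn : Module.finrank ℝ E = n + 1)
    (π : Y → X) [IsSmoothFibreBundle E (E × F) F π]
    -- the volume form
    (η : X → E [⋀^Fin (n + 1)]→L[ℝ] ℝ) (hη : SmoothForm η Set.univ) (hη0 : ∀ x, η x ≠ 0)
    -- the regular Lagrangian
    (L : J1 E F π → ℝ) (hL : ContMDiff 𝓘(ℝ, JModel E F) 𝓘(ℝ, ℝ) ∞ L) (hreg : IsRegularLagrangian L)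
    -- the constraint submanifold of codimension `k`, a fibre bundle over `Y`
    (C : Set (J1 E F π)) [ChartedSpace EC C] [IsManifold 𝓘(ℝ, EC) ∞ C]
    (hC : IsSubmanifold EC C)
    (k : ℕ) (hk : Module.finrank ℝ EC + k = Module.finrank ℝ (JModel E F))
    (hCY : IsSmoothFibreBundle (E × F) EC K (fun c : C => c.1.pt))
    -- the bundle of constraint forms and the compatibility condition
    (Fc : C → Submodule ℝ (JModel E F [⋀^Fin (n + 1)]→L[ℝ] ℝ))
    (hF : IsConstraintBundle EC η k Fc)
    (hcomp : ∀ c : C, constraintDist η L Fc c ⊓ tangentSub EC C c = ⊥)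
    -- a solution of the free De Donder-Weyl equation
    (h : J1 E F π → JModel E F →L[ℝ] JModel E F)
    (hh : IsHorizontalProjector E (JModel E F) (J1.base : J1 E F π → X) h)
    (hDDW : ∀ γ, insertEnd (h γ) (poincareCartan η L γ) = (n : ℝ) • poincareCartan η L γ) :
    -- the nonholonomic projector is well defined
    (∀ c : C, IsCompl (tangentSub EC C c) (constraintDist η L Fc c)) ∧
    -- `P ∘ h` is a projector along `C`, with kernel the `π₁`-vertical vectors
    (∀ (c : C) v, (nonholProjector EC η L Fc c ∘L h c.1)
        ((nonholProjector EC η L Fc c ∘L h c.1) v) =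
          (nonholProjector EC η L Fc c ∘L h c.1) v) ∧
    (∀ (c : C) v, (nonholProjector EC η L Fc c ∘L h c.1) v = 0 ↔
        dmap (JModel E F) E (J1.base : J1 E F π → X) c.1 v = 0) ∧
    -- it solves the nonholonomic De Donder-Weyl problem
    MemConstraintIdeal EC Fc (fun c =>
      insertEnd (nonholProjector EC η L Fc c ∘L h c.1) (poincareCartan η L c.1) -
        (n : ℝ) • poincareCartan η L c.1) ∧
    (∀ (c : C) v, (nonholProjector EC η L Fc c ∘L h c.1) v ∈ tangentSub EC C c) ∧
    -- it restricts to the horizontal projector of a semi-holonomic connection on `C → X`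
    ∃ hP : C → EC →L[ℝ] EC,
      (∀ (c : C) v, dmap EC (JModel E F) (Subtype.val : C → J1 E F π) c (hP c v) =
        (nonholProjector EC η L Fc c ∘L h c.1)
          (dmap EC (JModel E F) (Subtype.val : C → J1 E F π) c v)) ∧
      IsHorizontalProjector E EC (fun c : C => c.1.base) hP ∧
      IsSemiholonomic EC hP := by
  have hcompl : ∀ c : C, IsCompl (tangentSub EC C c) (constraintDist η L Fc c) := fun c =>
    isCompl_tangentSub_constraintDist hn hη hL hreg hC hk hF c (hcomp c)
  choose hP hPh using exists_dIncl_eq (h := h) hC hcompl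
  refine ⟨hcompl, fun c v => ?_, fun c v => ?_,
    memConstraintIdeal_nonholProjector hn hη hL hC hF hcompl hh hDDW,
    fun c v => nonholProjector_mem (hcompl c) _, hP, hPh,
    isHorizontalProjector_restrict hn hη hL hC hF hcompl hh hPh,
    isSemiholonomic_restrict hn hη hη0 hL hreg hcompl hh hDDW hPh⟩
  · simp only [ContinuousLinearMap.comp_apply]
    rw [horizontal_nonholProjector hh (hcompl c), hh.idem]
  · simp only [ContinuousLinearMap.comp_apply]
    rw [← hh.ker_eq]
    refine ⟨fun h0 => ?_, fun h0 => by rw [h0, map_zero]⟩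
    rw [← hh.idem, ← horizontal_nonholProjector hh (hcompl c), h0, map_zero]
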